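/- There exist three positive numerical constants $c,c',c''$ such that the following holds. Let $n,p\ge 0$ and $K\ge 2$ be integers, let $G=(G_1,\dots,G_K)$ be a partition of $\{1,\dots,n\}$ into $K$ nonempty groups, $m=\min_k|G_k|$, let $\mu_1,\dots,\mu_K\in\mathbb R^p$, let $\Sigma_1,\dots,\Sigma_K\in\mathbb R^{p\times p}$ be positive definite, and let $L>0$. Let $X_1,\dots,X_n$ be independent random vectors in $\mathbb R^p$ such that, for $a\in G_k$, $X_a=\mu_k+E_a$ with $E_a$ centered with covariance $\Sigma_k$, and such that the coordinates $Z_1,\dots,Z_p$ of $Z=\Sigma_k^{-1/2}E_a$ are independent and satisfy $\mathbb E[e^{tZ_i}]\le e^{L^2t^2/2}$ for all $t\in\mathbb R$ and all $i$. Set $$\Delta=\min_{j\ne k}\|\mu_j-\mu_k\|,\quad \sigma^2=L^2\max_k|\Sigma_k|_{op},\quad \nu^2=L^2\max_k|\Sigma_k|_F,\quad s^2=\frac{\Delta^2}{\sigma^2}\wedge\frac{m\Delta^4}{\nu^4},$$ let $\Gamma$ be the $n\times n$ diagonal matrix with $\Gamma_{aa}=\mathrm{Tr}(\Sigma_k)$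 for $a\in G_k$, and for a diagonal matrix $D$ write $|D|_V=\max_aD_{aa}-\min_aD_{aa}$. Let $\mathbf X\in\mathbb R^{n\times p}$ be the matrix with rows $X_1,\dots,X_n$. Assume that $s^2\ge c''n/m$. Then, with probability at least $1-c/n^2$, the following holds simultaneously for all diagonal matrices $\widehat\Gamma\in\mathbb R^{n\times n}$ (possibly depending on the data; $\widehat\Gamma=0$ is allowed) satisfying $$\Delta^2\ge \frac{64\,|\Gamma-\widehat\Gamma|_V}{m},$$ for all $$\widehat B\in\mathop{\mathrm{argmax}}_{B\in\mathcal C}\ \langle \mathbf X\mathbf X^T-\widehat\Gamma,B\rangle,\qquad \mathcal C=\{B\in\mathbb R^{n\times n}:\ B \text{ positive semidefinite},\ \mathrm{Tr}(B)=K,\ B1=1,\ B_{ab}\ge 0 \text{ for all } a,b\},$$ where $\langle A,B\rangle=\sum_{a,b}A_{ab}B_{ab}$, and for all partitions $\widehat G=(\widehat G_1,\dots,\widehat G_K)$ of $\{1,\dots,n\}$ into $K$ nonempty groups obtained from a $7$-approximate $K$-medoids on the rows of $\widehat B$: $$err(\widehat G,G):=\min_{\pi\in\mathcal S_K}\frac1{2n}\sum_{k=1}^K|G_k\bigtriangleup\widehat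 G_{\pi(k)}|\ \le\ e^{-c's^2}.$$ Here $\widehat G$ is obtained from a $7$-approximate $K$-medoids on the rows of $\widehat B$ if its partition matrix $\widehat A=(\mathbf 1_{i\in\widehat G_k})_{ik}\in\mathbb R^{n\times K}$ and some matrix $\widehat M\in\mathbb R^{K\times n}$, each of whose rows is a row of $\widehat B$, satisfy $|\widehat A\widehat M-\widehat B|_1\le 7\min_{A,M}|AM-\widehat B|_1$, where the minimum is over all partition matrices $A$ of partitions of $\{1,\dots,n\}$ into $K$ nonempty groups and all $M\in\mathbb R^{K\times n}$ each of whose rows is a row of $\widehat B$, and $|\cdot|_1$ is the sum of the absolute values of the entries. -/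

import Mathlib

open MeasureTheory ProbabilityTheory
open scoped NNReal Matrix MatrixOrder

noncomputable section

namespace SubGMixture

/-- An ordered partition of `{1,…,n}` into `K` nonempty groups, encoded by the map sending a point
to the index of its group. -/
structure LabeledPartition (n K : ℕ) where
  label : Fin n → Fin K
  surj : Function.Surjective label

/-- The `k`-th group `G_k`. -/
def LabeledPartition.group {n K : ℕ} (G : LabeledPartition n K) (k : Fin K) : Finset (Fin n) :=
  {a | G.label a = k}

/-- The size `m = min_k |G_k|` of the smallest group. -/
def LabeledPartition.minSize {n K : ℕ} (G : LabeledPartition n K) : ℕ :=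
  ⨅ k, (G.group k).card

/-- The partition matrix `A` with `A_{ik} = 1` if `i ∈ G_k` and `0` otherwise. -/
def LabeledPartition.matrix {n K : ℕ} (G : LabeledPartition n K) : Matrix (Fin n) (Fin K) ℝ :=
  Matrix.of fun i k => if i ∈ G.group k then 1 else 0

/-- The misclassification proportion
`err(Ĝ, G) = min_π (1 / (2n)) ∑_k |G_k ∆ Ĝ_{π(k)}|`, over the permutations `π` of the indices. -/
def err {n K : ℕ} (Ghat G : LabeledPartition n K) : ℝ :=
  ⨅ π : Equiv.Perm (Fin K),
    1 / (2 * (n : ℝ)) * ∑ k, ((symmDiff (G.group k) (Ghat.group (π k))).card : ℝ)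

/-- The entrywise `ℓ¹` norm. -/
def entryNorm1 {ι κ : Type*} [Fintype ι] [Fintype κ] (M : Matrix ι κ ℝ) : ℝ :=
  ∑ i, ∑ j, |M i j|

/-- The canonical inner product `⟨A, B⟩ = ∑_{ab} A_{ab} B_{ab}`. -/
def entryInner {ι κ : Type*} [Fintype ι] [Fintype κ] (A B : Matrix ι κ ℝ) : ℝ :=
  ∑ i, ∑ j, A i j * B i j

/-- The Frobenius norm. -/
def frobNorm {ι κ : Type*} [Fintype ι] [Fintype κ] (M : Matrix ι κ ℝ) : ℝ :=
  Real.sqrt (∑ i, ∑ j, M i j ^ 2)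

/-- The operator norm with respect to the Euclidean norm. -/
def opNorm {p : ℕ} (M : Matrix (Fin p) (Fin p) ℝ) : ℝ :=
  ‖Matrix.toEuclideanCLM (n := Fin p) (𝕜 := ℝ) M‖

/-- The pseudo-norm `|D|_V = max_a D_{aa} - min_a D_{aa}`. -/
def vNorm {n : ℕ} (D : Matrix (Fin n) (Fin n) ℝ) : ℝ :=
  (⨆ a, D a a) - ⨅ a, D a a

/-- The feasible set `𝒞` of the relaxed `K`-means program. -/
def feasible (n K : ℕ) : Set (Matrix (Fin n) (Fin n) ℝ) :=
  {B | B.PosSemidef ∧ B.trace = K ∧ B *ᵥ 1 = 1 ∧ ∀ a b, 0 ≤ B a b}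

/-- `Bhat ∈ argmax_{B ∈ 𝒞} ⟨𝐗𝐗ᵀ - Γhat, B⟩`; plain relaxed `K`-means is the case `Γhat = 0`. -/
def IsPecokSolution {n p : ℕ} (K : ℕ) (X : Matrix (Fin n) (Fin p) ℝ)
    (Γhat Bhat : Matrix (Fin n) (Fin n) ℝ) : Prop :=
  Bhat ∈ feasible n K ∧ IsMaxOn (fun B => entryInner (X * Xᵀ - Γhat) B) (feasible n K) Bhat

/-- `(A, M)`, with `A` the partition matrix of `Ghat`, is a `ρ`-approximate `K`-medoids on the rows
of `B`: the rows of `M` are rows of `B`, and `|AM - B|₁` is at most `ρ` times the minimal value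
of `|A'M' - B|₁` over partition matrices `A'` and matrices `M'` whose rows are rows of `B`. -/
def IsApproxMedoids {n K : ℕ} (ρ : ℝ) (B : Matrix (Fin n) (Fin n) ℝ)
    (Ghat : LabeledPartition n K) (M : Matrix (Fin K) (Fin n) ℝ) : Prop :=
  Set.range M.row ⊆ Set.range B.row ∧
    ∀ (G' : LabeledPartition n K) (M' : Matrix (Fin K) (Fin n) ℝ),
      Set.range M'.row ⊆ Set.range B.row →
        entryNorm1 (Ghat.matrix * M - B) ≤ ρ * entryNorm1 (G'.matrix * M' - B)

/-- `Ghat` comes from some `7`-approximate `K`-medoids on the rows of some solution of the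
(debiased) relaxed `K`-means program with data matrix `X` and correction `Γhat`. -/
def IsClusteringOutput {n p K : ℕ} (X : Matrix (Fin n) (Fin p) ℝ)
    (Γhat : Matrix (Fin n) (Fin n) ℝ) (Ghat : LabeledPartition n K) : Prop :=
  ∃ (Bhat : Matrix (Fin n) (Fin n) ℝ) (Mhat : Matrix (Fin K) (Fin n) ℝ),
    IsPecokSolution K X Γhat Bhat ∧ IsApproxMedoids 7 Bhat Ghat Mhat

/-- The matrix whose `a`-th row is the vector `X a`. -/
def dataMatrix {n p : ℕ} (X : Fin n → EuclideanSpace ℝ (Fin p)) : Matrix (Fin n) (Fin p) ℝ :=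
  Matrix.of fun a i => X a i

/-- `Z` has independent coordinates with `𝔼[exp(t Z_i)] ≤ exp(L² t² / 2)` for all real `t`, all
these exponentials being integrable. -/
def IsSubG {Ω : Type*} [MeasurableSpace Ω] (P : Measure Ω) {p : ℕ} (L : ℝ≥0)
    (Z : Ω → Fin p → ℝ) : Prop :=
  iIndepFun (fun i ω => Z ω i) P ∧ ∀ i, HasSubgaussianMGF (fun ω => Z ω i) (L ^ 2) P

/-- The noise `E_a = X_a - μ_k`, `a ∈ G_k`, rescaled by `Σ_k^{-1/2}`. -/
def whitenedNoise {Ω : Type*} {n K p : ℕ} (X : Fin n → Ω → EuclideanSpace ℝ (Fin p))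
    (G : LabeledPartition n K) (mu : Fin K → EuclideanSpace ℝ (Fin p))
    (Sigma : Fin K → Matrix (Fin p) (Fin p) ℝ) (a : Fin n) (ω : Ω) : Fin p → ℝ :=
  (CFC.sqrt (Sigma (G.label a)))⁻¹ *ᵥ (X a ω - mu (G.label a)).ofLp

/-- The sub-Gaussian mixture model with partition `G`, centers `mu`, invertible covariances
`Sigma` and sub-Gaussian constant `L`. -/
structure IsSubGaussianMixture {Ω : Type*} [MeasurableSpace Ω] (P : Measure Ω) {n K p : ℕ}
    (X : Fin n → Ω → EuclideanSpace ℝ (Fin p)) (G : LabeledPartition n K)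
    (mu : Fin K → EuclideanSpace ℝ (Fin p)) (Sigma : Fin K → Matrix (Fin p) (Fin p) ℝ)
    (L : ℝ≥0) : Prop where
  measurable : ∀ a, Measurable (X a)
  indep : iIndepFun X P
  mean : ∀ a, ∫ ω, X a ω ∂P = mu (G.label a)
  posDef : ∀ k, (Sigma k).PosDef
  covariance : ∀ a i j,
    cov[fun ω => X a ω i, fun ω => X a ω j; P] = Sigma (G.label a) i j
  subG : ∀ a, IsSubG P L (whitenedNoise X G mu Sigma a)

/-- `Δ = min_{j ≠ k} ‖μ_j - μ_k‖`. -/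
def minSep {K p : ℕ} (mu : Fin K → EuclideanSpace ℝ (Fin p)) : ℝ :=
  ⨅ q : {q : Fin K × Fin K // q.1 ≠ q.2}, ‖mu q.1.1 - mu q.1.2‖

/-- `σ² = L² max_k |Σ_k|_op`. -/
def sigmaSq {K p : ℕ} (L : ℝ≥0) (Sigma : Fin K → Matrix (Fin p) (Fin p) ℝ) : ℝ :=
  (L : ℝ) ^ 2 * ⨆ k, opNorm (Sigma k)

/-- `ν² = L² max_k |Σ_k|_F`. -/
def nuSq {K p : ℕ} (L : ℝ≥0) (Sigma : Fin K → Matrix (Fin p) (Fin p) ℝ) : ℝ :=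
  (L : ℝ) ^ 2 * ⨆ k, frobNorm (Sigma k)

/-- The signal-to-noise ratio `s² = Δ² / σ² ∧ m Δ⁴ / ν⁴`. -/
def snrSq {n K p : ℕ} (G : LabeledPartition n K) (mu : Fin K → EuclideanSpace ℝ (Fin p))
    (Sigma : Fin K → Matrix (Fin p) (Fin p) ℝ) (L : ℝ≥0) : ℝ :=
  min (minSep mu ^ 2 / sigmaSq L Sigma) ((G.minSize : ℝ) * minSep mu ^ 4 / nuSq L Sigma ^ 2)

/-- The diagonal matrix `Γ` with `Γ_{aa} = Tr(Σ_k)` for `a ∈ G_k`. -/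
def gammaMatrix {n K p : ℕ} (G : LabeledPartition n K)
    (Sigma : Fin K → Matrix (Fin p) (Fin p) ℝ) : Matrix (Fin n) (Fin n) ℝ :=
  Matrix.diagonal fun a => (Sigma (G.label a)).trace

end SubGMixture

end

/-! Write B* for `truth G`, the normalized membership matrix. It is feasible, so a maximizer B
satisfies ⟨XXᵀ - Γ̂, B - B*⟩ ≥ 0. The error of B is measured by δ = `offMass G B`, the weight that
the columns of B put outside their own group. Expanding X around the centers splits XXᵀ - Γ̂ into a
term from the centers, two cross terms, W = EEᵀ - Γ and Γ - Γ̂. The centers contribute at most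
-Δ²δ/2 (`entryInner_centers`), the diagonal correction at most 5Δ²δ/128 (`entryInner_diag_le`).

For W, B - B* is split along the range of B* (`sub_truth_decomposition`). The part compressed to the
range and the part orthogonal to it are both linear in δ/m, the second because Tr B = Tr B*
(`trace_residual_le`), so an operator norm bound on W suffices for them. What remains of W, together
with the cross terms, is a sum of scores of the pairs (point b, candidate group k), weighted by the
mass that column b gives to group k (`entryInner_sub_truth_le`).

Bounding each score separately would require s² of order log n. Only sums of q + 1 scores are
controlled, uniformly over the points and their candidate groups: then at most q points have a score
above the threshold, and δ ≤ q follows (`sum_mass_mul_le_of_subset_sum_le`,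
`offMass_le_of_noise_bounds`). The union bound costs 1 + log(n/(q+1)) + log K per point in the
exponent, which s² affords for q = ⌊n exp(-s²/2²⁹)⌋. The tails come from Laplace transforms of
linear forms and from a Hanson–Wright inequality (`lintegral_eexp_quadratic_le`).

Finally |B - B*|₁ ≤ 7(n/m)δ (`sum_abs_sub_truth_le`), and approximate medoids misclassify at most
15|B - B*|₁ points because distinct rows of B* are at ℓ¹ distance 2 (`err_le_of_medoids`). Since s²
≥ c''n/m, half of the exponent absorbs the factor n/m. -/

namespace SubGMixture

/-! ### Laplace transforms of linear forms and squared norms, as `[0, ∞]`-valued integrals that need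
no integrability. -/

section Chaos

open ENNReal

/-- The exponential with values in `[0, ∞]`. -/
noncomputable def eexp (x : ℝ) : ℝ≥0∞ := ENNReal.ofReal (Real.exp x)

lemma eexp_add (x y : ℝ) : eexp (x + y) = eexp x * eexp y := by
  rw [eexp, Real.exp_add, ENNReal.ofReal_mul (Real.exp_pos _).le]; rfl

lemma eexp_sum {ι : Type*} (s : Finset ι) (f : ι → ℝ) :
    eexp (∑ i ∈ s, f i) = ∏ i ∈ s, eexp (f i) := by
  rw [eexp, Real.exp_sum, ENNReal.ofReal_prod_of_nonneg fun i _ => (Real.exp_pos _).le]; rfl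

lemma eexp_le {x y : ℝ} (h : x ≤ y) : eexp x ≤ eexp y :=
  ENNReal.ofReal_le_ofReal (Real.exp_le_exp.2 h)

lemma eexp_ne_zero (x : ℝ) : eexp x ≠ 0 := by simp [eexp, Real.exp_pos]

lemma eexp_ne_top (x : ℝ) : eexp x ≠ ⊤ := ENNReal.ofReal_ne_top

@[fun_prop]
lemma measurable_eexp : Measurable eexp :=
  ENNReal.measurable_ofReal.comp Real.measurable_exp

lemma lintegral_pi_prod {ι : Type*} [Fintype ι] (ν : ι → Measure ℝ)
    [∀ i, IsProbabilityMeasure (ν i)] {f : ι → ℝ → ℝ≥0∞} (hf : ∀ i, Measurable (f i)) :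
    ∫⁻ z, ∏ i, f i (z i) ∂Measure.pi ν = ∏ i, ∫⁻ x, f i x ∂ν i := by
  have h : iIndepFun (fun i (z : ι → ℝ) => f i (z i)) (Measure.pi ν) :=
    iIndepFun_pi fun i => (hf i).aemeasurable
  rw [lintegral_prod_eq_prod_lintegral_of_indepFun Finset.univ _ h
    fun i => (hf i).comp (measurable_pi_apply i)]
  refine Finset.prod_congr rfl fun i _ => ?_
  exact (measurePreserving_eval ν i).lintegral_comp (hf i)

/-- A family of laws on `ℝ` whose Laplace transforms are at most those of centered Gaussians
of variance `s`. -/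
def IsSubGLaw {ι : Type*} (ν : ι → Measure ℝ) (s : ℝ) : Prop :=
  ∀ i t, ∫⁻ x, eexp (t * x) ∂ν i ≤ eexp (s * t ^ 2 / 2)

lemma lintegral_eexp_linear_le {ι : Type*} [Fintype ι] {ν : ι → Measure ℝ}
    [∀ i, IsProbabilityMeasure (ν i)] {s : ℝ} (hν : IsSubGLaw ν s) (v : ι → ℝ) :
    ∫⁻ z, eexp (∑ i, v i * z i) ∂Measure.pi ν ≤ eexp (s * (∑ i, v i ^ 2) / 2) := by
  simp_rw [eexp_sum]
  rw [lintegral_pi_prod ν (f := fun i x => eexp (v i * x)) (fun i => by fun_prop)]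
  refine (Finset.prod_le_prod' fun i _ => hν i (v i)).trans_eq ?_
  rw [← eexp_sum, Finset.mul_sum, Finset.sum_div]

lemma lintegral_eexp_gaussian (t : ℝ) :
    ∫⁻ x, eexp (t * x) ∂gaussianReal 0 1 = eexp (t ^ 2 / 2) := by
  have h := mgf_gaussianReal (p := gaussianReal 0 1) (X := id) (μ := 0) (v := 1)
    (by simp) t
  simp only [mgf, id, zero_mul, NNReal.coe_one, one_mul, zero_add] at h
  unfold eexp
  rw [← ofReal_integral_eq_lintegral_ofReal (integrable_exp_mul_gaussianReal t)
    (Filter.Eventually.of_forall fun x => (Real.exp_pos _).le), h]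

/-- The integral equals (1 - 2t)^(-1/2), and (1 + 4t)(1 - 2t) ≥ 1 for 0 ≤ t ≤ 1/4. -/
lemma lintegral_eexp_sq_gaussian_le {t : ℝ} (h0 : 0 ≤ t) (ht : t ≤ 1 / 4) :
    ∫⁻ x, eexp (t * x ^ 2) ∂gaussianReal 0 1 ≤ eexp (2 * t) := by
  rw [gaussianReal_of_var_ne_zero _ one_ne_zero,
    lintegral_withDensity_eq_lintegral_mul _ (measurable_gaussianPDF _ _) (by fun_prop)]
  have hb : 0 < 1 / 2 - t := by linarith
  have e : ∀ x : ℝ, (gaussianPDF 0 1 * fun x => eexp (t * x ^ 2)) x =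
      ENNReal.ofReal ((√(2 * Real.pi))⁻¹ * Real.exp (-(1 / 2 - t) * x ^ 2)) := by
    intro x
    simp only [Pi.mul_apply, gaussianPDF, gaussianPDFReal, eexp]
    rw [← ENNReal.ofReal_mul (by positivity), mul_assoc, ← Real.exp_add]
    congr 3
    · simp
    · simp; ring
  rw [lintegral_congr e, ← ofReal_integral_eq_lintegral_ofReal
    ((integrable_exp_neg_mul_sq hb).const_mul _)
    (Filter.Eventually.of_forall fun x => by positivity), integral_const_mul, integral_gaussian]
  refine ENNReal.ofReal_le_ofReal ?_
  rw [← Real.sqrt_inv, ← Real.sqrt_mul (by positivity)]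
  refine Real.sqrt_le_iff.2 ⟨(Real.exp_pos _).le, ?_⟩
  rw [← Real.exp_nat_mul, show (2 * Real.pi)⁻¹ * (Real.pi / (1 / 2 - t)) = (1 - 2 * t)⁻¹ by
    have := Real.pi_pos.ne'
    have : 1 - 2 * t ≠ 0 := by linarith
    field_simp]
  rw [inv_le_iff_one_le_mul₀ (by linarith)]
  have := Real.add_one_le_exp (((2 : ℕ) : ℝ) * (2 * t))
  push_cast at this ⊢
  nlinarith

/-- Diagonalization of the quadratic form `z ↦ ‖M z‖²`. -/
lemma exists_diagonalization {ι κ : Type*} [Fintype ι] [DecidableEq ι] [Fintype κ]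
    (M : Matrix κ ι ℝ) {τ : ℝ}
    (hτ : ∀ z : ι → ℝ, ∑ j, (M *ᵥ z) j ^ 2 ≤ τ * ∑ i, z i ^ 2) :
    ∃ (d : ι → ℝ) (u : ι → ι → ℝ), (∀ i, 0 ≤ d i) ∧ (∀ i, d i ≤ τ) ∧
      ∑ i, d i = ∑ j, ∑ i, M j i ^ 2 ∧
      (∀ i i', ∑ j, u i j * u i' j = if i = i' then 1 else 0) ∧
      ∀ z : ι → ℝ, ∑ j, (M *ᵥ z) j ^ 2 = ∑ i, d i * (∑ j, u i j * z j) ^ 2 := by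
  have hps : (Mᵀ * M).PosSemidef := by
    simpa using Matrix.posSemidef_conjTranspose_mul_self M
  set hA := hps.1
  have hu : ∀ i i', ∑ j, hA.eigenvectorBasis i j * hA.eigenvectorBasis i' j
      = if i = i' then 1 else 0 := by
    intro i i'
    have := orthonormal_iff_ite.1 hA.eigenvectorBasis.orthonormal i i'
    rw [← this, PiLp.inner_apply]
    exact Finset.sum_congr rfl fun j _ => by simp [mul_comm]
  have hq : ∀ z : ι → ℝ, ∑ j, (M *ᵥ z) j ^ 2 = z ⬝ᵥ (Mᵀ * M) *ᵥ z := by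
    intro z
    rw [← Matrix.mulVec_mulVec, Matrix.dotProduct_mulVec, Matrix.vecMul_transpose]
    simp [dotProduct, sq]
  refine ⟨hA.eigenvalues, fun i j => hA.eigenvectorBasis i j, hps.eigenvalues_nonneg, ?_, ?_, hu,
    ?_⟩
  · intro i
    have h1 := hτ (hA.eigenvectorBasis i).ofLp
    rw [hq, hA.mulVec_eigenvectorBasis] at h1
    have h2 : ∑ j, (hA.eigenvectorBasis i).ofLp j ^ 2 = 1 := by
      simpa [sq] using hu i i
    have h3 : (hA.eigenvectorBasis i).ofLp ⬝ᵥ (hA.eigenvectorBasis i).ofLp = 1 := by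
      simpa [dotProduct] using hu i i
    rw [dotProduct_smul, h3, h2] at h1
    simpa using h1
  · have := hA.trace_eq_sum_eigenvalues
    simp only [RCLike.ofReal_real_eq_id, id] at this
    rw [← this, Matrix.trace, Finset.sum_comm]
    refine Finset.sum_congr rfl fun i _ => ?_
    simp [Matrix.mul_apply, sq]
  · intro z
    rw [hq]
    have h1 := hA.eigenvectorBasis.sum_inner_mul_inner (WithLp.toLp 2 z)
      (WithLp.toLp 2 ((Mᵀ * M) *ᵥ z))
    have h2 : inner ℝ (WithLp.toLp 2 z) (WithLp.toLp 2 ((Mᵀ * M) *ᵥ z)) =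
        z ⬝ᵥ (Mᵀ * M) *ᵥ z := by
      simp [PiLp.inner_apply, dotProduct, mul_comm]
    rw [← h2, ← h1]
    refine Finset.sum_congr rfl fun i _ => ?_
    have h3 : inner ℝ (WithLp.toLp 2 z) (hA.eigenvectorBasis i) =
        ∑ j, hA.eigenvectorBasis i j * z j := by
      simp [PiLp.inner_apply]
    have h4 : inner ℝ (hA.eigenvectorBasis i) (WithLp.toLp 2 ((Mᵀ * M) *ᵥ z)) =
        hA.eigenvalues i * ∑ j, hA.eigenvectorBasis i j * z j := by
      have e1 : inner ℝ (hA.eigenvectorBasis i) (WithLp.toLp 2 ((Mᵀ * M) *ᵥ z)) =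
          (hA.eigenvectorBasis i).ofLp ⬝ᵥ ((Mᵀ * M) *ᵥ z) := by
        simp [PiLp.inner_apply, dotProduct, mul_comm]
      have e2 : (Mᵀ * M)ᵀ = Mᵀ * M := by simp
      rw [e1, Matrix.dotProduct_mulVec, ← Matrix.mulVec_transpose, e2,
        hA.mulVec_eigenvectorBasis, smul_dotProduct]
      rfl
    rw [h3, h4]; ring

/-- Exponential moments of `‖M z‖²` for a vector `z` with independent sub-Gaussian coordinates. -/
lemma lintegral_eexp_sq_norm_le {ι κ : Type*} [Fintype ι] [DecidableEq ι] [Fintype κ]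
    {ν : ι → Measure ℝ} [∀ i, IsProbabilityMeasure (ν i)] {s : ℝ} (hs : 0 ≤ s)
    (hν : IsSubGLaw ν s) (M : Matrix κ ι ℝ) {τ t : ℝ}
    (hτ : ∀ z : ι → ℝ, ∑ j, (M *ᵥ z) j ^ 2 ≤ τ * ∑ i, z i ^ 2) (ht : 0 ≤ t)
    (hst : t * s * τ ≤ 1 / 4) :
    ∫⁻ z, eexp (t * ∑ j, (M *ᵥ z) j ^ 2) ∂Measure.pi ν
      ≤ eexp (2 * t * s * ∑ j, ∑ i, M j i ^ 2) := by
  obtain ⟨d, u, hd0, hdτ, hdsum, hu, hz⟩ := exists_diagonalization M hτ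
  set γ : ι → Measure ℝ := fun _ => gaussianReal 0 1
  -- Gaussian linearization: the exponential of a square is the Laplace transform of an auxiliary
  -- Gaussian g. Once the integrals are swapped, the exponent is linear in z, where the sub-Gaussian
  -- bound applies, and what is left is a quadratic form in g.
  have hlin : ∀ z : ι → ℝ, eexp (t * ∑ j, (M *ᵥ z) j ^ 2) =
      ∫⁻ g, eexp (∑ i, (√(2 * t * d i) * ∑ j, u i j * z j) * g i) ∂Measure.pi γ := by
    intro z
    simp_rw [eexp_sum]
    rw [lintegral_pi_prod γ (f := fun i x => eexp ((√(2 * t * d i) * ∑ j, u i j * z j) * x))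
      (fun i => by fun_prop)]
    simp_rw [γ, lintegral_eexp_gaussian]
    rw [← eexp_sum, hz, Finset.mul_sum]
    congr 1
    refine Finset.sum_congr rfl fun i _ => ?_
    rw [mul_pow, Real.sq_sqrt (by have := hd0 i; positivity)]; ring
  have hswap : ∀ (g z : ι → ℝ), ∑ i, (√(2 * t * d i) * ∑ j, u i j * z j) * g i =
      ∑ j, (∑ i, √(2 * t * d i) * g i * u i j) * z j := by
    intro g z
    simp_rw [Finset.mul_sum, Finset.sum_mul]
    rw [Finset.sum_comm]
    exact Finset.sum_congr rfl fun j _ => Finset.sum_congr rfl fun i _ => by ring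
  have hsq : ∀ g : ι → ℝ, ∑ j, (∑ i, √(2 * t * d i) * g i * u i j) ^ 2 =
      ∑ i, 2 * t * d i * g i ^ 2 := by
    intro g
    have h1 : ∀ j, (∑ i, √(2 * t * d i) * g i * u i j) ^ 2 = ∑ i, ∑ i',
        (√(2 * t * d i) * g i) * (√(2 * t * d i') * g i') * (u i j * u i' j) := by
      intro j
      rw [sq, Finset.sum_mul_sum]
      exact Finset.sum_congr rfl fun j _ => Finset.sum_congr rfl fun i _ => by ring
    simp_rw [h1]
    rw [Finset.sum_comm]
    refine Finset.sum_congr rfl fun i _ => ?_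
    rw [Finset.sum_comm]
    simp_rw [← Finset.mul_sum, hu]
    simp only [mul_ite, mul_one, mul_zero, Finset.sum_ite_eq, Finset.mem_univ, if_true]
    have : √(2 * t * d i) ^ 2 = 2 * t * d i := Real.sq_sqrt (by have := hd0 i; positivity)
    linear_combination g i ^ 2 * this
  have hjoint : Measurable (fun q : (ι → ℝ) × (ι → ℝ) =>
      eexp (∑ i, (√(2 * t * d i) * ∑ j, u i j * q.1 j) * q.2 i)) := by fun_prop
  calc ∫⁻ z, eexp (t * ∑ j, (M *ᵥ z) j ^ 2) ∂Measure.pi ν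
      = ∫⁻ z, ∫⁻ g, eexp (∑ i, (√(2 * t * d i) * ∑ j, u i j * z j) * g i) ∂Measure.pi γ
          ∂Measure.pi ν := lintegral_congr hlin
    _ = ∫⁻ g, ∫⁻ z, eexp (∑ i, (√(2 * t * d i) * ∑ j, u i j * z j) * g i) ∂Measure.pi ν
          ∂Measure.pi γ := lintegral_lintegral_swap hjoint.aemeasurable
    _ ≤ ∫⁻ g, eexp (∑ i, (t * s * d i) * g i ^ 2) ∂Measure.pi γ := by
        refine lintegral_mono fun g => ?_
        simp_rw [hswap g]
        refine (lintegral_eexp_linear_le hν _).trans_eq ?_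
        rw [hsq, Finset.mul_sum, Finset.sum_div]
        congr 1
        exact Finset.sum_congr rfl fun i _ => by ring
    _ = ∏ i, ∫⁻ x, eexp ((t * s * d i) * x ^ 2) ∂γ i := by
        simp_rw [eexp_sum]
        exact lintegral_pi_prod γ (f := fun i x => eexp ((t * s * d i) * x ^ 2))
          (fun i => by fun_prop)
    _ ≤ ∏ i, eexp (2 * (t * s * d i)) := by
        refine Finset.prod_le_prod' fun i _ => lintegral_eexp_sq_gaussian_le ?_ ?_
        · have := hd0 i; positivity
        · exact (mul_le_mul_of_nonneg_left (hdτ i) (by positivity)).trans hst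
    _ = eexp (2 * t * s * ∑ j, ∑ i, M j i ^ 2) := by
        rw [← eexp_sum, ← hdsum, Finset.mul_sum]
        congr 1
        exact Finset.sum_congr rfl fun i _ => by ring

end Chaos

/-! ### The Hanson–Wright inequality, by decoupling. -/

section HansonWright

open ENNReal

variable {ι : Type*} [Fintype ι] [DecidableEq ι]

/-- Gluing two independent copies along I does not change the law. This lets the coordinates in I
and those outside I be treated as independent vectors. -/
lemma measurePreserving_merge (ν : ι → Measure ℝ) [∀ i, IsProbabilityMeasure (ν i)]
    (I : Finset ι) :
    MeasurePreserving (fun (q : (ι → ℝ) × (ι → ℝ)) i => if i ∈ I then q.1 i else q.2 i)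
      ((Measure.pi ν).prod (Measure.pi ν)) (Measure.pi ν) := by
  have hm : Measurable fun (q : (ι → ℝ) × (ι → ℝ)) i => if i ∈ I then q.1 i else q.2 i := by
    refine measurable_pi_lambda _ fun i => ?_
    by_cases h : i ∈ I <;> simp only [h, if_true, if_false] <;> fun_prop
  refine ⟨hm, (Measure.pi_eq fun s hs => ?_).symm⟩
  rw [Measure.map_apply hm (MeasurableSet.univ_pi hs)]
  have : (fun (q : (ι → ℝ) × (ι → ℝ)) i => if i ∈ I then q.1 i else q.2 i) ⁻¹' Set.univ.pi s =
      (Set.univ.pi fun i => if i ∈ I then s i else Set.univ) ×ˢ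
        (Set.univ.pi fun i => if i ∈ I then Set.univ else s i) := by
    ext q
    simp only [Set.mem_preimage, Set.mem_pi, Set.mem_univ, true_imp_iff, Set.mem_prod]
    rw [← forall_and]
    refine forall_congr' fun i => ?_
    by_cases h : i ∈ I <;> simp [h]
  rw [this, Measure.prod_prod, Measure.pi_pi, Measure.pi_pi, ← Finset.prod_mul_distrib]
  refine Finset.prod_congr rfl fun i _ => ?_
  by_cases h : i ∈ I <;> simp [h]

/-- With z in I frozen, the form is linear in the coordinates outside I; integrating these leaves a
squared norm in z, covered by `lintegral_eexp_sq_norm_le` with parameter s t²/2. -/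
lemma lintegral_eexp_decoupled_le {ν : ι → Measure ℝ} [∀ i, IsProbabilityMeasure (ν i)]
    {s : ℝ} (hs : 0 ≤ s) (hν : IsSubGLaw ν s) (A : Matrix ι ι ℝ) {τ t : ℝ}
    (hτ0 : 0 ≤ τ) (hτ : ∀ z : ι → ℝ, ∑ j, (Aᵀ *ᵥ z) j ^ 2 ≤ τ * ∑ i, z i ^ 2)
    (hst : 2 * s ^ 2 * t ^ 2 * τ ≤ 1) (I : Finset ι) :
    ∫⁻ z, eexp (t * ∑ i, ∑ j, if i ∈ I ∧ j ∉ I then A i j * z i * z j else 0) ∂Measure.pi ν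
      ≤ eexp (s ^ 2 * t ^ 2 * ∑ i, ∑ j, A i j ^ 2) := by
  set M : Matrix ι ι ℝ := Matrix.of fun j i => if i ∈ I ∧ j ∉ I then A i j else 0 with hM
  have hMτ : ∀ z : ι → ℝ, ∑ j, (M *ᵥ z) j ^ 2 ≤ τ * ∑ i, z i ^ 2 := by
    intro z
    set w : ι → ℝ := fun i => if i ∈ I then z i else 0 with hw
    have h1 : ∀ j, (M *ᵥ z) j ^ 2 ≤ (Aᵀ *ᵥ w) j ^ 2 := by
      intro j
      by_cases hj : j ∈ I
      · have : (M *ᵥ z) j = 0 := by simp [hM, Matrix.mulVec, dotProduct, hj]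
        rw [this, zero_pow two_ne_zero]; exact sq_nonneg _
      · have : (M *ᵥ z) j = (Aᵀ *ᵥ w) j := by
          simp only [hM, hw, Matrix.mulVec, dotProduct, Matrix.of_apply, Matrix.transpose_apply]
          refine Finset.sum_congr rfl fun i _ => ?_
          by_cases hi : i ∈ I <;> simp [hi, hj]
        rw [this]
    refine (Finset.sum_le_sum fun j _ => h1 j).trans ((hτ w).trans ?_)
    refine mul_le_mul_of_nonneg_left (Finset.sum_le_sum fun i _ => ?_) hτ0
    simp only [hw]
    split_ifs
    · exact le_rfl
    · simp only [ne_eq, OfNat.ofNat_ne_zero, not_false_eq_true, zero_pow]; positivity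
  have hmp := measurePreserving_merge ν I
  have hmeas : Measurable fun z : ι → ℝ =>
      eexp (t * ∑ i, ∑ j, if i ∈ I ∧ j ∉ I then A i j * z i * z j else 0) := by
    refine measurable_eexp.comp (Measurable.const_mul ?_ t)
    refine Finset.measurable_fun_sum _ fun i _ => Finset.measurable_fun_sum _ fun j _ => ?_
    split_ifs <;> fun_prop
  have hlin : ∀ z z' : ι → ℝ, (t * ∑ i, ∑ j, if i ∈ I ∧ j ∉ I then
      A i j * (if i ∈ I then z i else z' i) * (if j ∈ I then z j else z' j) else 0) =
      ∑ j, (t * (M *ᵥ z) j) * z' j := by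
    intro z z'
    rw [Finset.sum_comm, Finset.mul_sum]
    refine Finset.sum_congr rfl fun j _ => ?_
    simp only [hM, Matrix.mulVec, dotProduct, Matrix.of_apply]
    rw [mul_assoc, Finset.sum_mul]
    congr 1
    refine Finset.sum_congr rfl fun i _ => ?_
    by_cases hi : i ∈ I <;> by_cases hj : j ∈ I <;> simp [hi, hj]
  calc _ = ∫⁻ q, eexp (∑ j, (t * (M *ᵥ q.1) j) * q.2 j) ∂(Measure.pi ν).prod (Measure.pi ν) := by
        rw [← hmp.lintegral_comp hmeas]
        exact lintegral_congr fun q => congrArg eexp (hlin q.1 q.2)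
    _ = ∫⁻ z, ∫⁻ z', eexp (∑ j, (t * (M *ᵥ z) j) * z' j) ∂Measure.pi ν ∂Measure.pi ν := by
        refine lintegral_prod _ (Measurable.aemeasurable ?_)
        simp only [Matrix.mulVec, dotProduct]
        fun_prop
    _ ≤ ∫⁻ z, eexp (s * t ^ 2 / 2 * ∑ j, (M *ᵥ z) j ^ 2) ∂Measure.pi ν := by
        refine lintegral_mono fun z => ?_
        refine (lintegral_eexp_linear_le hν _).trans (eexp_le (le_of_eq ?_))
        simp_rw [mul_pow, ← Finset.mul_sum]
        ring
    _ ≤ eexp (2 * (s * t ^ 2 / 2) * s * ∑ j, ∑ i, M j i ^ 2) :=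
        lintegral_eexp_sq_norm_le hs hν M hMτ (by positivity) (by linarith)
    _ ≤ _ := by
        refine eexp_le ?_
        rw [show 2 * (s * t ^ 2 / 2) * s = s ^ 2 * t ^ 2 by ring]
        refine mul_le_mul_of_nonneg_left ?_ (by positivity)
        rw [Finset.sum_comm]
        refine Finset.sum_le_sum fun i _ => Finset.sum_le_sum fun j _ => ?_
        by_cases h : i ∈ I ∧ j ∉ I
        · simp [hM, h]
        · simp only [hM, Matrix.of_apply, h, if_false, zero_pow two_ne_zero]; exact sq_nonneg _

/-- A uniformly random subset contains i and misses j with probability 1/4, whence the factor 4 in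
the decoupling below. -/
lemma card_finset_mem_notMem {i j : ι} (hij : i ≠ j) :
    ((Finset.univ.filter fun I : Finset ι => i ∈ I ∧ j ∉ I).card : ℝ) =
      2 ^ Fintype.card ι / 4 := by
  have h1 : (Finset.univ.filter fun I : Finset ι => i ∈ I ∧ j ∉ I) =
      Finset.Icc {i} ({j}ᶜ : Finset ι) := by
    ext I
    simp [Finset.subset_compl_iff_disjoint_right]
  have hsub : ({i} : Finset ι) ⊆ {j}ᶜ := by simpa using hij.symm
  have h2 : 2 ≤ Fintype.card ι := by
    have := Finset.card_le_univ ({i, j} : Finset ι)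
    rwa [Finset.card_pair hij] at this
  rw [h1, Finset.card_Icc_finset hsub, Finset.card_compl, Finset.card_singleton,
    Finset.card_singleton]
  obtain ⟨N, hN⟩ := Nat.exists_eq_add_of_le h2
  rw [hN, show 2 + N - 1 - 1 = N by omega, pow_add]
  push_cast; ring

/-- The off-diagonal form is the average over all I of 4 times its restriction to I × Iᶜ. Jensen's
inequality then reduces to the decoupled bound at 4t. -/
lemma lintegral_eexp_offDiag_le {ν : ι → Measure ℝ} [∀ i, IsProbabilityMeasure (ν i)]
    {s : ℝ} (hs : 0 ≤ s) (hν : IsSubGLaw ν s) (A : Matrix ι ι ℝ) {τ t : ℝ}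
    (hτ0 : 0 ≤ τ) (hτ : ∀ z : ι → ℝ, ∑ j, (Aᵀ *ᵥ z) j ^ 2 ≤ τ * ∑ i, z i ^ 2)
    (hst : 32 * s ^ 2 * t ^ 2 * τ ≤ 1) :
    ∫⁻ z, eexp (t * ∑ i, ∑ j, if i ≠ j then A i j * z i * z j else 0) ∂Measure.pi ν
      ≤ eexp (16 * s ^ 2 * t ^ 2 * ∑ i, ∑ j, A i j ^ 2) := by
  set w : ℝ := (2 ^ Fintype.card ι)⁻¹ with hw
  have hw0 : 0 < w := by positivity
  have hwsum : (∑ _I : Finset ι, w) = 1 := by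
    simp [hw]
  have havg : ∀ z : ι → ℝ, (t * ∑ i, ∑ j, if i ≠ j then A i j * z i * z j else 0) =
      ∑ I : Finset ι, w • (4 * t * ∑ i, ∑ j,
        if i ∈ I ∧ j ∉ I then A i j * z i * z j else 0) := by
    intro z
    simp_rw [smul_eq_mul, Finset.mul_sum]
    conv_rhs => rw [Finset.sum_comm]
    refine Finset.sum_congr rfl fun i _ => ?_
    rw [Finset.sum_comm]
    refine Finset.sum_congr rfl fun j _ => ?_
    by_cases hij : i = j
    · subst hij
      simp
    · simp only [mul_ite, mul_zero]
      rw [← Finset.sum_filter, Finset.sum_const, nsmul_eq_mul, card_finset_mem_notMem hij]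
      simp only [ne_eq, hij, not_false_eq_true, if_true, hw]
      field_simp
  have hjensen : ∀ z : ι → ℝ, eexp (t * ∑ i, ∑ j, if i ≠ j then A i j * z i * z j else 0) ≤
      ∑ I : Finset ι, ENNReal.ofReal w * eexp (4 * t * ∑ i, ∑ j,
        if i ∈ I ∧ j ∉ I then A i j * z i * z j else 0) := by
    intro z
    rw [havg]
    have := convexOn_exp.map_sum_le (t := (Finset.univ : Finset (Finset ι))) (w := fun _ => w)
      (p := fun I => 4 * t * ∑ i, ∑ j, if i ∈ I ∧ j ∉ I then A i j * z i * z j else 0)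
      (fun _ _ => hw0.le) hwsum (fun _ _ => Set.mem_univ _)
    refine (ENNReal.ofReal_le_ofReal this).trans_eq ?_
    rw [ENNReal.ofReal_sum_of_nonneg fun I _ => by positivity]
    refine Finset.sum_congr rfl fun I _ => ?_
    rw [smul_eq_mul, ENNReal.ofReal_mul hw0.le]; rfl
  refine (lintegral_mono hjensen).trans ?_
  have hmeas : ∀ I : Finset ι, Measurable fun z : ι → ℝ =>
      eexp (4 * t * ∑ i, ∑ j, if i ∈ I ∧ j ∉ I then A i j * z i * z j else 0) := by
    intro I
    refine measurable_eexp.comp (Measurable.const_mul ?_ _)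
    refine Finset.measurable_fun_sum _ fun i _ => Finset.measurable_fun_sum _ fun j _ => ?_
    split_ifs <;> fun_prop
  rw [lintegral_finsetSum _ fun I _ => (hmeas I).const_mul _]
  simp_rw [lintegral_const_mul _ (hmeas _)]
  calc _ ≤ ∑ _I : Finset ι, ENNReal.ofReal w *
        eexp (s ^ 2 * (4 * t) ^ 2 * ∑ i, ∑ j, A i j ^ 2) := by
        gcongr with I
        exact lintegral_eexp_decoupled_le hs hν A hτ0 hτ (by linarith) I
    _ = eexp (s ^ 2 * (4 * t) ^ 2 * ∑ i, ∑ j, A i j ^ 2) := by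
        rw [← Finset.sum_mul, ← ENNReal.ofReal_sum_of_nonneg fun _ _ => hw0.le, hwsum]
        simp
    _ = _ := by congr 1; ring

lemma lintegral_eexp_sq_le {μ : Measure ℝ} [IsProbabilityMeasure μ] {s t : ℝ} (hs : 0 ≤ s)
    (hμ : ∀ t, ∫⁻ x, eexp (t * x) ∂μ ≤ eexp (s * t ^ 2 / 2)) (ht : 0 ≤ t) (hst : t * s ≤ 1 / 4) :
    ∫⁻ x, eexp (t * x ^ 2) ∂μ ≤ eexp (2 * t * s) := by
  have h := lintegral_eexp_sq_norm_le (ι := Unit) (κ := Unit) (ν := fun _ => μ) hs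
    (fun _ => hμ) (1 : Matrix Unit Unit ℝ) (τ := 1) (t := t) (by simp) ht (by linarith)
  simp only [Finset.univ_unique, Matrix.one_mulVec, Finset.sum_singleton, Matrix.one_apply_eq,
    PUnit.default_eq_unit, one_pow, mul_one] at h
  refine le_trans (le_of_eq ?_) h
  exact ((measurePreserving_eval (fun _ : Unit => μ) ()).lintegral_comp
    (f := fun x => eexp (t * x ^ 2)) (by fun_prop)).symm

/-- The first-order term is kept exact so that it cancels after centering. -/
lemma exp_le_quadratic (a : ℝ) : Real.exp a ≤ 1 + a + a ^ 2 * Real.exp |a| := by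
  have h1 : Real.exp a - 1 ≤ a * Real.exp a := by
    have := Real.one_sub_le_exp_neg a
    have h2 : Real.exp a * Real.exp (-a) = 1 := by rw [← Real.exp_add]; simp
    nlinarith [Real.exp_pos a]
  rcases le_total 0 a with h | h
  · rw [abs_of_nonneg h]
    nlinarith
  · have h3 := Real.add_one_le_exp a
    have h4 : 1 ≤ Real.exp |a| := Real.one_le_exp (abs_nonneg a)
    nlinarith [sq_nonneg a]

/-- Exponential moments of a centered sub-Gaussian square. -/
lemma lintegral_eexp_centered_sq_le {μ : Measure ℝ} [IsProbabilityMeasure μ] {s θ : ℝ}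
    (hs : 0 < s) (hμ : ∀ t, ∫⁻ x, eexp (t * x) ∂μ ≤ eexp (s * t ^ 2 / 2))
    (hθ : |θ| * s ≤ 1 / 8) :
    ∫⁻ x, eexp (θ * (x ^ 2 - ∫ y, y ^ 2 ∂μ)) ∂μ ≤ eexp (256 * s ^ 2 * θ ^ 2) := by
  -- 1/(4s) is the largest exponent allowed by `lintegral_eexp_sq_le`.
  have hexp : ∫⁻ x, ENNReal.ofReal (Real.exp (1 / (4 * s) * x ^ 2)) ∂μ ≤ eexp (1 / 2) := by
    refine (lintegral_eexp_sq_le hs.le hμ (t := 1 / (4 * s)) (by positivity)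
      (by field_simp; rfl)).trans_eq ?_
    congr 1; field_simp; norm_num
  have hint : Integrable (fun x : ℝ => Real.exp (1 / (4 * s) * x ^ 2)) μ := by
    refine ⟨by fun_prop, ?_⟩
    rw [hasFiniteIntegral_iff_ofReal (Filter.Eventually.of_forall fun x => (Real.exp_pos _).le)]
    exact hexp.trans_lt (eexp_ne_top _).lt_top
  have hI : ∫ x, Real.exp (1 / (4 * s) * x ^ 2) ∂μ ≤ 2 := by
    rw [integral_eq_lintegral_of_nonneg_ae
      (Filter.Eventually.of_forall fun x => (Real.exp_pos _).le) hint.1]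
    refine (ENNReal.toReal_mono (eexp_ne_top _) hexp).trans ?_
    rw [eexp, ENNReal.toReal_ofReal (Real.exp_pos _).le]
    have h1 : Real.exp (1 / 2) * Real.exp (1 / 2) = Real.exp 1 := by
      rw [← Real.exp_add]; norm_num
    nlinarith [Real.exp_one_lt_d9, Real.exp_pos (1 / 2)]
  have hsq : Integrable (fun x : ℝ => x ^ 2) μ := by
    refine (hint.const_mul (4 * s)).mono' (by fun_prop) (Filter.Eventually.of_forall fun x => ?_)
    rw [Real.norm_of_nonneg (by positivity)]
    have := Real.add_one_le_exp (1 / (4 * s) * x ^ 2)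
    calc x ^ 2 = 4 * s * (1 / (4 * s) * x ^ 2) := by field_simp
      _ ≤ _ := by gcongr; linarith
  set q := ∫ y, y ^ 2 ∂μ
  -- The exponent x²/(4s) = 2y is shared: one y dominates exp |θx²|, the other dominates the factor
  -- y² coming from (θx²)².
  have hpt : ∀ x : ℝ, Real.exp (θ * x ^ 2) ≤
      1 + θ * x ^ 2 + 128 * s ^ 2 * θ ^ 2 * Real.exp (1 / (4 * s) * x ^ 2) := by
    intro x
    set y := x ^ 2 / (8 * s) with hy
    have hy0 : 0 ≤ y := by positivity
    have hx : x ^ 2 = 8 * s * y := by rw [hy]; field_simp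
    have h1 := exp_le_quadratic (θ * x ^ 2)
    have h2 : |θ * x ^ 2| ≤ y := by
      rw [abs_mul, abs_of_nonneg (sq_nonneg x), hx]
      nlinarith
    have h3 : y ^ 2 ≤ 2 * Real.exp y := by
      have := Real.pow_div_factorial_le_exp y hy0 2
      norm_num at this; linarith
    have h4 : Real.exp (1 / (4 * s) * x ^ 2) = Real.exp y * Real.exp y := by
      rw [← Real.exp_add]; congr 1; rw [hy]; field_simp; ring
    calc Real.exp (θ * x ^ 2) ≤ 1 + θ * x ^ 2 + (θ * x ^ 2) ^ 2 * Real.exp |θ * x ^ 2| := h1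
      _ ≤ 1 + θ * x ^ 2 + (θ * x ^ 2) ^ 2 * Real.exp y := by gcongr
      _ = 1 + θ * x ^ 2 + 64 * s ^ 2 * θ ^ 2 * y ^ 2 * Real.exp y := by
        simp only [mul_pow, hx]; ring
      _ ≤ 1 + θ * x ^ 2 + 64 * s ^ 2 * θ ^ 2 * (2 * Real.exp y) * Real.exp y := by gcongr
      _ = _ := by rw [h4]; ring
  have hg : Integrable (fun x : ℝ =>
      1 + θ * x ^ 2 + 128 * s ^ 2 * θ ^ 2 * Real.exp (1 / (4 * s) * x ^ 2)) μ :=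
    ((integrable_const _).add (hsq.const_mul _)).add (hint.const_mul _)
  have hmain : ∫⁻ x, eexp (θ * x ^ 2) ∂μ ≤ eexp (θ * q + 256 * s ^ 2 * θ ^ 2) := by
    calc ∫⁻ x, eexp (θ * x ^ 2) ∂μ ≤ ∫⁻ x, ENNReal.ofReal
          (1 + θ * x ^ 2 + 128 * s ^ 2 * θ ^ 2 * Real.exp (1 / (4 * s) * x ^ 2)) ∂μ :=
          lintegral_mono fun x => ENNReal.ofReal_le_ofReal (hpt x)
      _ = ENNReal.ofReal (∫ x, (1 + θ * x ^ 2 +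
          128 * s ^ 2 * θ ^ 2 * Real.exp (1 / (4 * s) * x ^ 2)) ∂μ) :=
          (ofReal_integral_eq_lintegral_ofReal hg (Filter.Eventually.of_forall fun x =>
            (Real.exp_pos _).le.trans (hpt x))).symm
      _ ≤ _ := by
          refine ENNReal.ofReal_le_ofReal ?_
          have hg' : Integrable (fun x : ℝ => 1 + θ * x ^ 2) μ :=
            (integrable_const _).add (hsq.const_mul _)
          rw [integral_add hg' (hint.const_mul _),
            integral_add (integrable_const _) (hsq.const_mul _), integral_const_mul,
            integral_const_mul]
          simp only [integral_const, probReal_univ, smul_eq_mul, mul_one]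
          have h1 := Real.add_one_le_exp (θ * q + 256 * s ^ 2 * θ ^ 2)
          have h2 : 128 * s ^ 2 * θ ^ 2 * ∫ x, Real.exp (1 / (4 * s) * x ^ 2) ∂μ ≤
              128 * s ^ 2 * θ ^ 2 * 2 := by gcongr
          linarith
  calc ∫⁻ x, eexp (θ * (x ^ 2 - q)) ∂μ = ∫⁻ x, eexp (-(θ * q)) * eexp (θ * x ^ 2) ∂μ := by
        refine lintegral_congr fun x => ?_
        rw [← eexp_add]; congr 1; ring
    _ = eexp (-(θ * q)) * ∫⁻ x, eexp (θ * x ^ 2) ∂μ := lintegral_const_mul _ (by fun_prop)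
    _ ≤ eexp (-(θ * q)) * eexp (θ * q + 256 * s ^ 2 * θ ^ 2) := by gcongr
    _ = _ := by rw [← eexp_add]; congr 1; ring

/-- **Hanson–Wright inequality**, in Laplace transform form: exponential moments of a centered
quadratic form in independent sub-Gaussian variables. Here `τ` bounds the squared operator norm
of `A`. -/
theorem lintegral_eexp_quadratic_le {ν : ι → Measure ℝ} [∀ i, IsProbabilityMeasure (ν i)]
    {s : ℝ} (hs : 0 < s) (hν : IsSubGLaw ν s) (A : Matrix ι ι ℝ) {τ t : ℝ}
    (hτ0 : 0 ≤ τ) (hτ : ∀ z : ι → ℝ, ∑ j, (Aᵀ *ᵥ z) j ^ 2 ≤ τ * ∑ i, z i ^ 2)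
    (hst : 256 * s ^ 2 * t ^ 2 * τ ≤ 1) :
    ∫⁻ z, eexp (t * ((∑ i, ∑ j, A i j * z i * z j) - ∑ i, A i i * ∫ y, y ^ 2 ∂ν i)) ∂Measure.pi ν
      ≤ eexp (1024 * s ^ 2 * t ^ 2 * ∑ i, ∑ j, A i j ^ 2) := by
  set F := ∑ i, ∑ j, A i j ^ 2 with hF
  have hdiagτ : ∀ i, A i i ^ 2 ≤ τ := by
    intro i
    have h := hτ (Pi.single i 1)
    have h1 : ∑ j, (Pi.single i (1 : ℝ) : ι → ℝ) j ^ 2 = 1 := by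
      rw [Finset.sum_eq_single i] <;> simp +contextual
    rw [h1, mul_one] at h
    refine le_trans ?_ h
    have h2 := Finset.single_le_sum (f := fun j => (Aᵀ *ᵥ Pi.single i (1 : ℝ)) j ^ 2)
      (fun j _ => sq_nonneg _) (Finset.mem_univ i)
    simpa using h2
  have hdiagF : ∑ i, A i i ^ 2 ≤ F := Finset.sum_le_sum fun i _ =>
    Finset.single_le_sum (f := fun j => A i j ^ 2) (fun j _ => sq_nonneg _) (Finset.mem_univ i)
  set Dg : (ι → ℝ) → ℝ := fun z => ∑ i, A i i * (z i ^ 2 - ∫ y, y ^ 2 ∂ν i) with hDg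
  set O : (ι → ℝ) → ℝ := fun z => ∑ i, ∑ j, if i ≠ j then A i j * z i * z j else 0 with hO
  have hsplit : ∀ z : ι → ℝ,
      (∑ i, ∑ j, A i j * z i * z j) - ∑ i, A i i * ∫ y, y ^ 2 ∂ν i = Dg z + O z := by
    intro z
    simp only [hDg, hO]
    rw [← Finset.sum_sub_distrib, ← Finset.sum_add_distrib]
    refine Finset.sum_congr rfl fun i _ => ?_
    rw [← Finset.add_sum_erase _ _ (Finset.mem_univ i),
      ← Finset.add_sum_erase Finset.univ (fun j => if i ≠ j then _ else _) (Finset.mem_univ i)]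
    have : ∑ j ∈ Finset.univ.erase i, (if i ≠ j then A i j * z i * z j else 0) =
        ∑ j ∈ Finset.univ.erase i, A i j * z i * z j :=
      Finset.sum_congr rfl fun j hj => if_pos (Finset.ne_of_mem_erase hj).symm
    rw [this]
    simp only [ne_eq, not_true_eq_false, if_false]
    ring
  -- The condition |2t A i i| s ≤ 1/8 of the one-dimensional bound is what fixes the constant 256 in
  -- `hst`.
  have hD : ∫⁻ z, eexp (2 * t * Dg z) ∂Measure.pi ν ≤ eexp (1024 * s ^ 2 * t ^ 2 * F) := by
    simp only [hDg, Finset.mul_sum, eexp_sum]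
    rw [lintegral_pi_prod ν (f := fun i x => eexp (2 * t * (A i i * (x ^ 2 - ∫ y, y ^ 2 ∂ν i))))
      (fun i => by fun_prop)]
    calc _ ≤ ∏ i, eexp (256 * s ^ 2 * (2 * t * A i i) ^ 2) := by
          refine Finset.prod_le_prod' fun i _ => ?_
          simp_rw [← mul_assoc]
          refine lintegral_eexp_centered_sq_le hs (hν i) ?_
          rw [← abs_of_pos hs, ← abs_mul]
          refine abs_le_of_sq_le_sq ?_ (by norm_num)
          have := mul_le_mul_of_nonneg_left (hdiagτ i) (by positivity : 0 ≤ 256 * s ^ 2 * t ^ 2)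
          nlinarith
      _ = eexp (1024 * s ^ 2 * t ^ 2 * ∑ i, A i i ^ 2) := by
          rw [← eexp_sum, Finset.mul_sum]
          congr 1
          exact Finset.sum_congr rfl fun i _ => by ring
      _ ≤ _ := eexp_le (by gcongr)
  have hOff : ∫⁻ z, eexp (2 * t * O z) ∂Measure.pi ν ≤ eexp (1024 * s ^ 2 * t ^ 2 * F) := by
    refine (lintegral_eexp_offDiag_le hs.le hν A hτ0 hτ (t := 2 * t) (by
      nlinarith [mul_nonneg (mul_nonneg (sq_nonneg s) (sq_nonneg t)) hτ0])).trans (eexp_le ?_)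
    have : 0 ≤ s ^ 2 * t ^ 2 * F := by positivity
    nlinarith
  -- The diagonal and off-diagonal parts are dependent; they are separated by exp(x + y) ≤ (exp 2x +
  -- exp 2y)/2, at the price of doubling t.
  have hpt : ∀ z, eexp (t * (Dg z + O z)) ≤
      ENNReal.ofReal (1 / 2) * eexp (2 * t * Dg z) +
        ENNReal.ofReal (1 / 2) * eexp (2 * t * O z) := by
    intro z
    simp only [eexp]
    rw [← ENNReal.ofReal_mul (by norm_num), ← ENNReal.ofReal_mul (by norm_num),
      ← ENNReal.ofReal_add (by positivity) (by positivity)]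
    refine ENNReal.ofReal_le_ofReal ?_
    have e1 : Real.exp (t * (Dg z + O z)) = Real.exp (t * Dg z) * Real.exp (t * O z) := by
      rw [← Real.exp_add]; congr 1; ring
    have e2 : Real.exp (2 * t * Dg z) = Real.exp (t * Dg z) ^ 2 := by
      rw [← Real.exp_nat_mul]; congr 1; push_cast; ring
    have e3 : Real.exp (2 * t * O z) = Real.exp (t * O z) ^ 2 := by
      rw [← Real.exp_nat_mul]; congr 1; push_cast; ring
    rw [e1, e2, e3]
    nlinarith [sq_nonneg (Real.exp (t * Dg z) - Real.exp (t * O z))]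
  have hDm : Measurable fun z => eexp (2 * t * Dg z) := by fun_prop
  have hOm : Measurable fun z => eexp (2 * t * O z) := by
    refine measurable_eexp.comp (Measurable.const_mul ?_ _)
    refine Finset.measurable_fun_sum _ fun i _ => Finset.measurable_fun_sum _ fun j _ => ?_
    split_ifs <;> fun_prop
  simp_rw [hsplit]
  calc _ ≤ ∫⁻ z, (ENNReal.ofReal (1 / 2) * eexp (2 * t * Dg z) +
        ENNReal.ofReal (1 / 2) * eexp (2 * t * O z)) ∂Measure.pi ν := lintegral_mono hpt
    _ = ENNReal.ofReal (1 / 2) * ∫⁻ z, eexp (2 * t * Dg z) ∂Measure.pi ν +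
        ENNReal.ofReal (1 / 2) * ∫⁻ z, eexp (2 * t * O z) ∂Measure.pi ν := by
        rw [lintegral_add_left (hDm.const_mul _), lintegral_const_mul _ hDm,
          lintegral_const_mul _ hOm]
    _ ≤ ENNReal.ofReal (1 / 2) * eexp (1024 * s ^ 2 * t ^ 2 * F) +
        ENNReal.ofReal (1 / 2) * eexp (1024 * s ^ 2 * t ^ 2 * F) := by gcongr
    _ = _ := by
        rw [← add_mul, ← ENNReal.ofReal_add (by norm_num) (by norm_num)]
        norm_num

end HansonWright

/-! ### Square roots of the covariances and their norms. -/

section Covariances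

variable {p : ℕ}

lemma sqrt_mul_sqrt {A : Matrix (Fin p) (Fin p) ℝ} (hA : A.PosDef) :
    CFC.sqrt A * CFC.sqrt A = A :=
  CFC.sqrt_mul_sqrt_self A hA.posSemidef.nonneg

lemma sqrt_transpose (A : Matrix (Fin p) (Fin p) ℝ) : (CFC.sqrt A)ᵀ = CFC.sqrt A := by
  have := (Matrix.nonneg_iff_posSemidef.1 (CFC.sqrt_nonneg A)).1
  simpa using this.eq

lemma isUnit_det_sqrt {A : Matrix (Fin p) (Fin p) ℝ} (hA : A.PosDef) :
    IsUnit (CFC.sqrt A).det := by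
  have h1 := hA.det_pos
  rw [← sqrt_mul_sqrt hA, Matrix.det_mul] at h1
  exact isUnit_iff_ne_zero.2 fun h => by simp [h] at h1

lemma opNorm_nonneg (A : Matrix (Fin p) (Fin p) ℝ) : 0 ≤ opNorm A := norm_nonneg _

lemma frobNorm_nonneg (A : Matrix (Fin p) (Fin p) ℝ) : 0 ≤ frobNorm A := Real.sqrt_nonneg _

lemma sum_sqrt_mulVec_sq_le {A : Matrix (Fin p) (Fin p) ℝ} (hA : A.PosDef) (x : Fin p → ℝ) :
    ∑ i, (CFC.sqrt A *ᵥ x) i ^ 2 ≤ opNorm A * ∑ i, x i ^ 2 := by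
  have h1 : ∑ i, (CFC.sqrt A *ᵥ x) i ^ 2 = x ⬝ᵥ A *ᵥ x := by
    conv_rhs => rw [← sqrt_mul_sqrt hA, ← Matrix.mulVec_mulVec, Matrix.dotProduct_mulVec,
      ← Matrix.mulVec_transpose, sqrt_transpose]
    simp [dotProduct, sq]
  have h2 := Matrix.inner_toEuclideanCLM A (WithLp.toLp 2 x) (WithLp.toLp 2 x)
  have h3 : ‖WithLp.toLp 2 x‖ ^ 2 = ∑ i, x i ^ 2 := by
    rw [EuclideanSpace.norm_sq_eq]; simp
  rw [h1]
  calc x ⬝ᵥ A *ᵥ x = _ := h2.symm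
    _ ≤ ‖WithLp.toLp 2 x‖ * ‖Matrix.toEuclideanCLM (𝕜 := ℝ) A (WithLp.toLp 2 x)‖ :=
        real_inner_le_norm _ _
    _ ≤ ‖WithLp.toLp 2 x‖ * (opNorm A * ‖WithLp.toLp 2 x‖) := by
        gcongr; exact ContinuousLinearMap.le_opNorm _ _
    _ = _ := by rw [← h3]; ring

/-- The left side is Tr(AB), and Cauchy–Schwarz applies to the trace product. This is how the
Frobenius norms, hence ν², enter the variance of the quadratic forms. -/
lemma sum_sqrt_mul_sqrt_sq_le {A B : Matrix (Fin p) (Fin p) ℝ} (hA : A.PosDef) (hB : B.PosDef) :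
    ∑ i, ∑ j, (CFC.sqrt A * CFC.sqrt B) i j ^ 2 ≤ frobNorm A * frobNorm B := by
  have h1 : ∑ i, ∑ j, (CFC.sqrt A * CFC.sqrt B) i j ^ 2 = (A * B).trace := by
    have e1 : ∑ i, ∑ j, (CFC.sqrt A * CFC.sqrt B) i j ^ 2 =
        ((CFC.sqrt A * CFC.sqrt B) * (CFC.sqrt A * CFC.sqrt B)ᵀ).trace := by
      generalize CFC.sqrt A * CFC.sqrt B = C
      simp [Matrix.trace, Matrix.mul_apply, sq]
    rw [e1, Matrix.transpose_mul, sqrt_transpose, sqrt_transpose,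
      show CFC.sqrt A * CFC.sqrt B * (CFC.sqrt B * CFC.sqrt A) =
        CFC.sqrt A * ((CFC.sqrt B * CFC.sqrt B) * CFC.sqrt A) by simp only [Matrix.mul_assoc],
      sqrt_mul_sqrt hB, Matrix.trace_mul_comm, Matrix.mul_assoc, sqrt_mul_sqrt hA,
      Matrix.trace_mul_comm]
  have h2 : (A * B).trace = ∑ q : Fin p × Fin p, A q.1 q.2 * B q.2 q.1 := by
    simp [Matrix.trace, Matrix.mul_apply, Fintype.sum_prod_type]
  rw [h1, h2]
  refine (Real.sum_mul_le_sqrt_mul_sqrt _ _ _).trans_eq ?_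
  simp only [frobNorm, Fintype.sum_prod_type]
  congr 2
  exact Finset.sum_comm

lemma opNorm_le_iSup {K : ℕ} (Sigma : Fin K → Matrix (Fin p) (Fin p) ℝ) (k : Fin K) :
    opNorm (Sigma k) ≤ ⨆ k, opNorm (Sigma k) :=
  le_ciSup (f := fun k => opNorm (Sigma k)) (Set.finite_range _).bddAbove k

lemma frobNorm_le_iSup {K : ℕ} (Sigma : Fin K → Matrix (Fin p) (Fin p) ℝ) (k : Fin K) :
    frobNorm (Sigma k) ≤ ⨆ k, frobNorm (Sigma k) :=
  le_ciSup (f := fun k => frobNorm (Sigma k)) (Set.finite_range _).bddAbove k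

lemma sigmaSq_nonneg {K : ℕ} (L : ℝ≥0) (Sigma : Fin K → Matrix (Fin p) (Fin p) ℝ) :
    0 ≤ sigmaSq L Sigma :=
  mul_nonneg (by positivity) (Real.iSup_nonneg fun k => opNorm_nonneg _)

lemma nuSq_nonneg {K : ℕ} (L : ℝ≥0) (Sigma : Fin K → Matrix (Fin p) (Fin p) ℝ) :
    0 ≤ nuSq L Sigma :=
  mul_nonneg (by positivity) (Real.iSup_nonneg fun k => frobNorm_nonneg _)

end Covariances

/-! ### Exponential moments of the noise in the mixture model. -/

section Model

variable {Ω : Type*} {n K p : ℕ}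
  {X : Fin n → Ω → EuclideanSpace ℝ (Fin p)} {G : LabeledPartition n K}
  {mu : Fin K → EuclideanSpace ℝ (Fin p)} {Sigma : Fin K → Matrix (Fin p) (Fin p) ℝ} {L : ℝ≥0}

/-- The noise `E_a = X_a - μ_k`, `a ∈ G_k`. -/
noncomputable def noise (X : Fin n → Ω → EuclideanSpace ℝ (Fin p)) (G : LabeledPartition n K)
    (mu : Fin K → EuclideanSpace ℝ (Fin p)) (a : Fin n) (ω : Ω) : Fin p → ℝ :=
  (X a ω - mu (G.label a)).ofLp

/-- The matrix `E Eᵀ - Γ`. -/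
noncomputable def centeredGram (X : Fin n → Ω → EuclideanSpace ℝ (Fin p))
    (G : LabeledPartition n K) (mu : Fin K → EuclideanSpace ℝ (Fin p))
    (Sigma : Fin K → Matrix (Fin p) (Fin p) ℝ) (ω : Ω) : Matrix (Fin n) (Fin n) ℝ :=
  Matrix.of (fun a b => noise X G mu a ω ⬝ᵥ noise X G mu b ω) - gammaMatrix G Sigma

lemma noise_eq (hpd : ∀ k, (Sigma k).PosDef) (a : Fin n) (ω : Ω) :
    noise X G mu a ω =
      CFC.sqrt (Sigma (G.label a)) *ᵥ whitenedNoise X G mu Sigma a ω := by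
  rw [whitenedNoise, Matrix.mulVec_mulVec, Matrix.mul_nonsing_inv _ (isUnit_det_sqrt (hpd _)),
    Matrix.one_mulVec]
  rfl

lemma whitenedNoise_apply (a : Fin n) (ω : Ω) (i : Fin p) :
    whitenedNoise X G mu Sigma a ω i =
      ∑ j, (CFC.sqrt (Sigma (G.label a)))⁻¹ i j * noise X G mu a ω j := rfl

namespace IsSubGaussianMixture

variable [MeasurableSpace Ω] {P : Measure Ω}

lemma measurable_noise (h : IsSubGaussianMixture P X G mu Sigma L) (a : Fin n) (i : Fin p) :
    Measurable fun ω => noise X G mu a ω i := by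
  have := h.measurable a
  unfold noise
  fun_prop

lemma measurable_whitenedNoise (h : IsSubGaussianMixture P X G mu Sigma L) (a : Fin n)
    (i : Fin p) : Measurable fun ω => whitenedNoise X G mu Sigma a ω i := by
  simp only [whitenedNoise_apply]
  exact Finset.measurable_fun_sum _ fun j _ => (h.measurable_noise a j).const_mul _

/-- Independence across points combines with independence of the coordinates of each point, so the
whole whitened noise has a product law on `Fin n × Fin p`. -/
lemma iIndepFun_whitenedNoise (h : IsSubGaussianMixture P X G mu Sigma L) :
    iIndepFun (fun (q : Fin n × Fin p) ω => whitenedNoise X G mu Sigma q.1 ω q.2) P := by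
  refine iIndepFun_uncurry' (X := fun a i ω => whitenedNoise X G mu Sigma a ω i)
    (fun a i => h.measurable_whitenedNoise a i) ?_ fun a => (h.subG a).1
  refine h.indep.comp (fun a x => (CFC.sqrt (Sigma (G.label a)))⁻¹ *ᵥ
    (x - mu (G.label a)).ofLp) fun a => ?_
  refine measurable_pi_lambda _ fun i => ?_
  simp only [Matrix.mulVec, dotProduct]
  fun_prop

attribute [local irreducible] whitenedNoise

/-- The laws of the coordinates of the whitened noise. -/
noncomputable def law (P : Measure Ω) (X : Fin n → Ω → EuclideanSpace ℝ (Fin p))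
    (G : LabeledPartition n K) (mu : Fin K → EuclideanSpace ℝ (Fin p))
    (Sigma : Fin K → Matrix (Fin p) (Fin p) ℝ) (q : Fin n × Fin p) : Measure ℝ :=
  P.map fun ω => whitenedNoise X G mu Sigma q.1 ω q.2

lemma measurePreserving_whitenedNoise [IsProbabilityMeasure P]
    (h : IsSubGaussianMixture P X G mu Sigma L) :
    MeasurePreserving (fun ω (q : Fin n × Fin p) => whitenedNoise X G mu Sigma q.1 ω q.2) P
      (Measure.pi (law P X G mu Sigma)) := by
  refine ⟨measurable_pi_lambda _ fun q => h.measurable_whitenedNoise q.1 q.2, ?_⟩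
  have h1 := h.iIndepFun_whitenedNoise.map_fun_eq_pi_map
    fun q : Fin n × Fin p => (h.measurable_whitenedNoise q.1 q.2).aemeasurable
  rw [h1]
  rfl

lemma isProbabilityMeasure_law [IsProbabilityMeasure P]
    (h : IsSubGaussianMixture P X G mu Sigma L) (q : Fin n × Fin p) :
    IsProbabilityMeasure (law P X G mu Sigma q) :=
  Measure.isProbabilityMeasure_map (h.measurable_whitenedNoise q.1 q.2).aemeasurable

lemma isSubGLaw_law (h : IsSubGaussianMixture P X G mu Sigma L) :
    IsSubGLaw (law P X G mu Sigma) ((L : ℝ) ^ 2) := by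
  intro q t
  rw [law, lintegral_map (by fun_prop) (h.measurable_whitenedNoise q.1 q.2)]
  have hsub := (h.subG q.1).2 q.2
  unfold eexp
  rw [← ofReal_integral_eq_lintegral_ofReal (hsub.integrable_exp_mul t)
    (Filter.Eventually.of_forall fun x => (Real.exp_pos _).le)]
  refine ENNReal.ofReal_le_ofReal ((hsub.mgf_le t).trans_eq ?_)
  simp

lemma memLp_noise (h : IsSubGaussianMixture P X G mu Sigma L) (a : Fin n) (i : Fin p) :
    MemLp (fun ω => noise X G mu a ω i) 2 P := by
  simp_rw [noise_eq h.posDef, Matrix.mulVec, dotProduct]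
  refine memLp_finsetSum _ fun j _ => ?_
  exact (((h.subG a).2 j).memLp 2).const_mul _

lemma integral_coord [IsProbabilityMeasure P]
    (h : IsSubGaussianMixture P X G mu Sigma L) (a : Fin n) (i : Fin p) :
    ∫ ω, X a ω i ∂P = mu (G.label a) i := by
  have hint : ∀ i, Integrable (fun ω => X a ω i) P := by
    intro i
    have := ((h.memLp_noise a i).integrable one_le_two).add
      (integrable_const (mu (G.label a) i))
    refine this.congr (Filter.Eventually.of_forall fun ω => ?_)
    simp [noise]
  rw [← h.mean a, eval_integral_piLp hint]

lemma integral_noise_mul_noise [IsProbabilityMeasure P]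
    (h : IsSubGaussianMixture P X G mu Sigma L) (a : Fin n)
    (i j : Fin p) :
    ∫ ω, noise X G mu a ω i * noise X G mu a ω j ∂P = Sigma (G.label a) i j := by
  have h1 := h.covariance a i j
  rw [ProbabilityTheory.covariance, h.integral_coord, h.integral_coord] at h1
  rw [← h1]
  simp [noise]

/-- Whitening turns the covariance into the identity. With unit variances, the centering in
Hanson–Wright becomes exactly the pairing with Γ. -/
lemma integral_whitenedNoise_sq [IsProbabilityMeasure P]
    (h : IsSubGaussianMixture P X G mu Sigma L) (a : Fin n)
    (i : Fin p) : ∫ ω, whitenedNoise X G mu Sigma a ω i ^ 2 ∂P = 1 := by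
  set S := CFC.sqrt (Sigma (G.label a)) with hS
  have hu := isUnit_det_sqrt (h.posDef (G.label a))
  have h1 : ∀ ω, whitenedNoise X G mu Sigma a ω i ^ 2 =
      ∑ j, ∑ j', S⁻¹ i j * S⁻¹ i j' * (noise X G mu a ω j * noise X G mu a ω j') := by
    intro ω
    rw [whitenedNoise_apply, sq, Finset.sum_mul_sum]
    exact Finset.sum_congr rfl fun j _ => Finset.sum_congr rfl fun i _ => by ring
  have hint : ∀ j j', Integrable (fun ω =>
      S⁻¹ i j * S⁻¹ i j' * (noise X G mu a ω j * noise X G mu a ω j')) P := fun j j' =>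
    ((h.memLp_noise a j).integrable_mul (h.memLp_noise a j')).const_mul _
  simp_rw [h1]
  rw [integral_finsetSum _ fun j _ => integrable_finsetSum _ fun j' _ => hint j j']
  simp_rw [integral_finsetSum _ fun j' _ => hint _ j', integral_const_mul,
    h.integral_noise_mul_noise]
  have h2 : S⁻¹ * Sigma (G.label a) * S⁻¹ᵀ = 1 := by
    rw [← sqrt_mul_sqrt (h.posDef (G.label a)), Matrix.transpose_nonsing_inv, sqrt_transpose,
      ← hS, ← Matrix.mul_assoc, Matrix.nonsing_inv_mul _ hu, Matrix.one_mul,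
      Matrix.mul_nonsing_inv _ hu]
  have h3 := congrFun (congrFun h2 i) i
  rw [Matrix.one_apply_eq, Matrix.mul_apply] at h3
  rw [← h3, Finset.sum_comm]
  refine Finset.sum_congr rfl fun j _ => ?_
  rw [Matrix.mul_apply, Finset.sum_mul]
  exact Finset.sum_congr rfl fun j' _ => by rw [Matrix.transpose_apply]; ring

lemma integral_sq_law [IsProbabilityMeasure P]
    (h : IsSubGaussianMixture P X G mu Sigma L) (q : Fin n × Fin p) :
    ∫ y, y ^ 2 ∂law P X G mu Sigma q = 1 := by
  rw [law, integral_map (h.measurable_whitenedNoise q.1 q.2).aemeasurable (by fun_prop)]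
  exact h.integral_whitenedNoise_sq q.1 q.2

/-- Exponential moments of linear forms in the noise. -/
lemma lintegral_eexp_linear_noise_le [IsProbabilityMeasure P]
    (h : IsSubGaussianMixture P X G mu Sigma L)
    (v : Fin n → Fin p → ℝ) :
    ∫⁻ ω, eexp (∑ a, v a ⬝ᵥ noise X G mu a ω) ∂P
      ≤ eexp (sigmaSq L Sigma * (∑ a, ∑ i, v a i ^ 2) / 2) := by
  have := h.isProbabilityMeasure_law
  have hop : ∀ a, ∑ i, (CFC.sqrt (Sigma (G.label a)) *ᵥ v a) i ^ 2 ≤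
      (⨆ k, opNorm (Sigma k)) * ∑ i, v a i ^ 2 := fun a =>
    (sum_sqrt_mulVec_sq_le (h.posDef (G.label a)) (v a)).trans
      (mul_le_mul_of_nonneg_right (opNorm_le_iSup Sigma (G.label a)) (by positivity))
  set w : Fin n × Fin p → ℝ := fun q => (CFC.sqrt (Sigma (G.label q.1)) *ᵥ v q.1) q.2 with hw
  have h1 : ∀ ω, ∑ a, v a ⬝ᵥ noise X G mu a ω =
      ∑ q, w q * whitenedNoise X G mu Sigma q.1 ω q.2 := by
    intro ω
    rw [Fintype.sum_prod_type]
    refine Finset.sum_congr rfl fun a _ => ?_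
    rw [noise_eq h.posDef, Matrix.dotProduct_mulVec, ← Matrix.mulVec_transpose, sqrt_transpose]
    simp only [dotProduct, hw]
  simp_rw [h1]
  have hm : Measurable fun z : Fin n × Fin p → ℝ => eexp (∑ q, w q * z q) := by fun_prop
  have h2 := h.measurePreserving_whitenedNoise.lintegral_comp hm
  have h3 := lintegral_eexp_linear_le h.isSubGLaw_law w
  rw [← h2] at h3
  refine h3.trans (eexp_le ?_)
  have h4 : ∑ q, w q ^ 2 ≤ (⨆ k, opNorm (Sigma k)) * ∑ a, ∑ i, v a i ^ 2 := by
    rw [Fintype.sum_prod_type, Finset.mul_sum]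
    exact Finset.sum_le_sum fun a _ => hop a
  rw [sigmaSq, mul_assoc]
  gcongr

/-- Exponential moments of quadratic forms in the noise. -/
lemma lintegral_eexp_centeredGram_le [IsProbabilityMeasure P]
    (h : IsSubGaussianMixture P X G mu Sigma L) (hL : 0 < L)
    (N : Matrix (Fin n) (Fin n) ℝ) {f t : ℝ} (hf : ∑ a, ∑ b, N a b ^ 2 ≤ f)
    (ht : 256 * t ^ 2 * f * sigmaSq L Sigma ^ 2 ≤ 1) :
    ∫⁻ ω, eexp (t * ∑ a, ∑ b, N a b * centeredGram X G mu Sigma ω a b) ∂P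
      ≤ eexp (1024 * t ^ 2 * f * nuSq L Sigma ^ 2) := by
  have := h.isProbabilityMeasure_law
  set S : Fin n → Matrix (Fin p) (Fin p) ℝ := fun a => CFC.sqrt (Sigma (G.label a))
  set σ := ⨆ k, opNorm (Sigma k) with hσ
  set ν := ⨆ k, frobNorm (Sigma k) with hν
  have hσ0 : 0 ≤ σ := Real.iSup_nonneg fun k => opNorm_nonneg _
  have hν0 : 0 ≤ ν := Real.iSup_nonneg fun k => frobNorm_nonneg _
  have hf0 : 0 ≤ f := le_trans (by positivity) hf
  have hST : ∀ a, (S a)ᵀ = S a := fun a => sqrt_transpose _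
  have hSS : ∀ a, S a * S a = Sigma (G.label a) := fun a => sqrt_mul_sqrt (h.posDef (G.label a))
  have hSop : ∀ a (x : Fin p → ℝ), ∑ i, (S a *ᵥ x) i ^ 2 ≤ σ * ∑ i, x i ^ 2 := fun a x =>
    (sum_sqrt_mulVec_sq_le (h.posDef (G.label a)) x).trans
      (mul_le_mul_of_nonneg_right (opNorm_le_iSup Sigma (G.label a)) (by positivity))
  have hSF : ∀ a b, ∑ i, ∑ j, (S a * S b) i j ^ 2 ≤ ν ^ 2 := fun a b => by
    refine (sum_sqrt_mul_sqrt_sq_le (h.posDef (G.label a)) (h.posDef (G.label b))).trans ?_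
    rw [sq]
    exact mul_le_mul (frobNorm_le_iSup Sigma (G.label a)) (frobNorm_le_iSup Sigma (G.label b))
      (frobNorm_nonneg _) hν0
  have hnoise : ∀ a ω, noise X G mu a ω = S a *ᵥ whitenedNoise X G mu Sigma a ω :=
    fun a ω => noise_eq h.posDef a ω
  clear_value S
  -- The form ∑ N a b ⟨E_a, E_b⟩ as a form in the whitened noise, with blocks N a b √Σ_a √Σ_b.
  set A : Matrix (Fin n × Fin p) (Fin n × Fin p) ℝ :=
    Matrix.of fun q r => N q.1 r.1 * (S q.1 * S r.1) q.2 r.2 with hA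
  have hAF : ∑ q, ∑ r, A q r ^ 2 ≤ f * ν ^ 2 := by
    have h1 : ∑ q, ∑ r, A q r ^ 2 =
        ∑ a, ∑ b, N a b ^ 2 * ∑ i, ∑ j, (S a * S b) i j ^ 2 := by
      simp only [hA, Matrix.of_apply, Fintype.sum_prod_type, mul_pow, Finset.mul_sum]
      exact Finset.sum_congr rfl fun a _ => Finset.sum_comm
    rw [h1]
    calc _ ≤ ∑ a, ∑ b, N a b ^ 2 * ν ^ 2 := by
          gcongr with a _ b _
          exact hSF a b
      _ = (∑ a, ∑ b, N a b ^ 2) * ν ^ 2 := by simp_rw [Finset.sum_mul]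
      _ ≤ _ := by gcongr
  -- Each square root costs a factor at most √σ, and the operator norm of N is bounded by its
  -- Frobenius norm.
  have hAop : ∀ z : Fin n × Fin p → ℝ,
      ∑ q, (Aᵀ *ᵥ z) q ^ 2 ≤ (f * σ ^ 2) * ∑ q, z q ^ 2 := by
    intro z
    set y : Fin n → Fin p → ℝ := fun a => S a *ᵥ fun i => z (a, i) with hy
    have hyb : ∀ a, ∑ i, y a i ^ 2 ≤ σ * ∑ i, z (a, i) ^ 2 := fun a =>
      hSop a _
    set x : Fin n → Fin p → ℝ := fun b i => ∑ a, N a b * y a i with hx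
    have h1 : ∀ b j, (Aᵀ *ᵥ z) (b, j) = (S b *ᵥ x b) j := by
      intro b j
      simp only [hA, hx, hy, Matrix.mulVec, dotProduct, Matrix.transpose_apply, Matrix.of_apply,
        Fintype.sum_prod_type, Matrix.mul_apply, Finset.mul_sum, Finset.sum_mul]
      conv_rhs => rw [Finset.sum_comm]
      refine Finset.sum_congr rfl fun a _ => ?_
      conv_rhs => rw [Finset.sum_comm]
      refine Finset.sum_congr rfl fun i _ => Finset.sum_congr rfl fun l _ => ?_
      have e1 : S a i l = S a l i := by conv_lhs => rw [← hST a, Matrix.transpose_apply]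
      have e2 : S b l j = S b j l := by conv_lhs => rw [← hST b, Matrix.transpose_apply]
      rw [e1, e2]; ring
    have hxb : ∀ b, ∑ i, x b i ^ 2 ≤ (∑ a, N a b ^ 2) * (σ * ∑ q, z q ^ 2) := by
      intro b
      calc ∑ i, x b i ^ 2 ≤ ∑ i, (∑ a, N a b ^ 2) * ∑ a, y a i ^ 2 :=
            Finset.sum_le_sum fun i _ => Finset.sum_mul_sq_le_sq_mul_sq _ _ _
        _ = (∑ a, N a b ^ 2) * ∑ a, ∑ i, y a i ^ 2 := by
            rw [← Finset.mul_sum, Finset.sum_comm]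
        _ ≤ (∑ a, N a b ^ 2) * ∑ a, σ * ∑ i, z (a, i) ^ 2 := by
            gcongr with a; exact hyb a
        _ = _ := by rw [← Finset.mul_sum, Fintype.sum_prod_type]
    rw [Fintype.sum_prod_type]
    simp_rw [h1]
    calc ∑ b, ∑ j, (S b *ᵥ x b) j ^ 2 ≤ ∑ b, σ * ((∑ a, N a b ^ 2) * (σ * ∑ q, z q ^ 2)) := by
          refine Finset.sum_le_sum fun b _ => (hSop b _).trans ?_
          exact mul_le_mul_of_nonneg_left (hxb b) hσ0
      _ = (∑ a, ∑ b, N a b ^ 2) * (σ ^ 2 * ∑ q, z q ^ 2) := by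
          rw [← Finset.mul_sum, ← Finset.sum_mul, Finset.sum_comm]; ring
      _ ≤ f * (σ ^ 2 * ∑ q, z q ^ 2) := by gcongr
      _ = _ := by ring
  have hL2 : 0 < (L : ℝ) ^ 2 := by have : (0 : ℝ) < L := hL; positivity
  have hform : ∀ ω, ∑ a, ∑ b, N a b * centeredGram X G mu Sigma ω a b =
      (∑ q, ∑ r, A q r * whitenedNoise X G mu Sigma q.1 ω q.2 *
        whitenedNoise X G mu Sigma r.1 ω r.2) -
        ∑ q, A q q * ∫ y, y ^ 2 ∂law P X G mu Sigma q := by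
    intro ω
    have e1 : ∀ a b, noise X G mu a ω ⬝ᵥ noise X G mu b ω = ∑ i, ∑ j, (S a * S b) i j *
        whitenedNoise X G mu Sigma a ω i * whitenedNoise X G mu Sigma b ω j := by
      intro a b
      rw [hnoise, hnoise, Matrix.dotProduct_mulVec, ← Matrix.mulVec_transpose, hST,
        Matrix.mulVec_mulVec]
      simp only [dotProduct, Matrix.mulVec, Finset.sum_mul]
      rw [Finset.sum_comm]
      refine Finset.sum_congr rfl fun i _ => Finset.sum_congr rfl fun j _ => ?_
      have : (S b * S a) j i = (S a * S b) i j := by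
        conv_rhs => rw [← hST a, ← hST b, ← Matrix.transpose_mul, Matrix.transpose_apply]
      rw [this]
    have e2 : ∑ q, A q q * ∫ y, y ^ 2 ∂law P X G mu Sigma q =
        ∑ a, ∑ b, N a b * gammaMatrix G Sigma a b := by
      simp_rw [h.integral_sq_law, mul_one]
      rw [Fintype.sum_prod_type]
      refine Finset.sum_congr rfl fun a _ => ?_
      rw [Finset.sum_eq_single a (fun b _ hb => by simp [gammaMatrix, hb.symm])
        (by simp)]
      simp only [hA, Matrix.of_apply, ← Finset.mul_sum, hSS,
        gammaMatrix, Matrix.diagonal_apply_eq]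
      rfl
    have e3 : ∑ q, ∑ r, A q r * whitenedNoise X G mu Sigma q.1 ω q.2 *
        whitenedNoise X G mu Sigma r.1 ω r.2 =
        ∑ a, ∑ b, N a b * (noise X G mu a ω ⬝ᵥ noise X G mu b ω) := by
      simp only [e1, hA, Matrix.of_apply, Fintype.sum_prod_type, Finset.mul_sum]
      refine Finset.sum_congr rfl fun a _ => ?_
      rw [Finset.sum_comm]
      exact Finset.sum_congr rfl fun b _ => Finset.sum_congr rfl fun i _ =>
        Finset.sum_congr rfl fun j _ => by ring
    rw [e2, e3, ← Finset.sum_sub_distrib]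
    refine Finset.sum_congr rfl fun a _ => ?_
    rw [← Finset.sum_sub_distrib]
    refine Finset.sum_congr rfl fun b _ => ?_
    simp only [centeredGram, Matrix.sub_apply, Matrix.of_apply]
    ring
  simp_rw [hform]
  have hm : Measurable fun z : Fin n × Fin p → ℝ => eexp (t * ((∑ q, ∑ r, A q r * z q * z r) -
      ∑ q, A q q * ∫ y, y ^ 2 ∂law P X G mu Sigma q)) := by fun_prop
  have h2 := h.measurePreserving_whitenedNoise.lintegral_comp hm
  have ht' : 256 * ((L : ℝ) ^ 2) ^ 2 * t ^ 2 * (f * σ ^ 2) ≤ 1 := by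
    refine le_trans (le_of_eq ?_) ht
    rw [sigmaSq]; ring
  have h3 := lintegral_eexp_quadratic_le hL2 h.isSubGLaw_law A (by positivity) hAop ht'
  rw [← h2] at h3
  refine h3.trans (eexp_le ?_)
  calc _ ≤ 1024 * ((L : ℝ) ^ 2) ^ 2 * t ^ 2 * (f * ν ^ 2) := by gcongr
      _ = _ := by rw [nuSq]; ring

end IsSubGaussianMixture

end Model

/-! ### The normalized membership matrix of a partition. -/

section Partition

variable {n K : ℕ} (G : LabeledPartition n K)

lemma mem_group {a : Fin n} {k : Fin K} : a ∈ G.group k ↔ G.label a = k := by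
  simp [LabeledPartition.group]

lemma card_group_pos (k : Fin K) : 0 < (G.group k).card := by
  obtain ⟨a, ha⟩ := G.surj k
  exact Finset.card_pos.2 ⟨a, (mem_group G).2 ha⟩

lemma minSize_le (k : Fin K) : G.minSize ≤ (G.group k).card :=
  ciInf_le (OrderBot.bddBelow _) k

lemma minSize_pos (hK : 0 < K) : 0 < G.minSize := by
  have : Nonempty (Fin K) := ⟨⟨0, hK⟩⟩
  obtain ⟨k, hk⟩ := exists_eq_ciInf_of_finite (f := fun k => (G.group k).card)
  rw [LabeledPartition.minSize, ← hk]
  exact card_group_pos G k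

lemma sum_group (f : Fin n → ℝ) (k : Fin K) :
    ∑ a ∈ G.group k, f a = ∑ a, if G.label a = k then f a else 0 := by
  rw [LabeledPartition.group, Finset.sum_filter]

lemma sum_eq_sum_group (f : Fin n → ℝ) : ∑ a, f a = ∑ k, ∑ a ∈ G.group k, f a := by
  simp_rw [LabeledPartition.group]
  exact (Finset.sum_fiberwise Finset.univ G.label f).symm

lemma mul_minSize_le : K * G.minSize ≤ n := by
  have h : ∑ k, (G.group k).card = n := by
    have := sum_eq_sum_group G fun _ => 1
    simp only [Finset.sum_const, nsmul_eq_mul, mul_one, Finset.card_univ, Fintype.card_fin] at this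
    exact_mod_cast this.symm
  calc K * G.minSize = ∑ _k : Fin K, G.minSize := by simp
    _ ≤ ∑ k, (G.group k).card := Finset.sum_le_sum fun k _ => minSize_le G k
    _ = n := h

/-- The vector of weights of the mean over the group `k`. -/
noncomputable def groupVec (k : Fin K) (a : Fin n) : ℝ :=
  if G.label a = k then ((G.group k).card : ℝ)⁻¹ else 0

/-- The normalized membership matrix `B* = A (Aᵀ A)⁻¹ Aᵀ` of the partition. -/
noncomputable def truth : Matrix (Fin n) (Fin n) ℝ :=
  Matrix.of fun a b => groupVec G (G.label a) b

lemma groupVec_nonneg (k : Fin K) (a : Fin n) : 0 ≤ groupVec G k a := by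
  unfold groupVec; split_ifs <;> positivity

lemma sum_groupVec_mul (k : Fin K) (f : Fin n → ℝ) :
    ∑ a, groupVec G k a * f a = ((G.group k).card : ℝ)⁻¹ * ∑ a ∈ G.group k, f a := by
  rw [sum_group, Finset.mul_sum]
  refine Finset.sum_congr rfl fun a _ => ?_
  unfold groupVec; split_ifs <;> simp

lemma sum_groupVec (k : Fin K) : ∑ a, groupVec G k a = 1 := by
  have h := sum_groupVec_mul G k fun _ => 1
  have := card_group_pos G k
  simp only [mul_one, Finset.sum_const, nsmul_eq_mul] at h
  rw [h, inv_mul_cancel₀ (by positivity)]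

lemma sum_groupVec_sq (k : Fin K) :
    ∑ a, groupVec G k a ^ 2 = ((G.group k).card : ℝ)⁻¹ := by
  have := card_group_pos G k
  simp_rw [sq]
  rw [sum_groupVec_mul]
  have h : ∑ a ∈ G.group k, groupVec G k a = ∑ a ∈ G.group k, ((G.group k).card : ℝ)⁻¹ :=
    Finset.sum_congr rfl fun a ha => by rw [groupVec, if_pos ((mem_group G).1 ha)]
  rw [h, Finset.sum_const, nsmul_eq_mul, mul_inv_cancel₀ (by positivity), mul_one]

lemma inv_card_group_le (hK : 0 < K) (k : Fin K) :
    ((G.group k).card : ℝ)⁻¹ ≤ (G.minSize : ℝ)⁻¹ := by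
  have := minSize_pos G hK
  exact inv_anti₀ (by positivity) (by exact_mod_cast minSize_le G k)

lemma truth_symm (a b : Fin n) : truth G a b = truth G b a := by
  simp only [truth, Matrix.of_apply, groupVec]
  by_cases h : G.label a = G.label b
  · simp [h]
  · simp [h, Ne.symm h]

lemma truth_transpose : (truth G)ᵀ = truth G := by
  ext a b; exact truth_symm G b a

lemma truth_apply_right (a b : Fin n) : truth G a b = groupVec G (G.label b) a := by
  rw [truth_symm]; rfl

lemma truth_mul_truth : truth G * truth G = truth G := by
  ext a b
  rw [Matrix.mul_apply]
  have h : ∀ c, truth G a c * truth G c b = groupVec G (G.label a) c * truth G a b := by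
    intro c
    simp only [truth, Matrix.of_apply]
    by_cases hc : G.label c = G.label a
    · rw [hc]
    · simp [groupVec, hc]
  simp_rw [h]
  rw [← Finset.sum_mul, sum_groupVec, one_mul]

lemma truth_mulVec_one : truth G *ᵥ 1 = 1 := by
  ext a
  simp only [Matrix.mulVec, dotProduct, Pi.one_apply, mul_one]
  exact sum_groupVec G _

lemma truth_trace : (truth G).trace = K := by
  simp only [Matrix.trace, Matrix.diag_apply]
  rw [sum_eq_sum_group G]
  have h : ∀ k, ∑ a ∈ G.group k, truth G a a = 1 := by
    intro k
    have hc := card_group_pos G k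
    have : ∑ a ∈ G.group k, truth G a a = ∑ a ∈ G.group k, ((G.group k).card : ℝ)⁻¹ :=
      Finset.sum_congr rfl fun a ha => by
        simp [truth, groupVec, (mem_group G).1 ha]
    rw [this, Finset.sum_const, nsmul_eq_mul, mul_inv_cancel₀ (by positivity)]
  simp [h]

lemma truth_posSemidef : (truth G).PosSemidef := by
  have := Matrix.posSemidef_conjTranspose_mul_self (truth G)
  rwa [Matrix.conjTranspose_eq_transpose_of_trivial, truth_transpose, truth_mul_truth] at this

lemma truth_mem_feasible : truth G ∈ feasible n K :=
  ⟨truth_posSemidef G, truth_trace G, truth_mulVec_one G, fun _ _ => groupVec_nonneg G _ _⟩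

/-- The mass that column `b` of `B` gives to the group `k`. -/
noncomputable def mass (B : Matrix (Fin n) (Fin n) ℝ) (b : Fin n) (k : Fin K) : ℝ :=
  ∑ a ∈ G.group k, B a b

/-- The total mass of `B` outside the diagonal blocks. -/
noncomputable def offMass (B : Matrix (Fin n) (Fin n) ℝ) : ℝ :=
  ∑ b, (1 - mass G B b (G.label b))

end Partition

/-! ### Geometry of the feasible set around the membership matrix. -/

section Feasible

variable {n K : ℕ} (G : LabeledPartition n K) {B : Matrix (Fin n) (Fin n) ℝ}

lemma feasible_symm (hB : B ∈ feasible n K) (a b : Fin n) : B a b = B b a := by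
  have := hB.1.1.eq
  rw [Matrix.conjTranspose_eq_transpose_of_trivial] at this
  conv_lhs => rw [← this, Matrix.transpose_apply]

lemma feasible_transpose (hB : B ∈ feasible n K) : Bᵀ = B := by
  ext a b; exact feasible_symm hB b a

lemma feasible_row_sum (hB : B ∈ feasible n K) (a : Fin n) : ∑ b, B a b = 1 := by
  have := congrFun hB.2.2.1 a
  simpa [Matrix.mulVec, dotProduct] using this

lemma feasible_col_sum (hB : B ∈ feasible n K) (b : Fin n) : ∑ a, B a b = 1 := by
  simp_rw [feasible_symm hB _ b]; exact feasible_row_sum hB b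

lemma mass_nonneg (hB : B ∈ feasible n K) (b : Fin n) (k : Fin K) : 0 ≤ mass G B b k :=
  Finset.sum_nonneg fun a _ => hB.2.2.2 a b

lemma sum_mass (hB : B ∈ feasible n K) (b : Fin n) : ∑ k, mass G B b k = 1 := by
  rw [← feasible_col_sum hB b]; exact (sum_eq_sum_group G _).symm

lemma mass_le_one (hB : B ∈ feasible n K) (b : Fin n) (k : Fin K) : mass G B b k ≤ 1 := by
  rw [← sum_mass G hB b]
  exact Finset.single_le_sum (fun k _ => mass_nonneg G hB b k) (Finset.mem_univ k)

lemma offMass_nonneg (hB : B ∈ feasible n K) : 0 ≤ offMass G B :=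
  Finset.sum_nonneg fun b _ => sub_nonneg.2 (mass_le_one G hB b _)

/-- Column b of B sums to 1, so `1 - mass G B b (G.label b)` is its whole weight on the foreign
groups, and f vanishes on the own group. -/
lemma sum_mass_mul_le (hB : B ∈ feasible n K) (b : Fin n) {f : Fin K → ℝ} {c : ℝ}
    (h0 : f (G.label b) = 0) (hf : ∀ k, k ≠ G.label b → f k ≤ c) :
    ∑ k, mass G B b k * f k ≤ c * (1 - mass G B b (G.label b)) := by
  rw [← sum_mass G hB b, ← Finset.add_sum_erase _ _ (Finset.mem_univ (G.label b)),
    ← Finset.add_sum_erase _ (mass G B b) (Finset.mem_univ (G.label b)), h0, mul_zero, zero_add,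
    add_sub_cancel_left, Finset.mul_sum]
  refine Finset.sum_le_sum fun k hk => ?_
  rw [mul_comm c]
  exact mul_le_mul_of_nonneg_left (hf k (Finset.ne_of_mem_erase hk)) (mass_nonneg G hB b k)

lemma sum_sum_mass_mul_le (hB : B ∈ feasible n K) {f : Fin n → Fin K → ℝ} {c : ℝ}
    (h0 : ∀ b, f b (G.label b) = 0) (hf : ∀ b k, k ≠ G.label b → f b k ≤ c) :
    ∑ b, ∑ k, mass G B b k * f b k ≤ c * offMass G B := by
  rw [offMass, Finset.mul_sum]
  exact Finset.sum_le_sum fun b _ => sum_mass_mul_le G hB b (h0 b) (hf b)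

/-- Pairing with `B - B*` of a matrix whose rows are constant on the groups. -/
lemma sum_mul_sub_truth (hB : B ∈ feasible n K) (φ : Fin K → Fin n → ℝ) :
    ∑ a, ∑ b, φ (G.label a) b * (B - truth G) a b =
      ∑ b, ∑ k, mass G B b k * (φ k b - φ (G.label b) b) := by
  rw [Finset.sum_comm]
  refine Finset.sum_congr rfl fun b _ => ?_
  simp only [Matrix.sub_apply, mul_sub, Finset.sum_sub_distrib]
  congr 1
  · rw [sum_eq_sum_group G]
    refine Finset.sum_congr rfl fun k _ => ?_
    rw [mass, Finset.sum_mul]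
    refine Finset.sum_congr rfl fun a ha => ?_
    rw [(mem_group G).1 ha, mul_comm]
  · rw [← Finset.sum_mul, sum_mass G hB, one_mul]
    have : ∀ a, φ (G.label a) b * truth G a b = groupVec G (G.label b) a * φ (G.label b) b := by
      intro a
      rw [truth_apply_right]
      by_cases h : G.label a = G.label b
      · rw [h, mul_comm]
      · simp [groupVec, h]
    simp_rw [this]
    rw [← Finset.sum_mul, sum_groupVec, one_mul]

lemma entryInner_eq_trace {ι : Type*} [Fintype ι] (A C : Matrix ι ι ℝ) :
    entryInner A C = (Aᵀ * C).trace := by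
  simp only [entryInner, Matrix.trace, Matrix.diag_apply, Matrix.mul_apply, Matrix.transpose_apply]
  exact Finset.sum_comm

lemma entryInner_transpose {ι : Type*} [Fintype ι] (A C : Matrix ι ι ℝ) :
    entryInner Aᵀ Cᵀ = entryInner A C := by
  simp only [entryInner, Matrix.transpose_apply]
  exact Finset.sum_comm

lemma entryInner_add_right {ι : Type*} [Fintype ι] (A C D : Matrix ι ι ℝ) :
    entryInner A (C + D) = entryInner A C + entryInner A D := by
  simp [entryInner_eq_trace, Matrix.mul_add]

lemma entryInner_sub_right {ι : Type*} [Fintype ι] (A C D : Matrix ι ι ℝ) :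
    entryInner A (C - D) = entryInner A C - entryInner A D := by
  simp [entryInner_eq_trace, Matrix.mul_sub]

lemma entryInner_add_left {ι : Type*} [Fintype ι] (A C D : Matrix ι ι ℝ) :
    entryInner (A + C) D = entryInner A D + entryInner C D := by
  simp [entryInner_eq_trace, Matrix.add_mul]

/-- A Gram factorization of a positive semidefinite matrix. -/
lemma exists_gram {ι : Type*} [Fintype ι] [DecidableEq ι] {S : Matrix ι ι ℝ}
    (hS : S.PosSemidef) : ∃ R : Matrix ι ι ℝ, ∀ a b, S a b = ∑ i, R i a * R i b := by
  refine ⟨CFC.sqrt S, fun a b => ?_⟩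
  have h1 : CFC.sqrt S * CFC.sqrt S = S := CFC.sqrt_mul_sqrt_self S hS.nonneg
  have h2 := (Matrix.nonneg_iff_posSemidef.1 (CFC.sqrt_nonneg S)).1.eq
  rw [Matrix.conjTranspose_eq_transpose_of_trivial] at h2
  conv_lhs => rw [← h1, Matrix.mul_apply]
  refine Finset.sum_congr rfl fun i _ => ?_
  conv_lhs => rw [← h2, Matrix.transpose_apply, h2]

/-- A Gram factorization makes S a sum of rank-one matrices, and the quadratic form bound applies to
each of them. -/
lemma entryInner_posSemidef_le {ι : Type*} [Fintype ι] [DecidableEq ι] {Y S : Matrix ι ι ℝ}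
    {ρ : ℝ} (hS : S.PosSemidef)
    (hY : ∀ x : ι → ℝ, ∑ a, ∑ b, x a * Y a b * x b ≤ ρ * ∑ a, x a ^ 2) :
    entryInner Y S ≤ ρ * S.trace := by
  obtain ⟨R, hR⟩ := exists_gram hS
  have h1 : entryInner Y S = ∑ i, ∑ a, ∑ b, R i a * Y a b * R i b := by
    simp only [entryInner, hR, Finset.mul_sum]
    rw [Finset.sum_comm' (t' := Finset.univ) (s' := fun _ => Finset.univ) (by simp)]
    conv_rhs => rw [Finset.sum_comm]
    rw [Finset.sum_comm]
    refine Finset.sum_congr rfl fun a _ => ?_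
    rw [Finset.sum_comm]
    exact Finset.sum_congr rfl fun i _ => Finset.sum_congr rfl fun b _ => by ring
  have h2 : S.trace = ∑ i, ∑ a, R i a ^ 2 := by
    simp only [Matrix.trace, Matrix.diag_apply, hR, sq]
    exact Finset.sum_comm
  rw [h1, h2, Finset.mul_sum]
  exact Finset.sum_le_sum fun i _ => hY _

/-- In a positive semidefinite matrix |S a b| ≤ (S a a + S b b)/2. -/
lemma sum_abs_posSemidef_le {S : Matrix (Fin n) (Fin n) ℝ} (hS : S.PosSemidef) :
    ∑ a, ∑ b, |S a b| ≤ n * S.trace := by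
  obtain ⟨R, hR⟩ := exists_gram hS
  have h : ∀ a b, |S a b| ≤ (S a a + S b b) / 2 := by
    intro a b
    rw [hR a b, hR a a, hR b b, ← Finset.sum_add_distrib, Finset.sum_div]
    refine (Finset.abs_sum_le_sum_abs _ _).trans (Finset.sum_le_sum fun i _ => ?_)
    rw [abs_mul]
    nlinarith [sq_nonneg (|R i a| - |R i b|), sq_abs (R i a), sq_abs (R i b)]
  refine (Finset.sum_le_sum fun a _ => Finset.sum_le_sum fun b _ => h a b).trans_eq ?_
  simp only [← Finset.sum_div, Finset.sum_add_distrib, Finset.sum_const, Finset.card_univ,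
    Fintype.card_fin, nsmul_eq_mul, ← Finset.mul_sum, Matrix.trace, Matrix.diag_apply]
  ring

/-- The compression of `B` to the orthogonal complement of the range of `B*`. -/
noncomputable def residual (B : Matrix (Fin n) (Fin n) ℝ) : Matrix (Fin n) (Fin n) ℝ :=
  (1 - truth G) * B * (1 - truth G)

lemma residual_posSemidef (hB : B ∈ feasible n K) : (residual G B).PosSemidef := by
  have h := hB.1.mul_mul_conjTranspose_same (1 - truth G)
  rwa [Matrix.conjTranspose_eq_transpose_of_trivial, Matrix.transpose_sub, truth_transpose,
    Matrix.transpose_one] at h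

/-- The trace is Tr B - Tr(B*B). Since Tr B = K = Tr B*, both terms are sums over b of 1/|G_k|, k
the group of b, the second one weighted by the own mass of column b. The difference is thus a
weighted version of δ, and the bound is linear in δ. -/
lemma trace_residual_le (hK : 0 < K) (hB : B ∈ feasible n K) :
    (residual G B).trace ≤ (G.minSize : ℝ)⁻¹ * offMass G B := by
  have hQ : (1 - truth G) * (1 - truth G) = 1 - truth G := by
    rw [Matrix.sub_mul, Matrix.mul_sub, Matrix.mul_sub, truth_mul_truth]; simp
  have h1 : (residual G B).trace = B.trace - (truth G * B).trace := by
    rw [residual, Matrix.trace_mul_comm, ← Matrix.mul_assoc, hQ, Matrix.sub_mul, Matrix.trace_sub,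
      Matrix.one_mul]
  have h2 : (truth G * B).trace =
      ∑ b, ((G.group (G.label b)).card : ℝ)⁻¹ * mass G B b (G.label b) := by
    simp only [Matrix.trace, Matrix.diag_apply, Matrix.mul_apply]
    exact Finset.sum_congr rfl fun b _ => sum_groupVec_mul G _ _
  have h3 : B.trace = ∑ b, ((G.group (G.label b)).card : ℝ)⁻¹ := by
    rw [hB.2.1, ← truth_trace G]
    simp [Matrix.trace, truth, groupVec]
  rw [h1, h2, h3, ← Finset.sum_sub_distrib, offMass, Finset.mul_sum]
  refine Finset.sum_le_sum fun b _ => ?_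
  rw [← mul_one_sub]
  exact mul_le_mul_of_nonneg_right (inv_card_group_le G hK _)
    (sub_nonneg.2 (mass_le_one G hB b _))

/-- B* is a projection T, and any C equals TC + CT - TCT + (1 - T)C(1 - T); for C = B - T the last
term only sees B, because (1 - T)T = 0. -/
lemma sub_truth_decomposition :
    B - truth G = truth G * (B - truth G) + (B - truth G) * truth G
      - truth G * (B - truth G) * truth G + residual G B := by
  have h := truth_mul_truth G
  rw [residual]
  generalize truth G = T at h ⊢
  simp only [Matrix.mul_sub, Matrix.sub_mul, Matrix.mul_assoc, h, Matrix.one_mul, Matrix.mul_one]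
  abel

/-- Pairing with `B - B*` of a symmetric matrix `Y` of operator norm at most `ρ`. -/
lemma entryInner_sub_truth_le (hK : 0 < K) (hB : B ∈ feasible n K)
    {Y : Matrix (Fin n) (Fin n) ℝ} (hYs : Yᵀ = Y) {ρ : ℝ} (hρ0 : 0 ≤ ρ)
    (hY : ∀ x y : Fin n → ℝ,
      ∑ a, ∑ b, x a * Y a b * y b ≤ ρ / 2 * (∑ a, x a ^ 2 + ∑ a, y a ^ 2)) :
    entryInner Y (B - truth G) ≤
      ∑ b, ∑ k, mass G B b k * (2 * (∑ a, groupVec G k a * Y a b -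
        ∑ a, groupVec G (G.label b) a * Y a b)) + 3 * ρ / G.minSize * offMass G B := by
  set T := truth G with hT
  set C := B - T with hC
  have hTt : Tᵀ = T := truth_transpose G
  have hCt : Cᵀ = C := by rw [hC, Matrix.transpose_sub, feasible_transpose hB, hTt]
  set β : Fin K → Fin K → ℝ :=
    fun k j => ∑ c, ∑ d, groupVec G k c * Y c d * groupVec G j d with hβ
  -- This term stays explicit: it pairs a group vector, of norm at most 1/√m, with a single
  -- coordinate, so the operator norm would give ρ/√m per unit of mass instead of ρ/m.
  have h1 : entryInner Y (T * C) = ∑ b, ∑ k, mass G B b k *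
      (∑ a, groupVec G k a * Y a b - ∑ a, groupVec G (G.label b) a * Y a b) := by
    have e : entryInner Y (T * C) = entryInner (T * Y) C := by
      rw [entryInner_eq_trace, entryInner_eq_trace, Matrix.transpose_mul, hTt, Matrix.mul_assoc]
    rw [e, ← sum_mul_sub_truth G hB fun k b => ∑ a, groupVec G k a * Y a b]
    simp only [entryInner, Matrix.mul_apply]
    rfl
  have h2 : entryInner Y (C * T) = entryInner Y (T * C) := by
    rw [← entryInner_transpose Y (T * C), Matrix.transpose_mul, hTt, hCt, hYs]
  have h3 : entryInner Y (T * C * T) =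
      ∑ b, ∑ k, mass G B b k * (β k (G.label b) - β (G.label b) (G.label b)) := by
    have e : entryInner Y (T * C * T) = entryInner (T * Y * T) C := by
      rw [entryInner_eq_trace, entryInner_eq_trace, Matrix.transpose_mul, Matrix.transpose_mul,
        hTt, ← Matrix.mul_assoc, Matrix.trace_mul_comm]
      simp only [Matrix.mul_assoc]
    rw [e, ← sum_mul_sub_truth G hB fun k b => β k (G.label b)]
    simp only [entryInner, Matrix.mul_apply, hβ]
    refine Finset.sum_congr rfl fun a _ => Finset.sum_congr rfl fun b _ => ?_
    congr 1
    conv_rhs => rw [Finset.sum_comm]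
    refine Finset.sum_congr rfl fun d _ => ?_
    rw [hT, truth_apply_right G d b, Finset.sum_mul]
    rfl
  have hm : 0 < (G.minSize : ℝ) := by exact_mod_cast minSize_pos G hK
  -- Two group vectors are paired here, each of squared norm at most 1/m, which gives the full
  -- factor 1/m.
  have hβb : ∀ k j, β k j ≤ ρ / G.minSize ∧ -β k j ≤ ρ / G.minSize := by
    intro k j
    have hb : ρ / 2 * (∑ a, groupVec G k a ^ 2 + ∑ a, groupVec G j a ^ 2) ≤ ρ / G.minSize := by
      rw [sum_groupVec_sq, sum_groupVec_sq, div_eq_mul_inv ρ (G.minSize : ℝ)]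
      have := inv_card_group_le G hK k
      have := inv_card_group_le G hK j
      nlinarith
    constructor
    · exact (hY _ _).trans hb
    · have := hY (fun a => -groupVec G k a) (groupVec G j)
      simp only [neg_mul, Finset.sum_neg_distrib, even_two, Even.neg_pow] at this
      exact this.trans hb
  have h4 : -entryInner Y (T * C * T) ≤ 2 * ρ / G.minSize * offMass G B := by
    rw [h3, ← Finset.sum_neg_distrib]
    simp_rw [← Finset.sum_neg_distrib, ← mul_neg]
    refine sum_sum_mass_mul_le G hB (by simp) fun b k _ => ?_
    have h5 := (hβb k (G.label b)).2
    have h6 := (hβb (G.label b) (G.label b)).1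
    rw [show 2 * ρ / (G.minSize : ℝ) = ρ / G.minSize + ρ / G.minSize by ring]
    linarith
  have h5 : entryInner Y (residual G B) ≤ ρ / G.minSize * offMass G B := by
    refine (entryInner_posSemidef_le (residual_posSemidef G hB) fun x =>
      (hY x x).trans_eq (by ring)).trans ?_
    calc _ ≤ ρ * ((G.minSize : ℝ)⁻¹ * offMass G B) := by
          gcongr; exact trace_residual_le G hK hB
      _ = _ := by ring
  have h6 : entryInner Y C = 2 * entryInner Y (T * C) - entryInner Y (T * C * T) +
      entryInner Y (residual G B) := by
    conv_lhs => rw [hC, sub_truth_decomposition G, ← hT, ← hC, entryInner_add_right,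
      entryInner_sub_right, entryInner_add_right, h2]
    ring
  have h7 : ∑ b, ∑ k, mass G B b k * (2 * (∑ a, groupVec G k a * Y a b -
      ∑ a, groupVec G (G.label b) a * Y a b)) = 2 * entryInner Y (T * C) := by
    rw [h1, Finset.mul_sum]
    refine Finset.sum_congr rfl fun b _ => ?_
    rw [Finset.mul_sum]
    exact Finset.sum_congr rfl fun k _ => by ring
  rw [h6, h7, show 3 * ρ / (G.minSize : ℝ) = 2 * ρ / G.minSize + ρ / G.minSize by ring]
  linarith

/-- Control of `|B - B*|₁` by the mass of `B` outside the diagonal blocks. -/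
lemma sum_abs_sub_truth_le (hK : 0 < K) (hB : B ∈ feasible n K) :
    ∑ a, ∑ b, |B a b - truth G a b| ≤ 7 * (n / G.minSize) * offMass G B := by
  set T := truth G with hT
  set C := B - T with hC
  have hTt : Tᵀ = T := truth_transpose G
  have hCt : Cᵀ = C := by rw [hC, Matrix.transpose_sub, feasible_transpose hB, hTt]
  have hδ := offMass_nonneg G hB
  have hm : 0 < (G.minSize : ℝ) := by exact_mod_cast minSize_pos G hK
  -- On group k, column b of TC is constant and has ℓ¹ norm |mass of k - 1| or |mass of k|,
  -- according to whether k is the group of b; the two kinds each add up to the foreign mass of the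
  -- column.
  have hTC : ∑ a, ∑ b, |(T * C) a b| ≤ 2 * offMass G B := by
    have e : ∀ a b, (T * C) a b = ((G.group (G.label a)).card : ℝ)⁻¹ *
        (mass G B b (G.label a) - if G.label b = G.label a then 1 else 0) := by
      intro a b
      rw [hC, Matrix.mul_sub, hT, truth_mul_truth, Matrix.sub_apply, mul_sub, Matrix.mul_apply]
      congr 1
      · exact sum_groupVec_mul G _ _
      · simp [truth, groupVec]
    rw [Finset.sum_comm, offMass, Finset.mul_sum]
    refine Finset.sum_le_sum fun b _ => ?_
    simp_rw [e, abs_mul]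
    rw [sum_eq_sum_group G]
    have h1 : ∀ k, ∑ a ∈ G.group k, |((G.group (G.label a)).card : ℝ)⁻¹| *
        |mass G B b (G.label a) - if G.label b = G.label a then 1 else 0| =
        |mass G B b k - if G.label b = k then 1 else 0| := by
      intro k
      have hc := card_group_pos G k
      have : ∀ a ∈ G.group k, |((G.group (G.label a)).card : ℝ)⁻¹| *
        |mass G B b (G.label a) - if G.label b = G.label a then 1 else 0| =
        ((G.group k).card : ℝ)⁻¹ * |mass G B b k - if G.label b = k then 1 else 0| := by
        intro a ha
        rw [(mem_group G).1 ha, abs_of_nonneg (by positivity)]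
      rw [Finset.sum_congr rfl this, Finset.sum_const, nsmul_eq_mul, ← mul_assoc,
        mul_inv_cancel₀ (by positivity), one_mul]
    simp_rw [h1]
    rw [← Finset.add_sum_erase _ _ (Finset.mem_univ (G.label b))]
    have h2 : ∑ k ∈ Finset.univ.erase (G.label b),
        |mass G B b k - if G.label b = k then 1 else 0| = 1 - mass G B b (G.label b) := by
      rw [← sum_mass G hB b, ← Finset.add_sum_erase _ _ (Finset.mem_univ (G.label b)),
        add_sub_cancel_left]
      refine Finset.sum_congr rfl fun k hk => ?_
      rw [if_neg (Finset.ne_of_mem_erase hk).symm, sub_zero, abs_of_nonneg (mass_nonneg G hB b k)]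
    rw [h2, if_pos rfl, abs_sub_comm, abs_of_nonneg (sub_nonneg.2 (mass_le_one G hB b _))]
    linarith
  have hCT : ∑ a, ∑ b, |(C * T) a b| ≤ 2 * offMass G B := by
    have : C * T = (T * C)ᵀ := by rw [Matrix.transpose_mul, hTt, hCt]
    rw [this, Finset.sum_comm]
    exact hTC
  have hTCT : ∑ a, ∑ b, |(T * C * T) a b| ≤ 2 * offMass G B := by
    refine le_trans (Finset.sum_le_sum fun a _ => ?_) hTC
    calc ∑ b, |(T * C * T) a b| ≤ ∑ b, ∑ c, |(T * C) a c| * T c b := by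
          refine Finset.sum_le_sum fun b _ => ?_
          rw [Matrix.mul_apply]
          refine (Finset.abs_sum_le_sum_abs _ _).trans_eq (Finset.sum_congr rfl fun c _ => ?_)
          have hT0 : 0 ≤ T c b := groupVec_nonneg G _ _
          rw [abs_mul, abs_of_nonneg hT0]
      _ = ∑ c, |(T * C) a c| := by
          rw [Finset.sum_comm]
          refine Finset.sum_congr rfl fun c _ => ?_
          rw [← Finset.mul_sum, show ∑ b, T c b = 1 from sum_groupVec G _, mul_one]
  have hres : ∑ a, ∑ b, |residual G B a b| ≤ n / G.minSize * offMass G B := by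
    refine (sum_abs_posSemidef_le (residual_posSemidef G hB)).trans ?_
    calc _ ≤ n * ((G.minSize : ℝ)⁻¹ * offMass G B) := by
          gcongr; exact trace_residual_le G hK hB
      _ = _ := by ring
  have hpt : ∀ a b, |B a b - T a b| ≤
      |(T * C) a b| + |(C * T) a b| + |(T * C * T) a b| + |residual G B a b| := by
    intro a b
    have : B a b - T a b = (T * C) a b + (C * T) a b - (T * C * T) a b + residual G B a b := by
      have h := congrFun (congrFun (sub_truth_decomposition G (B := B)) a) b
      simpa [hC, hT] using h
    rw [this]
    refine (abs_add_le _ _).trans (add_le_add ((abs_sub _ _).trans ?_) le_rfl)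
    exact add_le_add (abs_add_le _ _) le_rfl
  -- The three projected terms cost 2δ each and the residual (n/m)δ; as n/m ≥ 1, the total is at
  -- most 7(n/m)δ.
  have hnm : 1 ≤ (n : ℝ) / G.minSize := by
    rw [le_div_iff₀ hm, one_mul]
    have h1 := mul_minSize_le G
    have h2 : G.minSize ≤ n := le_trans (Nat.le_mul_of_pos_left _ hK) h1
    exact_mod_cast h2
  have htot := Finset.sum_le_sum fun a (_ : a ∈ Finset.univ) =>
    Finset.sum_le_sum fun b (_ : b ∈ Finset.univ) => hpt a b
  simp only [Finset.sum_add_distrib] at htot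
  nlinarith

end Feasible

/-! ### From subset sums of scores to the mass, and from the mass to the clustering error. -/

section Deterministic

variable {n K : ℕ} (G : LabeledPartition n K) {B : Matrix (Fin n) (Fin n) ℝ}

/-- If the sums of `q + 1` scores are at most `θ (q + 1)`, the mean score under the off-diagonal
mass of `B` is at most `θ` up to an additive error proportional to `q`. -/
lemma sum_mass_mul_le_of_subset_sum_le (hB : B ∈ feasible n K) {y : Fin n → Fin K → ℝ}
    {θ : ℝ} (hθ : 0 ≤ θ) {q : ℕ} (hq : q + 1 ≤ n) (hy0 : ∀ b, y b (G.label b) = 0)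
    (hy : ∀ S : Finset (Fin n), S.card = q + 1 → ∀ κ : Fin n → Fin K,
      ∑ b ∈ S, y b (κ b) ≤ θ * (q + 1)) :
    ∑ b, ∑ k, mass G B b k * y b k ≤ θ * (offMass G B + 2 * q) := by
  classical
  have hmax : ∀ b, ∃ k, ∀ k', y b k' ≤ y b k := fun b => by
    have : Nonempty (Fin K) := ⟨G.label b⟩
    exact Finite.exists_max (y b)
  choose κ hκ using hmax
  have hM0 : ∀ b, 0 ≤ y b (κ b) := fun b => by rw [← hy0 b]; exact hκ b _
  set S : Finset (Fin n) := Finset.univ.filter fun b => θ < y b (κ b) with hS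
  -- If q + 1 points had a best score above θ, their sum would contradict `hy`.
  have hScard : S.card ≤ q := by
    by_contra hcon
    obtain ⟨T, hTS, hTc⟩ := Finset.exists_subset_card_eq (not_le.1 hcon : q + 1 ≤ S.card)
    have h1 := hy T hTc κ
    have h2 : ∑ b ∈ T, θ < ∑ b ∈ T, y b (κ b) := by
      refine Finset.sum_lt_sum_of_nonempty (Finset.card_pos.1 (by omega)) fun b hb => ?_
      exact (Finset.mem_filter.1 (hTS hb)).2
    rw [Finset.sum_const, hTc, nsmul_eq_mul] at h2
    push_cast at h2
    linarith
  have hSsum : ∑ b ∈ S, y b (κ b) ≤ θ * (2 * q) := by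
    rcases Nat.eq_zero_or_pos q with h0 | h0
    · have : S = ∅ := Finset.card_eq_zero.1 (by omega)
      simp [this, h0]
    -- S is completed to q + 1 points, the added ones keeping their own label and hence score 0.
    -- Then q + 1 ≤ 2q because q ≥ 1; for q = 0 the set S is empty.
    · obtain ⟨T, hST, hTc⟩ := Finset.exists_superset_card_eq (s := S) (n := q + 1) (by omega)
        (by simpa using hq)
      have h1 := hy T hTc fun b => if b ∈ S then κ b else G.label b
      have h2 : ∑ b ∈ S, y b (κ b) = ∑ b ∈ T, y b (if b ∈ S then κ b else G.label b) := by
        rw [← Finset.sum_subset hST fun b _ hb => by rw [if_neg hb, hy0]]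
        exact Finset.sum_congr rfl fun b hb => by rw [if_pos hb]
      rw [h2]
      refine h1.trans (mul_le_mul_of_nonneg_left ?_ hθ)
      have : (1 : ℝ) ≤ q := by exact_mod_cast h0
      linarith
  have hrow : ∀ b, ∑ k, mass G B b k * y b k ≤
      θ * (1 - mass G B b (G.label b)) + if b ∈ S then y b (κ b) else 0 := by
    intro b
    have hm1 := mass_nonneg G hB b (G.label b)
    have hm2 := mass_le_one G hB b (G.label b)
    by_cases hb : b ∈ S
    · rw [if_pos hb]
      refine (sum_mass_mul_le G hB b (hy0 b) fun k _ => hκ b k).trans ?_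
      have := hM0 b
      nlinarith [mul_nonneg hθ (sub_nonneg.2 hm2)]
    · rw [if_neg hb, add_zero]
      refine sum_mass_mul_le G hB b (hy0 b) fun k _ => (hκ b k).trans ?_
      simpa [hS] using hb
  calc _ ≤ ∑ b, (θ * (1 - mass G B b (G.label b)) + if b ∈ S then y b (κ b) else 0) :=
        Finset.sum_le_sum fun b _ => hrow b
    _ = θ * offMass G B + ∑ b ∈ S, y b (κ b) := by
        rw [Finset.sum_add_distrib, offMass, Finset.mul_sum, Finset.sum_ite_mem, Finset.univ_inter]
    _ ≤ _ := by linarith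

lemma matrix_mul_apply (M : Matrix (Fin K) (Fin n) ℝ) (a b : Fin n) :
    (G.matrix * M) a b = M (G.label a) b := by
  simp [Matrix.mul_apply, LabeledPartition.matrix, mem_group]

/-- The two rows are probability vectors with disjoint supports. -/
lemma sum_abs_truth_sub_truth {a a' : Fin n} (h : G.label a ≠ G.label a') :
    ∑ b, |truth G a b - truth G a' b| = 2 := by
  have h1 : ∀ b, |truth G a b - truth G a' b| =
      groupVec G (G.label a) b + groupVec G (G.label a') b := by
    intro b
    have e1 := groupVec_nonneg G (G.label a) b
    have e2 := groupVec_nonneg G (G.label a') b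
    simp only [truth, Matrix.of_apply]
    by_cases hb : G.label b = G.label a
    · have : groupVec G (G.label a') b = 0 := by rw [groupVec, if_neg (by rw [hb]; exact h)]
      rw [this, sub_zero, add_zero, abs_of_nonneg e1]
    · have : groupVec G (G.label a) b = 0 := by rw [groupVec, if_neg hb]
      rw [this, zero_sub, zero_add, abs_neg, abs_of_nonneg e2]
  simp_rw [h1]
  rw [Finset.sum_add_distrib, sum_groupVec, sum_groupVec]
  norm_num

/-- The comparison point is G itself with, in each group, the row of B closest to the row of B*: it
costs at most 2|B - B*|₁. The approximation factor and a triangle inequality give 15 = 7 · 2 + 1. -/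
lemma medoids_dist_truth_le {Ghat : LabeledPartition n K} {M : Matrix (Fin K) (Fin n) ℝ}
    (hM : IsApproxMedoids 7 B Ghat M) :
    ∑ a, ∑ b, |M (Ghat.label a) b - truth G a b| ≤
      15 * ∑ a, ∑ b, |B a b - truth G a b| := by
  set h : Fin n → ℝ := fun a => ∑ b, |B a b - truth G a b| with hh
  have hmin : ∀ k, ∃ r ∈ G.group k, ∀ a ∈ G.group k, h r ≤ h a := fun k =>
    Finset.exists_min_image _ _ (Finset.card_pos.1 (card_group_pos G k))
  choose r hr hrmin using hmin
  set M' : Matrix (Fin K) (Fin n) ℝ := Matrix.of fun k b => B (r k) b with hM'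
  have h1 := hM.2 G M' (by
    rintro _ ⟨k, rfl⟩
    exact ⟨r k, rfl⟩)
  have h2 : entryNorm1 (G.matrix * M' - B) ≤ 2 * ∑ a, h a := by
    rw [entryNorm1, Finset.mul_sum]
    refine Finset.sum_le_sum fun a _ => ?_
    have h3 : ∀ b, |(G.matrix * M' - B) a b| ≤
        |B (r (G.label a)) b - truth G (r (G.label a)) b| + |B a b - truth G a b| := by
      intro b
      have e : truth G (r (G.label a)) b = truth G a b := by
        simp only [truth, Matrix.of_apply, (mem_group G).1 (hr (G.label a))]
      rw [Matrix.sub_apply, matrix_mul_apply, e, hM', Matrix.of_apply]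
      calc _ = |(B (r (G.label a)) b - truth G a b) - (B a b - truth G a b)| := by congr 1; ring
        _ ≤ _ := abs_sub _ _
    refine (Finset.sum_le_sum fun b _ => h3 b).trans ?_
    rw [Finset.sum_add_distrib]
    have := hrmin (G.label a) a ((mem_group G).2 rfl)
    simp only [hh] at this ⊢
    linarith
  have h4 : entryNorm1 (Ghat.matrix * M - B) = ∑ a, ∑ b, |M (Ghat.label a) b - B a b| := by
    simp only [entryNorm1, Matrix.sub_apply, matrix_mul_apply]
  have h5 : ∑ a, ∑ b, |M (Ghat.label a) b - truth G a b| ≤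
      ∑ a, ∑ b, |M (Ghat.label a) b - B a b| + ∑ a, h a := by
    rw [← Finset.sum_add_distrib]
    refine Finset.sum_le_sum fun a _ => ?_
    rw [hh, ← Finset.sum_add_distrib]
    exact Finset.sum_le_sum fun b _ => abs_sub_le _ _ _
  rw [← h4] at h5
  linarith

/-- The misclassification proportion of approximate medoids on the rows of a matrix close to
the normalized membership matrix. -/
lemma err_le_of_medoids {Ghat : LabeledPartition n K} {M : Matrix (Fin K) (Fin n) ℝ} {η : ℝ}
    (hM : IsApproxMedoids 7 B Ghat M) (hη : ∑ a, ∑ b, |B a b - truth G a b| ≤ η)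
    (hm : 15 * η < G.minSize) : err Ghat G ≤ 15 * η / n := by
  classical
  set d : Fin n → ℝ := fun a => ∑ b, |M (Ghat.label a) b - truth G a b| with hd
  have hd0 : ∀ a, 0 ≤ d a := fun a => Finset.sum_nonneg fun b _ => abs_nonneg _
  set bad : Finset (Fin n) := Finset.univ.filter fun a => 1 ≤ d a with hbad
  have hbadcard : (bad.card : ℝ) ≤ 15 * η := by
    calc (bad.card : ℝ) = ∑ a ∈ bad, 1 := by simp
      _ ≤ ∑ a ∈ bad, d a := Finset.sum_le_sum fun a ha => (Finset.mem_filter.1 ha).2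
      _ ≤ ∑ a, d a := Finset.sum_le_sum_of_subset_of_nonneg (Finset.subset_univ _)
          fun a _ _ => hd0 a
      _ ≤ _ := (medoids_dist_truth_le G hM).trans (by linarith)
  -- There are fewer than m bad points, so no group consists of bad points only.
  have hgood : ∀ k, ∃ a, G.label a = k ∧ a ∉ bad := by
    intro k
    by_contra hcon
    push Not at hcon
    have h1 : G.group k ⊆ bad := fun a ha => hcon a ((mem_group G).1 ha)
    have h2 : (G.minSize : ℝ) ≤ bad.card := by
      exact_mod_cast (minSize_le G k).trans (Finset.card_le_card h1)
    linarith
  have hsep : ∀ a a', a ∉ bad → a' ∉ bad → Ghat.label a = Ghat.label a' →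
      G.label a = G.label a' := by
    intro a a' ha ha' hl
    by_contra hne
    have h1 : d a < 1 := by simpa [hbad] using ha
    have h2 : d a' < 1 := by simpa [hbad] using ha'
    have h3 := sum_abs_truth_sub_truth G hne
    have h4 : ∑ b, |truth G a b - truth G a' b| ≤ d a + d a' := by
      rw [hd, ← Finset.sum_add_distrib]
      refine Finset.sum_le_sum fun b _ => ?_
      rw [← hl, abs_sub_comm (M (Ghat.label a) b) (truth G a b)]
      exact abs_sub_le _ _ _
    linarith
  choose r hrl hrg using hgood
  -- Good points of different groups have different medoids, so one representative per group defines
  -- an injection of `Fin K` into itself, hence the permutation matching the two partitions.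
  have hinj : Function.Injective fun k => Ghat.label (r k) := by
    intro j k hjk
    have := hsep _ _ (hrg j) (hrg k) hjk
    rwa [hrl, hrl] at this
  set π : Equiv.Perm (Fin K) := Equiv.ofBijective _ (Finite.injective_iff_bijective.1 hinj) with hπ
  have hπapp : ∀ k, π k = Ghat.label (r k) := fun k => rfl
  have hπgood : ∀ a, a ∉ bad → π (G.label a) = Ghat.label a := by
    intro a ha
    obtain ⟨j, hj⟩ := π.surjective (Ghat.label a)
    have h1 := hsep (r j) a (hrg j) ha hj
    rw [hrl] at h1
    rw [← h1, hj]
  have hcount : ∑ k, ((symmDiff (G.group k) (Ghat.group (π k))).card : ℝ) ≤ 2 * bad.card := by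
    -- Only bad points are mismatched, and each is counted at most twice: in its true group and in
    -- the group matched with its estimated one.
    have h1 : ∀ k, ((symmDiff (G.group k) (Ghat.group (π k))).card : ℝ) ≤
        ∑ a ∈ bad, ((if G.label a = k then 1 else 0) +
          if π.symm (Ghat.label a) = k then 1 else 0) := by
      intro k
      have h2 : symmDiff (G.group k) (Ghat.group (π k)) ⊆
          bad.filter fun a => G.label a = k ∨ π.symm (Ghat.label a) = k := by
        intro a ha
        rw [Finset.mem_symmDiff, mem_group, mem_group] at ha
        have hab : a ∈ bad := by
          by_contra hab
          have h3 := hπgood a hab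
          rcases ha with ⟨h4, h5⟩ | ⟨h4, h5⟩
          · exact h5 (by rw [← h3, h4])
          · exact h5 (π.injective (by rw [h3, h4]))
        refine Finset.mem_filter.2 ⟨hab, ?_⟩
        rcases ha with ⟨h4, -⟩ | ⟨h4, -⟩
        · exact Or.inl h4
        · exact Or.inr (by rw [h4, Equiv.symm_apply_apply])
      calc ((symmDiff (G.group k) (Ghat.group (π k))).card : ℝ) ≤
            (bad.filter fun a => G.label a = k ∨ π.symm (Ghat.label a) = k).card := by
            exact_mod_cast Finset.card_le_card h2
        _ = ∑ a ∈ bad, if G.label a = k ∨ π.symm (Ghat.label a) = k then (1 : ℝ) else 0 := by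
            rw [Finset.sum_boole]
        _ ≤ _ := by
            refine Finset.sum_le_sum fun a _ => ?_
            by_cases h3 : G.label a = k <;> by_cases h4 : π.symm (Ghat.label a) = k <;>
              simp [h3, h4]
    refine (Finset.sum_le_sum fun k _ => h1 k).trans_eq ?_
    rw [Finset.sum_comm]
    simp [Finset.sum_add_distrib]
    ring
  have hbdd : BddBelow (Set.range fun π : Equiv.Perm (Fin K) =>
      1 / (2 * (n : ℝ)) * ∑ k, ((symmDiff (G.group k) (Ghat.group (π k))).card : ℝ)) :=
    (Set.finite_range _).bddBelow
  refine (ciInf_le hbdd π).trans ?_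
  calc _ ≤ 1 / (2 * (n : ℝ)) * (2 * (15 * η)) := by
        gcongr
        exact hcount.trans (by linarith)
    _ = _ := by
        rcases eq_or_ne (n : ℝ) 0 with h | h
        · simp [h]
        · field_simp

end Deterministic

/-! ### Discretization of the operator norm. -/

section Net

/-- A finite `1/2`-net of the unit ball of `ℝⁿ` with at most `5ⁿ` points. -/
lemma exists_net (n : ℕ) : ∃ s : Finset (EuclideanSpace ℝ (Fin n)), s.card ≤ 5 ^ n ∧
    (∀ x ∈ s, ‖x‖ ≤ 1) ∧ ∀ x : EuclideanSpace ℝ (Fin n), ‖x‖ ≤ 1 → ∃ y ∈ s, ‖x - y‖ ≤ 1 / 2 := by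
  classical
  set Pr : Finset (EuclideanSpace ℝ (Fin n)) → Prop := fun s =>
    (∀ x ∈ s, ‖x‖ ≤ 1) ∧ ∀ x ∈ s, ∀ y ∈ s, x ≠ y → 1 / 2 ≤ ‖x - y‖ with hPr
  have hcard : ∀ s, Pr s → s.card ≤ 5 ^ n := by
    intro s hs
    -- Doubling turns a 1/2-separated subset of the unit ball into a 1-separated subset of the ball
    -- of radius 2, the setting of the volume bound. A separated set of maximal cardinality is then
    -- a net.
    have h1 := Besicovitch.card_le_of_separated (s.image fun x => (2 : ℝ) • x) (by
      simp only [Finset.mem_image, forall_exists_index, and_imp]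
      rintro _ x hx rfl
      rw [norm_smul, Real.norm_ofNat]
      linarith [hs.1 x hx]) (by
      simp only [Finset.mem_image, forall_exists_index, and_imp]
      rintro _ x hx rfl _ y hy rfl hne
      have hxy : x ≠ y := fun h => hne (by rw [h])
      rw [← smul_sub, norm_smul, Real.norm_ofNat]
      linarith [hs.2 x hx y hy hxy])
    rwa [Finset.card_image_of_injective _ (smul_right_injective _ two_ne_zero),
      finrank_euclideanSpace_fin] at h1
  have hex : ∃ N s, Pr s ∧ s.card = N := ⟨0, ∅, by simp [hPr], rfl⟩
  obtain ⟨N, ⟨s, hs, hsN⟩, hNmax⟩ : ∃ N, (∃ s, Pr s ∧ s.card = N) ∧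
      ∀ N', (∃ s, Pr s ∧ s.card = N') → N' ≤ N := by
    have hb : ∀ N, (∃ s, Pr s ∧ s.card = N) → N ≤ 5 ^ n := by
      rintro N ⟨s, hs, rfl⟩; exact hcard s hs
    obtain ⟨N, hN⟩ := hex
    exact ⟨Nat.findGreatest (fun N => ∃ s, Pr s ∧ s.card = N) (5 ^ n),
      Nat.findGreatest_spec (P := fun N => ∃ s, Pr s ∧ s.card = N) (hb N hN) hN,
      fun N' hN' => Nat.le_findGreatest (hb N' hN') hN'⟩
  refine ⟨s, hcard s hs, hs.1, fun x hx => ?_⟩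
  by_contra hcon
  push Not at hcon
  have hxs : x ∉ s := fun h => by have := hcon x h; norm_num at this
  have hins : Pr (insert x s) := by
    refine ⟨fun y hy => ?_, fun y hy z hz hyz => ?_⟩
    · rcases Finset.mem_insert.1 hy with rfl | hy
      · exact hx
      · exact hs.1 y hy
    · rcases Finset.mem_insert.1 hy with rfl | hy' <;>
        rcases Finset.mem_insert.1 hz with rfl | hz'
      · exact absurd rfl hyz
      · exact (hcon z hz').le
      · rw [norm_sub_rev]; exact (hcon y hy').le
      · exact hs.2 y hy' z hz' hyz
  have := hNmax _ ⟨_, hins, rfl⟩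
  rw [Finset.card_insert_of_notMem hxs, hsN] at this
  omega

/-- A bilinear form bounded on a `1/2`-net is bounded. -/
lemma bilin_le_of_net {n : ℕ} {s : Finset (EuclideanSpace ℝ (Fin n))}
    (hnet : ∀ x : EuclideanSpace ℝ (Fin n), ‖x‖ ≤ 1 → ∃ y ∈ s, ‖x - y‖ ≤ 1 / 2)
    (Y : Matrix (Fin n) (Fin n) ℝ) {t : ℝ}
    (h : ∀ x ∈ s, ∀ y ∈ s, ∑ a, ∑ b, x a * y b * Y a b ≤ t) (x y : Fin n → ℝ) :
    ∑ a, ∑ b, x a * Y a b * y b ≤ (4 * t) / 2 * (∑ a, x a ^ 2 + ∑ a, y a ^ 2) := by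
  set T := Matrix.toEuclideanCLM (n := Fin n) (𝕜 := ℝ) Y with hT
  have hinner : ∀ x y : EuclideanSpace ℝ (Fin n),
      inner ℝ x (T y) = ∑ a, ∑ b, x a * Y a b * y b := by
    intro x y
    rw [hT, Matrix.inner_toEuclideanCLM]
    simp only [dotProduct, Matrix.mulVec, Finset.mul_sum, mul_assoc]
  have h' : ∀ x ∈ s, ∀ y ∈ s, inner ℝ x (T y) ≤ t := by
    intro x hx y hy
    rw [hinner]
    refine le_trans (le_of_eq ?_) (h x hx y hy)
    exact Finset.sum_congr rfl fun a _ => Finset.sum_congr rfl fun b _ => by ring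
  have h1 : ∀ y ∈ s, ‖T y‖ ≤ 2 * t := by
    intro y hy
    rcases eq_or_ne (T y) 0 with h0 | h0
    · obtain ⟨x, hx, -⟩ := hnet 0 (by simp)
      have := h' x hx y hy
      rw [h0, inner_zero_right] at this
      rw [h0, norm_zero]; linarith
    · have hpos : 0 < ‖T y‖ := norm_pos_iff.2 h0
      obtain ⟨x, hx, hxd⟩ := hnet ((‖T y‖)⁻¹ • T y) (by
        rw [norm_smul, norm_inv, norm_norm, inv_mul_cancel₀ hpos.ne'])
      have e1 : inner ℝ ((‖T y‖)⁻¹ • T y) (T y) = ‖T y‖ := by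
        rw [real_inner_smul_left, real_inner_self_eq_norm_sq]; field_simp
      have e2 : inner ℝ ((‖T y‖)⁻¹ • T y) (T y) =
          inner ℝ ((‖T y‖)⁻¹ • T y - x) (T y) + inner ℝ x (T y) := by
        rw [inner_sub_left]; ring
      have e3 := real_inner_le_norm ((‖T y‖)⁻¹ • T y - x) (T y)
      have e4 := h' x hx y hy
      have e5 : ‖(‖T y‖)⁻¹ • T y - x‖ * ‖T y‖ ≤ 1 / 2 * ‖T y‖ := by gcongr
      linarith
  have ht : 0 ≤ t := by
    obtain ⟨x, hx, -⟩ := hnet 0 (by simp)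
    have := (norm_nonneg _).trans (h1 x hx)
    linarith
  have h2 : ‖T‖ ≤ 4 * t := by
    -- The net is used once on each side of the form, and each use costs a factor 2.
    have h3 : ∀ x : EuclideanSpace ℝ (Fin n), ‖x‖ ≤ 1 → ‖T x‖ ≤ 2 * t + ‖T‖ / 2 := by
      intro x hx
      obtain ⟨y, hy, hxy⟩ := hnet x hx
      calc ‖T x‖ = ‖T y + T (x - y)‖ := by rw [← map_add]; congr 2; abel
        _ ≤ ‖T y‖ + ‖T (x - y)‖ := norm_add_le _ _
        _ ≤ 2 * t + ‖T‖ * ‖x - y‖ := add_le_add (h1 y hy) (T.le_opNorm _)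
        _ ≤ 2 * t + ‖T‖ * (1 / 2) := by gcongr
        _ = _ := by ring
    have h4 : ‖T‖ ≤ 2 * t + ‖T‖ / 2 :=
      ContinuousLinearMap.opNorm_le_of_unit_norm (by positivity) fun x hx => h3 x hx.le
    linarith
  have h5 := hinner (WithLp.toLp 2 x) (WithLp.toLp 2 y)
  have h6 : ∀ x : Fin n → ℝ, ‖WithLp.toLp 2 x‖ ^ 2 = ∑ i, x i ^ 2 := fun x => by
    rw [EuclideanSpace.norm_sq_eq]; simp
  rw [← h6, ← h6]
  calc ∑ a, ∑ b, x a * Y a b * y b = _ := h5.symm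
    _ ≤ ‖WithLp.toLp 2 x‖ * ‖T (WithLp.toLp 2 y)‖ := real_inner_le_norm _ _
    _ ≤ ‖WithLp.toLp 2 x‖ * (4 * t * ‖WithLp.toLp 2 y‖) := by
        gcongr
        exact (T.le_opNorm _).trans (by gcongr)
    _ ≤ _ := by nlinarith [sq_nonneg (‖WithLp.toLp 2 x‖ - ‖WithLp.toLp 2 y‖)]

end Net

/-! ### The optimality inequality on the event of controlled noise. -/

section Recovery

variable {Ω : Type*} {n K p : ℕ} {X : Fin n → Ω → EuclideanSpace ℝ (Fin p)}
  {G : LabeledPartition n K} {mu : Fin K → EuclideanSpace ℝ (Fin p)}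
  {Sigma : Fin K → Matrix (Fin p) (Fin p) ℝ} {B : Matrix (Fin n) (Fin n) ℝ}

/-- The squared distance between two centers. -/
noncomputable def sqDist (mu : Fin K → EuclideanSpace ℝ (Fin p)) (j k : Fin K) : ℝ :=
  ∑ i, (mu j i - mu k i) ^ 2

lemma sqDist_self (k : Fin K) : sqDist mu k k = 0 := by simp [sqDist]

lemma sqDist_nonneg (j k : Fin K) : 0 ≤ sqDist mu j k := by unfold sqDist; positivity

lemma minSep_nonneg : 0 ≤ minSep mu := Real.iInf_nonneg fun _ => norm_nonneg _

lemma minSep_sq_le {j k : Fin K} (h : j ≠ k) : minSep mu ^ 2 ≤ sqDist mu j k := by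
  have h1 : minSep mu ≤ ‖mu j - mu k‖ :=
    ciInf_le (f := fun q : {q : Fin K × Fin K // q.1 ≠ q.2} => ‖mu q.1.1 - mu q.1.2‖)
      (Set.finite_range _).bddBelow ⟨(j, k), h⟩
  have h2 : ‖mu j - mu k‖ ^ 2 = sqDist mu j k := by
    rw [EuclideanSpace.norm_sq_eq]; simp [sqDist]
  rw [← h2]
  exact pow_le_pow_left₀ minSep_nonneg h1 2

/-- The centers term of `⟨X Xᵀ, B - B*⟩`. -/
lemma entryInner_centers (hB : B ∈ feasible n K) :
    entryInner (Matrix.of fun a b => (mu (G.label a)).ofLp ⬝ᵥ (mu (G.label b)).ofLp)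
      (B - truth G) = -(1 / 2) * ∑ b, ∑ k, mass G B b k * sqDist mu k (G.label b) := by
  have h1 := sum_mul_sub_truth G hB fun k b => (mu k).ofLp ⬝ᵥ (mu (G.label b)).ofLp
  have h2 := sum_mul_sub_truth G hB fun k _ => (mu k).ofLp ⬝ᵥ (mu k).ofLp
  -- B and B* have the same row sums, so a matrix with constant rows is orthogonal to B - B*. This
  -- allows the squared norms of the centers to complete the inner products into squared distances.
  have h3 : ∑ a, ∑ b, (mu (G.label a)).ofLp ⬝ᵥ (mu (G.label a)).ofLp * (B - truth G) a b = 0 := by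
    refine Finset.sum_eq_zero fun a _ => ?_
    rw [← Finset.mul_sum]
    simp only [Matrix.sub_apply, Finset.sum_sub_distrib, feasible_row_sum hB]
    rw [show ∑ b, truth G a b = 1 from sum_groupVec G _, sub_self, mul_zero]
  rw [h3] at h2
  have h4 : ∀ k j, (mu k).ofLp ⬝ᵥ (mu j).ofLp - (mu j).ofLp ⬝ᵥ (mu j).ofLp =
      -(1 / 2) * sqDist mu k j +
        1 / 2 * ((mu k).ofLp ⬝ᵥ (mu k).ofLp - (mu j).ofLp ⬝ᵥ (mu j).ofLp) := by
    intro k j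
    simp only [sqDist, dotProduct, Finset.mul_sum, ← Finset.sum_sub_distrib,
      ← Finset.sum_add_distrib]
    exact Finset.sum_congr rfl fun i _ => by ring
  simp only [entryInner, Matrix.of_apply]
  rw [h1]
  simp_rw [h4, mul_add, Finset.sum_add_distrib]
  have h5 : ∑ b, ∑ k, mass G B b k * (1 / 2 * ((mu k).ofLp ⬝ᵥ (mu k).ofLp -
      (mu (G.label b)).ofLp ⬝ᵥ (mu (G.label b)).ofLp)) = 0 := by
    rw [← mul_zero (1 / 2 : ℝ), h2, Finset.mul_sum]
    refine Finset.sum_congr rfl fun b _ => ?_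
    rw [Finset.mul_sum]
    exact Finset.sum_congr rfl fun k _ => by ring
  rw [h5, add_zero, Finset.mul_sum]
  refine Finset.sum_congr rfl fun b _ => ?_
  rw [Finset.mul_sum]
  exact Finset.sum_congr rfl fun k _ => by ring

/-- The contribution of the diagonal correction. -/
lemma entryInner_diag_le (hK : 0 < K) (hB : B ∈ feasible n K) {D : Matrix (Fin n) (Fin n) ℝ}
    (hD : D.IsDiag) :
    entryInner D (B - truth G) ≤ 5 / 2 * vNorm D / G.minSize * offMass G B := by
  set V := vNorm D with hV
  set c := ((⨆ a, D a a) + ⨅ a, D a a) / 2 with hc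
  have hVa : ∀ a, |D a a - c| ≤ V / 2 := by
    intro a
    have h1 : D a a ≤ ⨆ a, D a a := le_ciSup (f := fun a => D a a) (Set.finite_range _).bddAbove a
    have h2 : ⨅ a, D a a ≤ D a a := ciInf_le (f := fun a => D a a) (Set.finite_range _).bddBelow a
    rw [abs_le, hV, hc, vNorm]
    constructor <;> linarith
  have hm : 0 < (G.minSize : ℝ) := by exact_mod_cast minSize_pos G hK
  have hn : 0 < n := by
    obtain ⟨a, -⟩ := G.surj ⟨0, hK⟩
    exact a.pos
  have hV0 : 0 ≤ V / 2 := (abs_nonneg _).trans (hVa ⟨0, hn⟩)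
  set Y : Matrix (Fin n) (Fin n) ℝ := Matrix.diagonal fun a => D a a - c with hY
  -- Tr B = Tr B*, so subtracting a multiple of the identity is free. The midpoint c leaves diagonal
  -- entries of size at most V/2.
  have hDY : entryInner D (B - truth G) = entryInner Y (B - truth G) := by
    have e1 : D = Y + Matrix.diagonal fun _ => c := by
      ext a b
      by_cases hab : a = b
      · subst hab; simp [hY]
      · simp [hY, hab, hD hab]
    have e2 : entryInner (Matrix.diagonal fun _ => c) (B - truth G) = 0 := by
      rw [entryInner_eq_trace, Matrix.diagonal_transpose, ← Matrix.smul_one_eq_diagonal,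
        smul_mul_assoc, one_mul, Matrix.trace_smul, Matrix.trace_sub, hB.2.1, truth_trace, sub_self,
        smul_zero]
    conv_lhs => rw [e1, entryInner_add_left, e2, add_zero]
  have hbil : ∀ x y : Fin n → ℝ, ∑ a, ∑ b, x a * Y a b * y b ≤
      (V / 2) / 2 * (∑ a, x a ^ 2 + ∑ a, y a ^ 2) := by
    intro x y
    rw [← Finset.sum_add_distrib, Finset.mul_sum]
    refine Finset.sum_le_sum fun a _ => ?_
    rw [Finset.sum_eq_single a (fun b _ hb => by simp [hY, hb.symm]) (by simp)]
    simp only [hY, Matrix.diagonal_apply_eq]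
    have h1 := hVa a
    have h2 : x a * (D a a - c) * y a ≤ |D a a - c| * (|x a| * |y a|) := by
      refine (le_abs_self _).trans_eq ?_
      rw [abs_mul, abs_mul]; ring
    have h3 : |x a| * |y a| ≤ (x a ^ 2 + y a ^ 2) / 2 := by
      nlinarith [sq_nonneg (|x a| - |y a|), sq_abs (x a), sq_abs (y a)]
    calc _ ≤ |D a a - c| * (|x a| * |y a|) := h2
      _ ≤ V / 2 * ((x a ^ 2 + y a ^ 2) / 2) := mul_le_mul h1 h3 (by positivity) hV0
      _ = _ := by ring
  have hmain := entryInner_sub_truth_le G hK hB (Y := Y) (Matrix.diagonal_transpose _) hV0 hbil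
  have hfirst : ∑ b, ∑ k, mass G B b k * (2 * (∑ a, groupVec G k a * Y a b -
      ∑ a, groupVec G (G.label b) a * Y a b)) ≤ V / G.minSize * offMass G B := by
    refine sum_sum_mass_mul_le G hB (by simp) fun b k hk => ?_
    have e : ∀ k, ∑ a, groupVec G k a * Y a b = groupVec G k b * (D b b - c) := by
      intro k
      rw [Finset.sum_eq_single b (fun a _ ha => by simp [hY, ha]) (by simp)]
      simp [hY]
    rw [e, e]
    have h1 : groupVec G k b = 0 := by rw [groupVec, if_neg hk.symm]
    have h2 : groupVec G (G.label b) b ≤ (G.minSize : ℝ)⁻¹ := by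
      rw [groupVec, if_pos rfl]; exact inv_card_group_le G hK _
    have h3 := groupVec_nonneg G (G.label b) b
    have h4 := (abs_le.1 (hVa b)).1
    have h5 : groupVec G (G.label b) b * (-(D b b - c)) ≤ (G.minSize : ℝ)⁻¹ * (V / 2) := by
      calc _ ≤ groupVec G (G.label b) b * (V / 2) := by gcongr; linarith
        _ ≤ _ := by gcongr
    rw [h1, div_eq_mul_inv]
    linarith
  rw [hDY]
  refine hmain.trans ?_
  have h6 : 5 / 2 * V / (G.minSize : ℝ) * offMass G B =
      V / G.minSize * offMass G B + 3 * (V / 2) / G.minSize * offMass G B := by ring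
  rw [h6]
  linarith

/-- On the event where the noise is under control, a solution of the program puts little mass
outside the diagonal blocks. -/
lemma offMass_le_of_noise_bounds (hK : 0 < K) {ω : Ω} {q : ℕ} (hq : q + 1 ≤ n)
    (hΔ : 0 < minSep mu)
    (hop : ∀ x y : Fin n → ℝ, ∑ a, ∑ b, x a * centeredGram X G mu Sigma ω a b * y b ≤
      (G.minSize * minSep mu ^ 2 / 32) / 2 * (∑ a, x a ^ 2 + ∑ a, y a ^ 2))
    (hlin : ∀ S : Finset (Fin n), S.card = q + 1 → ∀ κ : Fin n → Fin K,
      ∑ b ∈ S, (2 * (((mu (κ b)).ofLp - (mu (G.label b)).ofLp) ⬝ᵥ noise X G mu b ω) -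
        sqDist mu (κ b) (G.label b) / 32) ≤ minSep mu ^ 2 / 32 * (q + 1))
    (hquad : ∀ S : Finset (Fin n), S.card = q + 1 → ∀ κ : Fin n → Fin K,
      ∑ b ∈ S, 2 * (∑ a, groupVec G (κ b) a * centeredGram X G mu Sigma ω a b -
        ∑ a, groupVec G (G.label b) a * centeredGram X G mu Sigma ω a b) ≤
          minSep mu ^ 2 / 32 * (q + 1))
    {Γhat : Matrix (Fin n) (Fin n) ℝ} (hΓ : Γhat.IsDiag)
    (hV : 64 * vNorm (gammaMatrix G Sigma - Γhat) / (G.minSize : ℝ) ≤ minSep mu ^ 2)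
    (hB : IsPecokSolution K (dataMatrix fun a => X a ω) Γhat B) :
    offMass G B ≤ q := by
  obtain ⟨hB, hmax⟩ := hB
  set Δ2 := minSep mu ^ 2 with hΔ2
  have hΔ2pos : 0 < Δ2 := by positivity
  have hm : 0 < (G.minSize : ℝ) := by exact_mod_cast minSize_pos G hK
  set E := fun a => noise X G mu a ω with hE
  set W := centeredGram X G mu Sigma ω with hW
  set C := B - truth G with hC
  have hCt : Cᵀ = C := by
    rw [hC, Matrix.transpose_sub, feasible_transpose hB, truth_transpose]
  have hδ := offMass_nonneg G hB
  set c1 : Matrix (Fin n) (Fin n) ℝ :=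
    Matrix.of fun a b => (mu (G.label a)).ofLp ⬝ᵥ (mu (G.label b)).ofLp with hc1
  set c2 : Matrix (Fin n) (Fin n) ℝ := Matrix.of fun a b => (mu (G.label a)).ofLp ⬝ᵥ E b with hc2
  have hdecomp : dataMatrix (fun a => X a ω) * (dataMatrix fun a => X a ω)ᵀ - Γhat =
      c1 + c2 + c2ᵀ + W + (gammaMatrix G Sigma - Γhat) := by
    have hX : ∀ a i, X a ω i = mu (G.label a) i + E a i := fun a i => by simp [hE, noise]
    ext a b
    simp only [Matrix.sub_apply, Matrix.add_apply, Matrix.mul_apply, Matrix.transpose_apply,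
      dataMatrix, Matrix.of_apply, hc1, hc2, hW, centeredGram, dotProduct]
    have : ∑ i, X a ω i * X b ω i = ∑ i, mu (G.label a) i * mu (G.label b) i +
        ∑ i, mu (G.label a) i * E b i + ∑ i, mu (G.label b) i * E a i + ∑ i, E a i * E b i := by
      simp_rw [← Finset.sum_add_distrib, hX]
      exact Finset.sum_congr rfl fun i _ => by ring
    rw [this]
    ring
  have hpos : 0 ≤ entryInner (dataMatrix (fun a => X a ω) * (dataMatrix fun a => X a ω)ᵀ - Γhat)
      C := by
    have := hmax (truth_mem_feasible G)
    simp only [Set.mem_ofPred_eq] at this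
    rw [hC, entryInner_sub_right]
    linarith
  rw [hdecomp, entryInner_add_left, entryInner_add_left, entryInner_add_left,
    entryInner_add_left] at hpos
  set Q := ∑ b, ∑ k, mass G B b k * sqDist mu k (G.label b) with hQ
  have hsig : entryInner c1 C = -(1 / 2) * Q := entryInner_centers hB
  have hQlow : Δ2 * offMass G B ≤ Q := by
    have := sum_sum_mass_mul_le G hB (f := fun b k => -sqDist mu k (G.label b)) (c := -Δ2)
      (fun b => by simp [sqDist_self]) fun b k hk => neg_le_neg (minSep_sq_le hk)
    simp only [mul_neg, Finset.sum_neg_distrib] at this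
    linarith
  have hcross : entryInner c2 C = ∑ b, ∑ k, mass G B b k *
      (((mu k).ofLp - (mu (G.label b)).ofLp) ⬝ᵥ E b) := by
    simp_rw [sub_dotProduct]
    rw [← sum_mul_sub_truth G hB fun k b => (mu k).ofLp ⬝ᵥ E b]
    rfl
  have hcross' : entryInner c2ᵀ C = entryInner c2 C := by
    rw [← entryInner_transpose c2 C, hCt]
  have hWt : Wᵀ = W := by
    ext a b
    simp only [hW, centeredGram, Matrix.transpose_apply, Matrix.sub_apply, Matrix.of_apply,
      dotProduct_comm (noise X G mu b ω)]
    congr 1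
    by_cases hab : a = b
    · rw [hab]
    · simp [gammaMatrix, hab, Ne.symm hab]
  have hWle := entryInner_sub_truth_le G hK hB hWt (by positivity) hop
  have hdiag : (gammaMatrix G Sigma - Γhat).IsDiag := by
    intro a b hab
    rw [Matrix.sub_apply, hΓ hab, gammaMatrix, Matrix.diagonal_apply_ne _ hab, sub_zero]
  have hDle := entryInner_diag_le (G := G) hK hB hdiag
  -- The variance of the linear score grows with the squared distance of the two centers, which may
  -- far exceed Δ². A share Q/32 of the signal is spent inside the score to compensate it.
  set y : Fin n → Fin K → ℝ := fun b k =>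
    (2 * (((mu k).ofLp - (mu (G.label b)).ofLp) ⬝ᵥ E b) - sqDist mu k (G.label b) / 32) +
    2 * (∑ a, groupVec G k a * W a b - ∑ a, groupVec G (G.label b) a * W a b) with hy
  have hysum := sum_mass_mul_le_of_subset_sum_le G hB (y := y) (θ := Δ2 / 16) (by positivity) hq
    (fun b => by simp [hy, sqDist_self]) (fun S hS κ => by
      simp only [hy, Finset.sum_add_distrib]
      linarith [hlin S hS κ, hquad S hS κ])
  have hyexp : ∑ b, ∑ k, mass G B b k * y b k = 2 * entryInner c2 C - Q / 32 +
      ∑ b, ∑ k, mass G B b k * (2 * (∑ a, groupVec G k a * W a b -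
        ∑ a, groupVec G (G.label b) a * W a b)) := by
    rw [hcross, hQ, Finset.mul_sum, Finset.sum_div, ← Finset.sum_sub_distrib,
      ← Finset.sum_add_distrib]
    refine Finset.sum_congr rfl fun b _ => ?_
    rw [Finset.mul_sum, Finset.sum_div, ← Finset.sum_sub_distrib, ← Finset.sum_add_distrib]
    exact Finset.sum_congr rfl fun k _ => by simp only [hy]; ring
  have hop' : 3 * (G.minSize * Δ2 / 32) / G.minSize * offMass G B = 3 / 32 * Δ2 * offMass G B := by
    field_simp
  have hV' : 5 / 2 * vNorm (gammaMatrix G Sigma - Γhat) / G.minSize * offMass G B ≤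
      5 / 128 * Δ2 * offMass G B := by
    refine mul_le_mul_of_nonneg_right ?_ hδ
    calc _ = 5 / 128 * (64 * vNorm (gammaMatrix G Sigma - Γhat) / (G.minSize : ℝ)) := by ring
      _ ≤ _ := by gcongr
  rw [hop'] at hWle
  rw [hyexp] at hysum
  rw [hsig, hcross'] at hpos
  -- Of the signal, (1/2 - 1/32)Δ²δ remains, against (1/16 + 3/32 + 5/128)Δ²δ + Δ²q/8 from the
  -- noise; thus 35δ ≤ 16q.
  have hfin : Δ2 * offMass G B ≤ Δ2 * q := by
    have hq0 : 0 ≤ Δ2 * (q : ℝ) := by positivity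
    have hδ0 : 0 ≤ Δ2 * offMass G B := by positivity
    nlinarith
  exact le_of_mul_le_mul_left hfin hΔ2pos

end Recovery

/-! ### Chernoff and union bounds for the three bad events. -/

section Events

open ENNReal

variable {Ω : Type*} [MeasurableSpace Ω] {P : Measure Ω}

lemma measure_lt_le_eexp {f : Ω → ℝ} (hf : Measurable f) {l t c : ℝ} (hl : 0 ≤ l)
    (h : ∫⁻ ω, eexp (l * f ω) ∂P ≤ eexp c) : P {ω | t < f ω} ≤ eexp (c - l * t) := by
  have h1 := meas_ge_le_lintegral_div (μ := P) (f := fun ω => eexp (l * f ω))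
    (Measurable.aemeasurable (by fun_prop)) (eexp_ne_zero (l * t)) (eexp_ne_top _)
  calc P {ω | t < f ω} ≤ P {ω | eexp (l * t) ≤ eexp (l * f ω)} :=
        measure_mono fun ω (hω : t < f ω) => eexp_le (mul_le_mul_of_nonneg_left hω.le hl)
    _ ≤ (∫⁻ ω, eexp (l * f ω) ∂P) / eexp (l * t) := h1
    _ ≤ eexp c / eexp (l * t) := by gcongr
    _ = eexp (c - l * t) := by
        simp only [eexp]
        rw [← ENNReal.ofReal_div_of_pos (Real.exp_pos _), ← Real.exp_sub]

/-- Union bound over the subsets of a given size and the labelings of these subsets. -/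
lemma measure_exists_subset_sum_le {n K : ℕ} (d : Fin n → Fin K) (y : Ω → Fin n → Fin K → ℝ)
    (l : ℕ) (t : ℝ) (c : ℝ≥0∞)
    (h : ∀ S : Finset (Fin n), S.card = l → ∀ κ : Fin n → Fin K,
      P {ω | t < ∑ b ∈ S, y ω b (κ b)} ≤ c) :
    P {ω | ∃ S : Finset (Fin n), S.card = l ∧ ∃ κ : Fin n → Fin K,
      t < ∑ b ∈ S, y ω b (κ b)} ≤ (n.choose l * K ^ l : ℕ) * c := by
  classical
  -- Only the values of κ on S matter, which leaves K^l labelings; d is a filler off S.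
  set ext : (S : Finset (Fin n)) → (S → Fin K) → Fin n → Fin K :=
    fun S κ b => if hb : b ∈ S then κ ⟨b, hb⟩ else d b with hext
  have hsub : {ω | ∃ S : Finset (Fin n), S.card = l ∧ ∃ κ : Fin n → Fin K,
      t < ∑ b ∈ S, y ω b (κ b)} ⊆ ⋃ S ∈ Finset.powersetCard l (Finset.univ : Finset (Fin n)),
        ⋃ κ ∈ (Finset.univ : Finset (S → Fin K)), {ω | t < ∑ b ∈ S, y ω b (ext S κ b)} := by
    rintro ω ⟨S, hS, κ, hκ⟩
    simp only [Set.mem_iUnion]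
    refine ⟨S, Finset.mem_powersetCard.2 ⟨Finset.subset_univ _, hS⟩, fun b => κ b,
      Finset.mem_univ _, ?_⟩
    refine lt_of_lt_of_eq hκ (Finset.sum_congr rfl fun b hb => ?_)
    simp [hext, hb]
  refine (measure_mono hsub).trans ((measure_biUnion_finset_le _ _).trans ?_)
  calc _ ≤ ∑ S ∈ Finset.powersetCard l (Finset.univ : Finset (Fin n)),
          ((K ^ l : ℕ) : ℝ≥0∞) * c := by
        refine Finset.sum_le_sum fun S hS => ?_
        have hSc := (Finset.mem_powersetCard.1 hS).2
        refine (measure_biUnion_finset_le _ _).trans ?_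
        refine (Finset.sum_le_sum fun κ _ => h S hSc (ext S κ)).trans_eq ?_
        rw [Finset.sum_const, Finset.card_univ, Fintype.card_fun, Fintype.card_fin,
          Fintype.card_coe, hSc, nsmul_eq_mul]
    _ = _ := by
        rw [Finset.sum_const, Finset.card_powersetCard, Finset.card_univ, Fintype.card_fin,
          nsmul_eq_mul, ← mul_assoc]
        push_cast; rfl

/-- The binomial coefficient is at most n^l / l!, and l^l / l! ≤ e^l. -/
lemma choose_mul_pow_le_eexp {n K l : ℕ} (hl : 1 ≤ l) (hln : l ≤ n) (hK : 0 < K) :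
    ((n.choose l * K ^ l : ℕ) : ℝ≥0∞) ≤
      eexp (l * (1 + Real.log (n / l) + Real.log K)) := by
  have hl0 : (0 : ℝ) < l := by exact_mod_cast hl
  have hn0 : (0 : ℝ) < n := by exact_mod_cast lt_of_lt_of_le hl hln
  have hK0 : (0 : ℝ) < K := by exact_mod_cast hK
  rw [← ENNReal.ofReal_natCast]
  refine ENNReal.ofReal_le_ofReal ?_
  push_cast
  have h1 : (n.choose l : ℝ) ≤ (n : ℝ) ^ l / l.factorial := Nat.choose_le_pow_div l n
  have h2 := Real.pow_div_factorial_le_exp (l : ℝ) hl0.le l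
  have h3 : Real.exp (l * (1 + Real.log (n / l) + Real.log K)) =
      Real.exp l * ((n : ℝ) / l) ^ l * (K : ℝ) ^ l := by
    rw [show (l : ℝ) * (1 + Real.log (n / l) + Real.log K) =
      l + l * Real.log (n / l) + l * Real.log K by ring, Real.exp_add, Real.exp_add,
      Real.exp_nat_mul, Real.exp_nat_mul, Real.exp_log (by positivity), Real.exp_log hK0]
  rw [h3]
  gcongr
  calc (n.choose l : ℝ) ≤ (n : ℝ) ^ l / l.factorial := h1
    _ = (l : ℝ) ^ l / l.factorial * ((n : ℝ) / l) ^ l := by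
        rw [div_pow]; field_simp
    _ ≤ _ := by gcongr

/-- From log n = log(n/l) + log l and log l ≤ l one gets log n ≤ l(1 + log(n/l)). Hence even l = 1
leaves a failure probability of order 1/n². -/
lemma exp_neg_two_mul_le {n l : ℕ} (hl : 1 ≤ l) (hln : l ≤ n) {Λ : ℝ}
    (hΛ : 1 + Real.log (n / l) ≤ Λ) : Real.exp (-(2 * (l * Λ))) ≤ 1 / (n : ℝ) ^ 2 := by
  have hl1 : (1 : ℝ) ≤ l := by exact_mod_cast hl
  have hn0 : (0 : ℝ) < n := by exact_mod_cast lt_of_lt_of_le hl hln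
  have hlog : 0 ≤ Real.log (n / l) :=
    Real.log_nonneg (by rw [le_div_iff₀ (by linarith), one_mul]; exact_mod_cast hln)
  have h1 : Real.log n ≤ l * Λ := by
    have h2 : Real.log n = Real.log (n / l) + Real.log l := by
      rw [← Real.log_mul (by positivity) (by positivity)]; congr 1; field_simp
    have h3 := Real.log_le_self (x := (l : ℝ)) (by linarith)
    nlinarith
  have h4 : (1 : ℝ) / (n : ℝ) ^ 2 = Real.exp (-(2 * Real.log n)) := by
    rw [Real.exp_neg, show 2 * Real.log (n : ℝ) = ((2 : ℕ) : ℝ) * Real.log n by norm_num,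
      Real.exp_nat_mul, Real.exp_log hn0, one_div]
  rw [h4]
  exact Real.exp_le_exp.2 (by linarith)

lemma one_add_log_le_two_sqrt {u : ℝ} (hu : 0 < u) : 1 + Real.log u ≤ 2 * √u := by
  have h1 := Real.log_le_sub_one_of_pos (Real.sqrt_pos.2 hu)
  have h2 : Real.log u = 2 * Real.log √u := by
    rw [Real.log_sqrt hu.le]; ring
  linarith

/-- The entropy term `Λ` is dominated by the number of groups when weighted by `√(l / m)`. -/
lemma entropy_sq_mul_le {n K l m : ℝ} (hl : 0 < l) (hln : l ≤ n) (hm : 0 < m) (hK : 1 ≤ K)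
    (hKm : K * m ≤ n) :
    (1 + Real.log (n / l) + Real.log K) ^ 2 * (l / m) ≤ 16 * (n / m) ^ 2 := by
  have hn : 0 < n := hl.trans_le hln
  have hr : 1 ≤ n / m := by rw [le_div_iff₀ hm]; nlinarith
  have hKr : K ≤ n / m := by rwa [le_div_iff₀ hm]
  set a := 1 + Real.log (n / l) with ha
  set b := Real.log K with hb
  have ha0 : 0 ≤ a := by
    have := Real.log_nonneg (x := n / l) (by rw [le_div_iff₀ hl]; linarith)
    linarith
  have hb0 : 0 ≤ b := Real.log_nonneg hK
  have h1 : a ^ 2 ≤ 4 * (n / l) := by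
    have := one_add_log_le_two_sqrt (u := n / l) (by positivity)
    calc a ^ 2 ≤ (2 * √(n / l)) ^ 2 := pow_le_pow_left₀ ha0 this 2
      _ = _ := by rw [mul_pow, Real.sq_sqrt (by positivity)]; norm_num
  have h2 : b ^ 2 ≤ 4 * (n / m) := by
    have := one_add_log_le_two_sqrt (u := K) (by linarith)
    calc b ^ 2 ≤ (2 * √K) ^ 2 := pow_le_pow_left₀ hb0 (by linarith) 2
      _ = 4 * K := by rw [mul_pow, Real.sq_sqrt (by linarith)]; norm_num
      _ ≤ _ := by linarith
  have h3 : a ^ 2 * (l / m) ≤ 4 * (n / m) := by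
    calc a ^ 2 * (l / m) ≤ 4 * (n / l) * (l / m) := by gcongr
      _ = _ := by field_simp
  have h4 : b ^ 2 * (l / m) ≤ 4 * (n / m) * (n / m) := by gcongr
  have h5 : (a + b) ^ 2 * (l / m) ≤ (2 * a ^ 2 + 2 * b ^ 2) * (l / m) := by
    gcongr; nlinarith [sq_nonneg (a - b)]
  nlinarith

variable {n K p : ℕ} {X : Fin n → Ω → EuclideanSpace ℝ (Fin p)}
  {G : LabeledPartition n K} {mu : Fin K → EuclideanSpace ℝ (Fin p)}
  {Sigma : Fin K → Matrix (Fin p) (Fin p) ℝ} {L : ℝ≥0}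

lemma measurable_centeredGram (h : IsSubGaussianMixture P X G mu Sigma L) (a b : Fin n) :
    Measurable fun ω => centeredGram X G mu Sigma ω a b := by
  simp only [centeredGram, Matrix.sub_apply, Matrix.of_apply, dotProduct]
  refine Measurable.sub_const (Finset.measurable_fun_sum _ fun i _ => ?_) _
  exact (h.measurable_noise a i).mul (h.measurable_noise b i)

lemma measurable_dotProduct_noise (h : IsSubGaussianMixture P X G mu Sigma L) (a : Fin n)
    (v : Fin p → ℝ) : Measurable fun ω => v ⬝ᵥ noise X G mu a ω := by
  simp only [dotProduct]
  exact Finset.measurable_fun_sum _ fun i _ => (h.measurable_noise a i).const_mul _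

/-- Bound on the operator norm of `E Eᵀ - Γ`. -/
lemma measure_bilin_bad_le [IsProbabilityMeasure P] (h : IsSubGaussianMixture P X G mu Sigma L)
    (hL : 0 < L) {l t : ℝ} (hl : 0 ≤ l) (hσ : 256 * l ^ 2 * sigmaSq L Sigma ^ 2 ≤ 1)
    (hν : 1024 * l ^ 2 * nuSq L Sigma ^ 2 ≤ n) (hlt : 6 * n ≤ l * t) :
    P {ω | ¬ ∀ x y : Fin n → ℝ, ∑ a, ∑ b, x a * centeredGram X G mu Sigma ω a b * y b ≤
      (4 * t) / 2 * (∑ a, x a ^ 2 + ∑ a, y a ^ 2)} ≤ eexp (-n) := by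
  obtain ⟨s, hs, hs1, hnet⟩ := exists_net n
  have hsub : {ω | ¬ ∀ x y : Fin n → ℝ, ∑ a, ∑ b, x a * centeredGram X G mu Sigma ω a b * y b ≤
      (4 * t) / 2 * (∑ a, x a ^ 2 + ∑ a, y a ^ 2)} ⊆ ⋃ x ∈ s, ⋃ y ∈ s,
        {ω | t < ∑ a, ∑ b, x a * y b * centeredGram X G mu Sigma ω a b} := by
    intro ω hω
    by_contra hcon
    simp only [Set.mem_iUnion, not_exists, Set.mem_ofPred_eq, not_lt] at hcon
    exact hω fun x y => bilin_le_of_net hnet _ (fun x hx y hy => hcon x hx y hy) x y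
  have hone : ∀ x ∈ s, ∀ y ∈ s,
      P {ω | t < ∑ a, ∑ b, x a * y b * centeredGram X G mu Sigma ω a b} ≤ eexp (-(5 * n)) := by
    intro x hx y hy
    have hf : ∑ a, ∑ b, (Matrix.of (fun a b => x a * y b) : Matrix (Fin n) (Fin n) ℝ) a b ^ 2
        ≤ 1 := by
      simp only [Matrix.of_apply, mul_pow, ← Finset.mul_sum, ← Finset.sum_mul]
      have e : ∀ z : EuclideanSpace ℝ (Fin n), ∑ a, z a ^ 2 = ‖z‖ ^ 2 := fun z => by
        rw [EuclideanSpace.norm_sq_eq]; simp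
      rw [e, e]
      exact mul_le_one₀ (pow_le_one₀ (norm_nonneg _) (hs1 x hx)) (by positivity)
        (pow_le_one₀ (norm_nonneg _) (hs1 y hy))
    have h1 := h.lintegral_eexp_centeredGram_le hL _ hf (t := l) (by linarith)
    have hmeas : Measurable fun ω => ∑ a, ∑ b, x a * y b * centeredGram X G mu Sigma ω a b :=
      Finset.measurable_fun_sum _ fun a _ => Finset.measurable_fun_sum _ fun b _ =>
        (measurable_centeredGram h a b).const_mul _
    refine (measure_lt_le_eexp hmeas hl h1).trans (eexp_le ?_)
    linarith
  refine (measure_mono hsub).trans ((measure_biUnion_finset_le _ _).trans ?_)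
  calc _ ≤ ∑ x ∈ s, ∑ y ∈ s, eexp (-(5 * n)) :=
        Finset.sum_le_sum fun x hx => (measure_biUnion_finset_le _ _).trans
          (Finset.sum_le_sum fun y hy => hone x hx y hy)
    _ = ((s.card * s.card : ℕ) : ℝ≥0∞) * eexp (-(5 * n)) := by
        simp only [Finset.sum_const, nsmul_eq_mul]; push_cast; ring
    -- There are at most 25ⁿ pairs of net points and 5 ≤ e².
    _ ≤ eexp (4 * n) * eexp (-(5 * n)) := by
        gcongr
        rw [← ENNReal.ofReal_natCast]
        refine ENNReal.ofReal_le_ofReal ?_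
        have h1 : ((s.card * s.card : ℕ) : ℝ) ≤ ((5 ^ n * 5 ^ n : ℕ) : ℝ) := by
          exact_mod_cast Nat.mul_le_mul hs hs
        have h2 : (5 : ℝ) ≤ Real.exp 2 := by
          have := Real.quadratic_le_exp_of_nonneg (x := 2) (by norm_num)
          norm_num at this ⊢; linarith
        calc _ ≤ _ := h1
          _ = ((5 : ℝ) ^ n) * 5 ^ n := by push_cast; ring
          _ ≤ (Real.exp 2) ^ n * (Real.exp 2) ^ n := by gcongr
          _ = _ := by rw [← Real.exp_nat_mul, ← Real.exp_add]; congr 1; ring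
    _ = _ := by rw [← eexp_add]; congr 1; ring

/-- Bound on the sums of `l` linear scores. -/
lemma measure_linear_bad_le [IsProbabilityMeasure P] (h : IsSubGaussianMixture P X G mu Sigma L)
    (hK : 0 < K) {l : ℕ} (hl : 1 ≤ l) (hln : l ≤ n) {Λ D : ℝ} (hD : 0 < D)
    (hΛ : Λ = 1 + Real.log (n / l) + Real.log K) (hσ : 8192 * Λ * sigmaSq L Sigma ≤ D) :
    P {ω | ∃ S : Finset (Fin n), S.card = l ∧ ∃ κ : Fin n → Fin K, D / 32 * l <
      ∑ b ∈ S, (2 * (((mu (κ b)).ofLp - (mu (G.label b)).ofLp) ⬝ᵥ noise X G mu b ω) -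
        sqDist mu (κ b) (G.label b) / 32)} ≤ ENNReal.ofReal (1 / (n : ℝ) ^ 2) := by
  classical
  have hK1 : (1 : ℝ) ≤ K := by exact_mod_cast hK
  have hlogK : 0 ≤ Real.log K := Real.log_nonneg hK1
  have hl0 : (0 : ℝ) < l := by exact_mod_cast hl
  have hlog : 0 ≤ Real.log (n / l) :=
    Real.log_nonneg (by rw [le_div_iff₀ hl0, one_mul]; exact_mod_cast hln)
  have hΛ0 : 0 < Λ := by linarith
  have hσ0 := sigmaSq_nonneg L Sigma
  -- With this Chernoff parameter the threshold contributes r · (D/32) · l = 4lΛ, against the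
  -- entropy lΛ.
  set r := 128 * Λ / D with hr
  have hr0 : 0 ≤ r := by positivity
  have hone : ∀ S : Finset (Fin n), S.card = l → ∀ κ : Fin n → Fin K,
      P {ω | D / 32 * l <
        ∑ b ∈ S, (2 * (((mu (κ b)).ofLp - (mu (G.label b)).ofLp) ⬝ᵥ noise X G mu b ω) -
          sqDist mu (κ b) (G.label b) / 32)} ≤ eexp (-(4 * (l * Λ))) := by
    intro S hS κ
    set v : Fin n → Fin p → ℝ := fun b => (mu (κ b)).ofLp - (mu (G.label b)).ofLp with hv
    set T := ∑ b ∈ S, sqDist mu (κ b) (G.label b) with hT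
    have hT0 : 0 ≤ T := Finset.sum_nonneg fun b _ => sqDist_nonneg _ _
    set w : Fin n → Fin p → ℝ := fun b => if b ∈ S then (2 * r) • v b else 0 with hw
    have hw2 : ∑ b, ∑ i, w b i ^ 2 = 4 * r ^ 2 * T := by
      have e : ∀ b, ∑ i, w b i ^ 2 =
          if b ∈ S then 4 * r ^ 2 * sqDist mu (κ b) (G.label b) else 0 := by
        intro b
        by_cases hb : b ∈ S
        · simp only [hw, hb, if_true, Pi.smul_apply, smul_eq_mul, hv, Pi.sub_apply, sqDist,
            Finset.mul_sum]
          exact Finset.sum_congr rfl fun i _ => by ring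
        · simp [hw, hb]
      simp_rw [e]
      rw [Finset.sum_ite_mem, Finset.univ_inter, hT, Finset.mul_sum]
    have hform : ∀ ω, r * ∑ b ∈ S, (2 * (v b ⬝ᵥ noise X G mu b ω) -
        sqDist mu (κ b) (G.label b) / 32) =
        ∑ b, w b ⬝ᵥ noise X G mu b ω + -(r * T / 32) := by
      intro ω
      have e : ∀ b, w b ⬝ᵥ noise X G mu b ω =
          if b ∈ S then 2 * r * (v b ⬝ᵥ noise X G mu b ω) else 0 := by
        intro b
        by_cases hb : b ∈ S <;> simp [hw, hb]
      simp_rw [e]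
      rw [Finset.sum_ite_mem, Finset.univ_inter, Finset.sum_sub_distrib, ← Finset.sum_div, ← hT,
        ← Finset.mul_sum, ← Finset.mul_sum]
      ring
    have hmgf : ∫⁻ ω, eexp (r * ∑ b ∈ S, (2 * (v b ⬝ᵥ noise X G mu b ω) -
        sqDist mu (κ b) (G.label b) / 32)) ∂P ≤ eexp 0 := by
      simp_rw [hform, eexp_add]
      rw [lintegral_mul_const' _ _ (eexp_ne_top _)]
      calc _ ≤ eexp (sigmaSq L Sigma * (∑ a, ∑ i, w a i ^ 2) / 2) * eexp (-(r * T / 32)) := by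
            gcongr; exact h.lintegral_eexp_linear_noise_le w
        _ ≤ _ := by
            rw [← eexp_add]
            refine eexp_le ?_
            rw [hw2]
            -- This makes the Gaussian-type term 2r²Tσ² at most rT/32, the amount subtracted in the
            -- score.
            have h1 : 64 * r * sigmaSq L Sigma ≤ 1 := by
              rw [hr, show 64 * (128 * Λ / D) * sigmaSq L Sigma =
                (8192 * Λ * sigmaSq L Sigma) / D by ring, div_le_one hD]
              exact hσ
            have h2 : 0 ≤ r * T := mul_nonneg hr0 hT0
            nlinarith
    have hmeas : Measurable fun ω => ∑ b ∈ S, (2 * (v b ⬝ᵥ noise X G mu b ω) -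
        sqDist mu (κ b) (G.label b) / 32) :=
      Finset.measurable_fun_sum _ fun b _ =>
        ((measurable_dotProduct_noise h b _).const_mul _).sub_const _
    refine (measure_lt_le_eexp hmeas hr0 hmgf).trans (eexp_le (le_of_eq ?_))
    rw [hr]; field_simp; ring
  refine (measure_exists_subset_sum_le G.label (fun ω b k =>
    2 * (((mu k).ofLp - (mu (G.label b)).ofLp) ⬝ᵥ noise X G mu b ω) -
      sqDist mu k (G.label b) / 32) l _ _ hone).trans ?_
  calc _ ≤ eexp (l * Λ) * eexp (-(4 * (l * Λ))) := by
        gcongr; rw [hΛ]; exact choose_mul_pow_le_eexp hl hln hK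
    _ ≤ eexp (-(2 * (l * Λ))) := by
        rw [← eexp_add]; refine eexp_le ?_
        have : 0 ≤ l * Λ := by positivity
        linarith
    _ ≤ _ := ENNReal.ofReal_le_ofReal (exp_neg_two_mul_le hl hln (by linarith))

/-- Bound on the sums of `l` quadratic scores. -/
lemma measure_quadratic_bad_le [IsProbabilityMeasure P]
    (h : IsSubGaussianMixture P X G mu Sigma L) (hL : 0 < L)
    (hK : 0 < K) {l : ℕ} (hl : 1 ≤ l) (hln : l ≤ n) {Λ D : ℝ} (hD : 0 < D)
    (hΛ : Λ = 1 + Real.log (n / l) + Real.log K)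
    (hσ : 2 ^ 26 * (Λ ^ 2 * (l / G.minSize)) * sigmaSq L Sigma ^ 2 ≤ D ^ 2)
    (hν : 2 ^ 28 * Λ * nuSq L Sigma ^ 2 ≤ G.minSize * D ^ 2) :
    P {ω | ∃ S : Finset (Fin n), S.card = l ∧ ∃ κ : Fin n → Fin K, D / 32 * l <
      ∑ b ∈ S, 2 * (∑ a, groupVec G (κ b) a * centeredGram X G mu Sigma ω a b -
        ∑ a, groupVec G (G.label b) a * centeredGram X G mu Sigma ω a b)}
      ≤ ENNReal.ofReal (1 / (n : ℝ) ^ 2) := by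
  classical
  have hK1 : (1 : ℝ) ≤ K := by exact_mod_cast hK
  have hlogK : 0 ≤ Real.log K := Real.log_nonneg hK1
  have hl0 : (0 : ℝ) < l := by exact_mod_cast hl
  have hlog : 0 ≤ Real.log (n / l) :=
    Real.log_nonneg (by rw [le_div_iff₀ hl0, one_mul]; exact_mod_cast hln)
  have hΛ0 : 0 < Λ := by linarith
  have hm : 0 < (G.minSize : ℝ) := by exact_mod_cast minSize_pos G hK
  set r := 128 * Λ / D with hr
  have hr0 : 0 ≤ r := by positivity
  set f : ℝ := 16 * (l / G.minSize) with hf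
  have hone : ∀ S : Finset (Fin n), S.card = l → ∀ κ : Fin n → Fin K,
      P {ω | D / 32 * l <
        ∑ b ∈ S, 2 * (∑ a, groupVec G (κ b) a * centeredGram X G mu Sigma ω a b -
          ∑ a, groupVec G (G.label b) a * centeredGram X G mu Sigma ω a b)} ≤
        eexp (-(3 * (l * Λ))) := by
    intro S hS κ
    set N : Matrix (Fin n) (Fin n) ℝ := Matrix.of fun a b =>
      if b ∈ S then 2 * (groupVec G (κ b) a - groupVec G (G.label b) a) else 0 with hN
    -- Each of the l nonzero columns is twice a difference of two group vectors, of squared norm at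
    -- most 16/m.
    have hNf : ∑ a, ∑ b, N a b ^ 2 ≤ f := by
      rw [Finset.sum_comm]
      have e : ∀ b, ∑ a, N a b ^ 2 ≤ if b ∈ S then 16 * (G.minSize : ℝ)⁻¹ else 0 := by
        intro b
        by_cases hb : b ∈ S
        · simp only [hN, Matrix.of_apply, hb, if_true]
          calc _ ≤ ∑ a, (8 * groupVec G (κ b) a ^ 2 + 8 * groupVec G (G.label b) a ^ 2) := by
                refine Finset.sum_le_sum fun a _ => ?_
                nlinarith [sq_nonneg (groupVec G (κ b) a + groupVec G (G.label b) a)]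
            _ ≤ _ := by
                rw [Finset.sum_add_distrib, ← Finset.mul_sum, ← Finset.mul_sum, sum_groupVec_sq,
                  sum_groupVec_sq]
                linarith [inv_card_group_le G hK (κ b), inv_card_group_le G hK (G.label b)]
        · simp [hN, hb]
      refine (Finset.sum_le_sum fun b _ => e b).trans_eq ?_
      rw [Finset.sum_ite_mem, Finset.univ_inter, Finset.sum_const, hS, nsmul_eq_mul, hf]
      ring
    have hform : ∀ ω, ∑ b ∈ S, 2 * (∑ a, groupVec G (κ b) a * centeredGram X G mu Sigma ω a b -
        ∑ a, groupVec G (G.label b) a * centeredGram X G mu Sigma ω a b) =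
        ∑ a, ∑ b, N a b * centeredGram X G mu Sigma ω a b := by
      intro ω
      rw [Finset.sum_comm, ← Finset.univ_inter S, ← Finset.sum_ite_mem]
      refine Finset.sum_congr rfl fun b _ => ?_
      by_cases hb : b ∈ S
      · simp only [hN, Matrix.of_apply, hb, if_true]
        rw [← Finset.sum_sub_distrib, Finset.mul_sum]
        exact Finset.sum_congr rfl fun a _ => by ring
      · simp [hN, hb]
    have hcond : 256 * r ^ 2 * f * sigmaSq L Sigma ^ 2 ≤ 1 := by
      have e : 256 * r ^ 2 * f * sigmaSq L Sigma ^ 2 =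
          (2 ^ 26 * (Λ ^ 2 * (l / G.minSize)) * sigmaSq L Sigma ^ 2) / D ^ 2 := by
        rw [hr, hf]; ring
      rw [e, div_le_one (by positivity)]
      exact hσ
    have hmgf := h.lintegral_eexp_centeredGram_le hL N hNf hcond
    have hmeas : Measurable fun ω => ∑ a, ∑ b, N a b * centeredGram X G mu Sigma ω a b :=
      Finset.measurable_fun_sum _ fun a _ => Finset.measurable_fun_sum _ fun b _ =>
        (measurable_centeredGram h a b).const_mul _
    simp_rw [hform]
    refine (measure_lt_le_eexp hmeas hr0 hmgf).trans (eexp_le ?_)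
    -- The variance term costs lΛ of the 4lΛ given by the threshold, and the entropy another lΛ.
    have e1 : 1024 * r ^ 2 * f * nuSq L Sigma ^ 2 ≤ l * Λ := by
      have e : 1024 * r ^ 2 * f * nuSq L Sigma ^ 2 =
          l * Λ * ((2 ^ 28 * Λ * nuSq L Sigma ^ 2) / (G.minSize * D ^ 2)) := by
        rw [hr, hf]; field_simp; ring
      rw [e]
      exact mul_le_of_le_one_right (by positivity) ((div_le_one (by positivity)).2 hν)
    have e2 : r * (D / 32 * l) = 4 * (l * Λ) := by
      rw [hr]; field_simp; ring
    rw [e2]; linarith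
  refine (measure_exists_subset_sum_le G.label (fun ω b k =>
    2 * (∑ a, groupVec G k a * centeredGram X G mu Sigma ω a b -
      ∑ a, groupVec G (G.label b) a * centeredGram X G mu Sigma ω a b)) l _ _ hone).trans ?_
  calc _ ≤ eexp (l * Λ) * eexp (-(3 * (l * Λ))) := by
        gcongr; rw [hΛ]; exact choose_mul_pow_le_eexp hl hln hK
    _ ≤ eexp (-(2 * (l * Λ))) := by
        rw [← eexp_add]; exact eexp_le (by linarith)
    _ ≤ _ := ENNReal.ofReal_le_ofReal (exp_neg_two_mul_le hl hln (by linarith))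

end Events

/-! ### Choice of constants and assembly. -/

section Main

/-- The numerical consequences of a lower bound on the signal-to-noise ratio `s`, for clusters of
size at least `m` and at most `q ≤ n exp(-s / 2²⁹)` ambiguous points. -/
lemma snr_numerics {n m K q s : ℝ} (hm : 0 < m) (hK : 1 ≤ K) (hKm : K * m ≤ n)
    (hs : 2 ^ 37 * n / m ≤ s) (hq0 : 0 ≤ q) (hq : q ≤ n * Real.exp (-(s / 2 ^ 29)))
    (hq1 : n * Real.exp (-(s / 2 ^ 29)) < q + 1) :
    2 ^ 28 * (1 + Real.log (n / (q + 1)) + Real.log K) ≤ s ∧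
      15 * (7 * (n / m) * q) < m ∧
      15 * (7 * (n / m) * q) / n ≤ Real.exp (-(1 / 2 ^ 30) * s) := by
  have hn : 0 < n := lt_of_lt_of_le (by positivity) hKm
  set z := s / 2 ^ 29 with hz
  set r := n / m with hr
  have hr0 : 0 < r := by positivity
  have hKr : K ≤ r := by rwa [hr, le_div_iff₀ hm]
  have hrs : 2 ^ 37 * r ≤ s := by rw [hr, ← mul_div_assoc]; exact hs
  have hrz : 2 ^ 8 * r ≤ z := by rw [hz, le_div_iff₀ (by positivity)]; linarith
  have hz0 : 0 < z := lt_of_lt_of_le (by positivity) hrz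
  have hexp := Real.exp_pos (-z)
  have hexpz : Real.exp (-z) * Real.exp z = 1 := by rw [← Real.exp_add]; simp
  have hnm : n = r * m := by rw [hr]; field_simp
  refine ⟨?_, ?_, ?_⟩
  · have h1 : Real.log (n / (q + 1)) ≤ z := by
      -- The lower bound on q + 1 says that log(n/(q + 1)) ≤ z: the entropy per point is affordable
      -- precisely from this size on.
      rw [Real.log_le_iff_le_exp (by positivity), div_le_iff₀ (by positivity)]
      have := mul_lt_mul_of_pos_left hq1 (Real.exp_pos z)
      have e : Real.exp z * (n * Real.exp (-z)) = n := by
        rw [mul_left_comm, ← Real.exp_add]; simp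
      linarith
    have h2 := Real.log_le_sub_one_of_pos (lt_of_lt_of_le one_pos hK)
    have h3 : s = 2 ^ 29 * z := by rw [hz]; field_simp
    linarith
  · have h1 : z ^ 2 ≤ 2 * Real.exp z := by
      have := Real.pow_div_factorial_le_exp z hz0.le 2
      norm_num at this; linarith
    have h2 : r ^ 2 * Real.exp (-z) ≤ 2 / 2 ^ 16 := by
      have h3 : r ^ 2 ≤ 2 * Real.exp z / 2 ^ 16 := by
        rw [le_div_iff₀ (by positivity)]; nlinarith
      calc r ^ 2 * Real.exp (-z) ≤ 2 * Real.exp z / 2 ^ 16 * Real.exp (-z) := by gcongr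
        _ = 2 / 2 ^ 16 * (Real.exp (-z) * Real.exp z) := by ring
        _ = _ := by rw [hexpz, mul_one]
    calc 15 * (7 * r * q) ≤ 15 * (7 * r * (n * Real.exp (-z))) := by gcongr
      _ = 105 * (r ^ 2 * Real.exp (-z)) * m := by rw [hnm]; ring
      _ ≤ 105 * (2 / 2 ^ 16) * m := by gcongr
      _ < m := by linarith
  · have h1 : -(1 / 2 ^ 30) * s = -(z / 2) := by rw [hz]; ring
    -- Half of the exponent z is spent on the factor 105 n/m ≤ z/2 ≤ exp(z/2), whence 2³⁰ in place
    -- of 2²⁹.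
    have h2 := Real.add_one_le_exp (z / 2)
    have h3 : Real.exp (-z) * Real.exp (z / 2) = Real.exp (-(z / 2)) := by
      rw [← Real.exp_add]; congr 1; ring
    rw [h1, div_le_iff₀ hn, ← h3]
    calc 15 * (7 * r * q) ≤ 15 * (7 * r * (n * Real.exp (-z))) := by gcongr
      _ = (105 * r) * (Real.exp (-z) * n) := by ring
      _ ≤ Real.exp (z / 2) * (Real.exp (-z) * n) := by gcongr; linarith
      _ = _ := by ring

variable {Ω : Type*} [MeasurableSpace Ω] {P : Measure Ω} {n K p : ℕ}
  {X : Fin n → Ω → EuclideanSpace ℝ (Fin p)}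
  {G : LabeledPartition n K} {mu : Fin K → EuclideanSpace ℝ (Fin p)}
  {Sigma : Fin K → Matrix (Fin p) (Fin p) ℝ} {L : ℝ≥0}

/-- A quotient by 0 equals 0, so a positive signal-to-noise ratio forces σ² and ν² to be positive,
and the divisions can be cleared. -/
lemma snr_bounds (hs : 0 < snrSq G mu Sigma L) :
    sigmaSq L Sigma * snrSq G mu Sigma L ≤ minSep mu ^ 2 ∧
      nuSq L Sigma ^ 2 * snrSq G mu Sigma L ≤ G.minSize * (minSep mu ^ 2) ^ 2 ∧
      0 < minSep mu := by
  have h1 : snrSq G mu Sigma L ≤ minSep mu ^ 2 / sigmaSq L Sigma := min_le_left _ _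
  have h2 : snrSq G mu Sigma L ≤ G.minSize * minSep mu ^ 4 / nuSq L Sigma ^ 2 := min_le_right _ _
  have hσ : 0 < sigmaSq L Sigma := lt_of_le_of_ne (sigmaSq_nonneg L Sigma) fun h0 => by
    rw [← h0, div_zero] at h1; linarith
  have hν : 0 < nuSq L Sigma := lt_of_le_of_ne (nuSq_nonneg L Sigma) fun h0 => by
    rw [← h0, zero_pow two_ne_zero, div_zero] at h2; linarith
  rw [le_div_iff₀ hσ] at h1
  rw [le_div_iff₀ (by positivity)] at h2
  refine ⟨by linarith, by nlinarith, lt_of_le_of_ne minSep_nonneg fun h0 => ?_⟩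
  rw [← h0] at h1
  nlinarith [mul_pos hs hσ]

/-- With large probability the noise is under control, with `q = ⌊n exp(-s² / 2²⁹)⌋`. -/
lemma exists_event_of_snr [IsProbabilityMeasure P] (h : IsSubGaussianMixture P X G mu Sigma L)
    (hL : 0 < L) (hK : 0 < K) (hs : 2 ^ 37 * (n : ℝ) / G.minSize ≤ snrSq G mu Sigma L)
    {q : ℕ} (hq : q = ⌊(n : ℝ) * Real.exp (-(snrSq G mu Sigma L / 2 ^ 29))⌋₊) (hqn : q + 1 ≤ n) :
    ∃ S : Set Ω, MeasurableSet S ∧ 1 - 4 / (n : ℝ) ^ 2 ≤ P.real S ∧ ∀ ω ∈ S,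
      (∀ x y : Fin n → ℝ, ∑ a, ∑ b, x a * centeredGram X G mu Sigma ω a b * y b ≤
        (G.minSize * minSep mu ^ 2 / 32) / 2 * (∑ a, x a ^ 2 + ∑ a, y a ^ 2)) ∧
      (∀ S : Finset (Fin n), S.card = q + 1 → ∀ κ : Fin n → Fin K,
        ∑ b ∈ S, (2 * (((mu (κ b)).ofLp - (mu (G.label b)).ofLp) ⬝ᵥ noise X G mu b ω) -
          sqDist mu (κ b) (G.label b) / 32) ≤ minSep mu ^ 2 / 32 * (q + 1)) ∧
      (∀ S : Finset (Fin n), S.card = q + 1 → ∀ κ : Fin n → Fin K,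
        ∑ b ∈ S, 2 * (∑ a, groupVec G (κ b) a * centeredGram X G mu Sigma ω a b -
          ∑ a, groupVec G (G.label b) a * centeredGram X G mu Sigma ω a b) ≤
            minSep mu ^ 2 / 32 * (q + 1)) := by
  set s := snrSq G mu Sigma L with hsdef
  have hm : 0 < (G.minSize : ℝ) := by exact_mod_cast minSize_pos G hK
  have hK1 : (1 : ℝ) ≤ K := by exact_mod_cast hK
  have hKm : (K : ℝ) * G.minSize ≤ n := by exact_mod_cast mul_minSize_le G
  have hn : 0 < (n : ℝ) := by exact_mod_cast (by omega : 0 < n)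
  have hs0 : 0 < s := lt_of_lt_of_le (by positivity) hs
  obtain ⟨hσs, hνs, hΔ⟩ := snr_bounds hs0
  rw [← hsdef] at hσs hνs
  set D := minSep mu ^ 2 with hD
  have hD0 : 0 < D := by positivity
  set σ := sigmaSq L Sigma with hσdef
  set ν := nuSq L Sigma with hνdef
  have hσ0 : 0 ≤ σ := sigmaSq_nonneg L Sigma
  have hν0 : 0 ≤ ν := nuSq_nonneg L Sigma
  have hms : 2 ^ 37 * (n : ℝ) ≤ s * G.minSize := by rwa [div_le_iff₀ hm] at hs
  obtain ⟨hΛs, -, -⟩ := snr_numerics (q := q) hm hK1 hKm hs q.cast_nonneg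
    (by rw [hq]; exact Nat.floor_le (by positivity)) (by rw [hq]; exact Nat.lt_floor_add_one _)
  set Λ := 1 + Real.log (n / ((q : ℝ) + 1)) + Real.log K with hΛ
  have hl : ((q + 1 : ℕ) : ℝ) = q + 1 := by push_cast; rfl
  have hln : (q : ℝ) + 1 ≤ n := by exact_mod_cast hqn
  have hΛ0 : 0 ≤ Λ := by
    have h1 := Real.log_nonneg hK1
    have h2 : 0 ≤ Real.log (n / ((q : ℝ) + 1)) :=
      Real.log_nonneg (by rw [le_div_iff₀ (by positivity)]; linarith)
    linarith
  have hnσ : 2 ^ 37 * ((n : ℝ) * σ) ≤ G.minSize * D := by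
    calc 2 ^ 37 * ((n : ℝ) * σ) = (2 ^ 37 * n) * σ := by ring
      _ ≤ (s * G.minSize) * σ := by gcongr
      _ = G.minSize * (σ * s) := by ring
      _ ≤ _ := by gcongr
  have hnν : 2 ^ 37 * ((n : ℝ) * ν ^ 2) ≤ G.minSize ^ 2 * D ^ 2 := by
    calc 2 ^ 37 * ((n : ℝ) * ν ^ 2) = (2 ^ 37 * n) * ν ^ 2 := by ring
      _ ≤ (s * G.minSize) * ν ^ 2 := by gcongr
      _ = G.minSize * (ν ^ 2 * s) := by ring
      _ ≤ G.minSize * (G.minSize * D ^ 2) := by gcongr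
      _ = _ := by ring
  -- Chosen so that l t = 6n for t = mD/128; the factor 4 of the net argument then gives the
  -- operator norm bound mD/32.
  set l := 768 * (n : ℝ) / (G.minSize * D) with hldef
  have hbil := measure_bilin_bad_le h hL (l := l) (t := G.minSize * D / 128) (by positivity)
    (by
      have e : 256 * l ^ 2 * σ ^ 2 = ((12288 * (n * σ)) / (G.minSize * D)) ^ 2 := by
        rw [hldef]; ring
      rw [e]
      refine pow_le_one₀ (by positivity) ((div_le_one (by positivity)).2 (le_trans ?_ hnσ))
      have : 0 ≤ (n : ℝ) * σ := by positivity
      linarith)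
    (by
      have e : 1024 * l ^ 2 * ν ^ 2 =
          n * ((603979776 * (n * ν ^ 2)) / (G.minSize ^ 2 * D ^ 2)) := by
        rw [hldef]; field_simp; ring
      rw [e]
      refine mul_le_of_le_one_right hn.le ((div_le_one (by positivity)).2 (le_trans ?_ hnν))
      have : 0 ≤ (n : ℝ) * ν ^ 2 := by positivity
      linarith)
    (by rw [hldef]; field_simp; norm_num)
  have hlin := measure_linear_bad_le (l := q + 1) (Λ := Λ) h hK (by omega) hqn hD0
    (by rw [hl])
    (by
      calc 8192 * Λ * σ ≤ 2 ^ 28 * Λ * σ := by gcongr; norm_num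
        _ ≤ s * σ := by gcongr
        _ ≤ D := by linarith)
  have hquad := measure_quadratic_bad_le (l := q + 1) (Λ := Λ) h hL hK (by omega) hqn hD0
    (by rw [hl])
    (by
      rw [hl]
      have h1 := entropy_sq_mul_le (l := (q : ℝ) + 1) (by positivity) hln hm hK1 hKm
      rw [← hΛ] at h1
      calc 2 ^ 26 * (Λ ^ 2 * (((q : ℝ) + 1) / G.minSize)) * σ ^ 2
          ≤ 2 ^ 26 * (16 * (n / G.minSize) ^ 2) * σ ^ 2 := by gcongr
        _ = (2 ^ 15 * (n * σ) / G.minSize) ^ 2 := by ring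
        _ ≤ D ^ 2 := by
            refine pow_le_pow_left₀ (by positivity) ?_ 2
            rw [div_le_iff₀ hm, mul_comm D]
            refine le_trans ?_ hnσ
            have : 0 ≤ (n : ℝ) * σ := by positivity
            linarith)
    (by
      calc 2 ^ 28 * Λ * ν ^ 2 ≤ s * ν ^ 2 := by gcongr
        _ = ν ^ 2 * s := by ring
        _ ≤ _ := hνs)
  set b1 := {ω | ¬ ∀ x y : Fin n → ℝ, ∑ a, ∑ b, x a * centeredGram X G mu Sigma ω a b * y b ≤
      (4 * (G.minSize * D / 128)) / 2 * (∑ a, x a ^ 2 + ∑ a, y a ^ 2)} with hb1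
  set b2 := {ω | ∃ S : Finset (Fin n), S.card = q + 1 ∧ ∃ κ : Fin n → Fin K,
      D / 32 * (q + 1 : ℕ) <
      ∑ b ∈ S, (2 * (((mu (κ b)).ofLp - (mu (G.label b)).ofLp) ⬝ᵥ noise X G mu b ω) -
        sqDist mu (κ b) (G.label b) / 32)} with hb2
  set b3 := {ω | ∃ S : Finset (Fin n), S.card = q + 1 ∧ ∃ κ : Fin n → Fin K,
      D / 32 * (q + 1 : ℕ) <
      ∑ b ∈ S, 2 * (∑ a, groupVec G (κ b) a * centeredGram X G mu Sigma ω a b -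
        ∑ a, groupVec G (G.label b) a * centeredGram X G mu Sigma ω a b)} with hb3
  have hbad : P (b1 ∪ b2 ∪ b3) ≤ ENNReal.ofReal (4 / (n : ℝ) ^ 2) := by
    have hexp : Real.exp (-n) ≤ 2 / (n : ℝ) ^ 2 := by
      have := Real.pow_div_factorial_le_exp (n : ℝ) hn.le 2
      norm_num at this
      rw [le_div_iff₀ (by positivity), Real.exp_neg, inv_mul_le_iff₀ (Real.exp_pos _)]
      linarith
    calc P (b1 ∪ b2 ∪ b3) ≤ P b1 + P b2 + P b3 :=
          (measure_union_le _ _).trans (add_le_add (measure_union_le _ _) le_rfl)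
      _ ≤ ENNReal.ofReal (2 / (n : ℝ) ^ 2) + ENNReal.ofReal (1 / (n : ℝ) ^ 2) +
          ENNReal.ofReal (1 / (n : ℝ) ^ 2) :=
          add_le_add (add_le_add (hbil.trans (ENNReal.ofReal_le_ofReal hexp)) hlin) hquad
      _ = _ := by
          rw [← ENNReal.ofReal_add (by positivity) (by positivity),
            ← ENNReal.ofReal_add (by positivity) (by positivity)]
          congr 1; ring
  -- A measurable hull of the bad set has the same measure, so measurability of the bad events is
  -- never needed.
  refine ⟨(toMeasurable P (b1 ∪ b2 ∪ b3))ᶜ, (measurableSet_toMeasurable _ _).compl, ?_, ?_⟩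
  · rw [probReal_compl_eq_one_sub (measurableSet_toMeasurable _ _), measureReal_def,
      measure_toMeasurable]
    have := ENNReal.toReal_mono ENNReal.ofReal_ne_top hbad
    rw [ENNReal.toReal_ofReal (by positivity)] at this
    linarith
  · intro ω hω
    have hω' : ω ∉ b1 ∪ b2 ∪ b3 := fun hmem => hω (subset_toMeasurable _ _ hmem)
    simp only [Set.mem_union, not_or] at hω'
    obtain ⟨⟨h1, h2⟩, h3⟩ := hω'
    refine ⟨fun x y => ?_, fun S hS κ => ?_, fun S hS κ => ?_⟩
    · have h4 := not_not.1 h1 x y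
      rwa [show 4 * ((G.minSize : ℝ) * D / 128) = G.minSize * D / 32 by ring] at h4
    · by_contra hcon
      exact h2 ⟨S, hS, κ, by rw [hl]; exact not_le.1 hcon⟩
    · by_contra hcon
      exact h3 ⟨S, hS, κ, by rw [hl]; exact not_le.1 hcon⟩

end Main

end SubGMixture

theorem theorem1 :
    ∃ c c' c'' : ℝ, 0 < c ∧ 0 < c' ∧ 0 < c'' ∧
      ∀ (Ω : Type*) [MeasurableSpace Ω] (P : Measure Ω) [IsProbabilityMeasure P]
        (n K p : ℕ) (_hK : 2 ≤ K)
        (X : Fin n → Ω → EuclideanSpace ℝ (Fin p))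
        (G : SubGMixture.LabeledPartition n K)
        (mu : Fin K → EuclideanSpace ℝ (Fin p))
        (Sigma : Fin K → Matrix (Fin p) (Fin p) ℝ)
        (L : ℝ≥0) (_hL : 0 < L),
        SubGMixture.IsSubGaussianMixture P X G mu Sigma L →
        c'' * (n : ℝ) / (G.minSize : ℝ) ≤ SubGMixture.snrSq G mu Sigma L →
        -- one event of large probability works for all corrections and outputs at once
        ∃ S : Set Ω, MeasurableSet S ∧ 1 - c / (n : ℝ) ^ 2 ≤ P.real S ∧
          ∀ ω ∈ S, ∀ Γhat : Matrix (Fin n) (Fin n) ℝ, Γhat.IsDiag →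
            64 * SubGMixture.vNorm (SubGMixture.gammaMatrix G Sigma - Γhat) / (G.minSize : ℝ)
              ≤ SubGMixture.minSep mu ^ 2 →
            ∀ Ghat : SubGMixture.LabeledPartition n K,
              SubGMixture.IsClusteringOutput
                (SubGMixture.dataMatrix fun a => X a ω) Γhat Ghat →
              SubGMixture.err Ghat G ≤ Real.exp (-c' * SubGMixture.snrSq G mu Sigma L) := by
  refine ⟨4, 1 / 2 ^ 30, 2 ^ 37, by norm_num, by norm_num, by norm_num, ?_⟩
  intro Ω _ P _ n K p hK2 X G mu Sigma L hL h hs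
  have hK : 0 < K := by omega
  have hm : 0 < (G.minSize : ℝ) := by exact_mod_cast SubGMixture.minSize_pos G hK
  have hK1 : (1 : ℝ) ≤ K := by exact_mod_cast hK
  have hKm : (K : ℝ) * G.minSize ≤ n := by exact_mod_cast SubGMixture.mul_minSize_le G
  have hn : 0 < (n : ℝ) := lt_of_lt_of_le (by positivity) hKm
  have hs0 : 0 < SubGMixture.snrSq G mu Sigma L := lt_of_lt_of_le (by positivity) hs
  set q := ⌊(n : ℝ) * Real.exp (-(SubGMixture.snrSq G mu Sigma L / 2 ^ 29))⌋₊ with hq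
  have hqle : (q : ℝ) ≤ n * Real.exp (-(SubGMixture.snrSq G mu Sigma L / 2 ^ 29)) :=
    Nat.floor_le (by positivity)
  -- The strict inequality exp(-s²/2²⁹) < 1 guarantees that subsets of q + 1 points exist.
  have hqn : q + 1 ≤ n := by
    have h0 : 0 < SubGMixture.snrSq G mu Sigma L / 2 ^ 29 := by positivity
    have h1 : (q : ℝ) < n := lt_of_le_of_lt hqle
      (mul_lt_of_lt_one_right hn (Real.exp_lt_one_iff.2 (by linarith)))
    exact_mod_cast h1
  obtain ⟨-, hlt, hle⟩ := SubGMixture.snr_numerics hm hK1 hKm hs q.cast_nonneg hqle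
    (Nat.lt_floor_add_one _)
  obtain ⟨S, hSm, hSP, hSω⟩ := SubGMixture.exists_event_of_snr h hL hK hs hq hqn
  refine ⟨S, hSm, hSP, fun ω hω Γhat hΓ hV Ghat hout => ?_⟩
  obtain ⟨B, M, hB, hM⟩ := hout
  obtain ⟨h1, h2, h3⟩ := hSω ω hω
  have hδ := SubGMixture.offMass_le_of_noise_bounds hK hqn (SubGMixture.snr_bounds hs0).2.2
    h1 h2 h3 hΓ hV hB
  have hη := (SubGMixture.sum_abs_sub_truth_le G hK hB.1).trans
    (mul_le_mul_of_nonneg_left hδ (by positivity))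
  exact (SubGMixture.err_le_of_medoids G hM hη hlt).trans hle
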